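/- **Setting.** Let $\mathsf B$ be the stationary Bratteli diagram with vertices $v_1,v_2$ and edges $a_1,a_2,c_1,c_2,b$ on every level, where $a_1,a_2$ start at $v_1$; $c_1,c_2,b$ start at $v_2$; $a_1,c_1$ end at $v_1$; and $a_2,c_2,b$ end at $v_2$. Paths are written from right to left, $\Omega(\mathsf B)$ is the space of infinite paths $\ldots e_2e_1$, and $\xi=c_2^{\omega}$. The tile $\mathcal T_{i,n}$ has as vertices the paths of length $n$ ending in $v_i$. Thus $\mathcal T_{1,n+1}$ consists of copies $a_1\mathcal T_{1,n}$, $c_1\mathcal T_{2,n}$, and $\mathcal T_{2,n+1}$ of copies $a_2\mathcal T_{1,n}$, $b\mathcal T_{2,n}$, $c_2\mathcal T_{2,n}$. Let $G_0$ be the inverse semigroup of partial homeomorphisms of $\Omega(\mathsf B)$ defined by the tile inflation process with the following labels (here $i=1,2$, and $w$ is any continuation). * $S_{a_i}=S_{c_i}^{-1}:wa_i\mapsto wc_i$; $\;M:wb\leftrightarrow wc_2$; $\;S_b:wbb\leftrightarrow wc_2b$. * $L_{bb}:wbbb\leftrightarrow wc_2bb$; $\;L_{bbc_2}:wbbbc_2\leftrightarrow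 wc_2bbc_2$. * $L_{a_ia_1}=L_{c_ib}^{-1}:wa_ia_1\mapsto wc_ib$; $\;L_{a_ia_1c_1}=L_{c_ibc_2}^{-1}:wa_ia_1c_1\mapsto wc_ibc_2$. * The identities $L_{a_2},L_{a_2c_1},L_{a_2c_1c_2}$ of $\Omega(\mathsf B)a_2$, $\Omega(\mathsf B)a_2c_1$, $\Omega(\mathsf B)a_2c_1c_2$. * $L_{c_2}$, given by $\zeta c_2^k\mapsto F(\zeta)c_2^k$ for $k\ge1$ and $F\in\{L_{a_ia_1c_1},L_{c_ibc_2},L_{a_2c_1c_2},L_{bbc_2}\}$. A connector is a pair of finite paths whose prefixes are switched in this list, and the boundary points are the proper truncations of the points in connectors. After forgetting the indices of the labels, $\mathcal T_{1,n+1}$ and $\mathcal T_{2,n+1}$ ($n\ge2$) are obtained by joining $a_i\sigma_{1,n}$ to $c_i\sigma_{2,n}$ and $b\mu_{2,n}$ to $c_2\mu_{2,n}$ by edges labeled $L$ (and adding a loop at $a_2\lambda_{1,n}$), where $\lambda_{1,n}=c_1c_2^{n-1}$, $\sigma_{1,n}=a_1\lambda_{1,n-1}$, $\lambda_{2,n}=c_2^n$,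 $\sigma_{2,n}=b\lambda_{2,n-1}$, $\mu_{2,n}=b\sigma_{2,n-1}$. **Statement.** 1. *The action of $G_0$ is linearly repetitive.* There are $K>1$ and $R:\mathbb N\to\mathbb N$ with $R(r)<Kr$ for all integers $r\ge1$ such that for every $r\ge 1$, every $G_0$-regular $\zeta\in\Omega(\mathsf B)$ and every $\eta\in\Omega(\mathsf B)$ there is a vertex $\eta'$ at distance at most $R(r)$ from $\eta$ in its orbital graph for which the rooted labeled balls $B_\zeta(r)$ and $B_{\eta'}(r)$ are isomorphic. (A point $\zeta$ is $G_0$-regular if every $g\in G_0$ fixing $\zeta$ fixes a neighbourhood of $\zeta$ pointwise.) 2. *$G_0$ is of bounded type.* The process above is a tile inflation process with well-labeled connected tiles; the numbers of boundary points of the finite tiles are bounded; only finitely many points of $\Omega(\mathsf B)$ have all their truncations among the boundary points; and there is $C$ such that within distance $C\cdot\mathrm{Diam}(\mathcal T_{i,n})$ of every point of every infinite tile there is, in that infinite tile, an isomorphic copy of $\mathcal T_{i,n}$ ($i=1,2$, $n\ge 1$). 3. *After relabeling, $G_0$ becomes a group.* Relabel $S_{a_i},S_{c_i},S_b$ by $S$,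 keep $M$, and relabel all other labels by $L$. Letting each of $L,M,S$ act as the maps carrying its label, and identically where none of these is defined, gives homeomorphisms $L,M,S$ of $\Omega(\mathsf B)$. 4. *Growth of the fragmentation.* For $j=0,1,2$ let $P_{\xi,j}=\bigcup_{k\ge0}W_{3k+j}$, where $W_n=\{b,c_2\}^{\omega}b\,c_2^{\,n}$. Consider partitions $\Omega(\mathsf B)\setminus\{\xi\}=P_0\sqcup P_1\sqcup P_2$ into open $L$-invariant sets with $P_{\xi,j}\subset P_j$ such that, for each pair of distinct finite paths $x,y$ connected by an edge labeled $L$ when the tiles are inflated, the set $\Omega(\mathsf B)x$ lies in a single piece. Such partitions exist. For each of them there are homeomorphisms $L_0,L_1,L_2$ of $\Omega(\mathsf B)$ acting as $L$ on $P_0\cup P_1$, $P_0\cup P_2$, $P_1\cup P_2$, respectively, and as the identity elsewhere. Let $\gamma_G(R)$ be the number of elements of length at most $R$ of the group $G=\langle L_0,L_1,L_2,M,S\rangle$. Let $\beta=\frac{3+\sqrt5}2=\lim_{n\to\infty}|\mathcal T_{2,n}|^{1/n}$, and let $\eta\approx0.9028$ be the unique positive root of $x^5+x^4+x^3-2=0$.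 Then for every $$\alpha>\frac{\log\beta}{\log\beta-\log\eta}\approx0.9040$$ we have $\gamma_G(R)\preccurlyeq\exp(R^{\alpha})$, that is, there is $C\ge1$ with $\gamma_G(R)\le\exp((CR)^{\alpha})$ for all integers $R\ge1$. (Both approximations hold with error less than $0.00005$.) -/

import Mathlib

open Filter Topology

namespace TileInfl

/-! ### Stationary Bratteli diagrams and tile inflations

Finite paths are written with the last edge first: the list `[eₙ, …, e₂, e₁]` is the path that
runs first through `e₁` and last through `eₙ`, so that continuing a path `x` by an edge `e` gives
`e :: x`.  Infinite paths are sequences `γ 0, γ 1, …` of edges (`γ 0` is the first edge). -/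

/-- A tile inflation process on a stationary Bratteli diagram with vertices `V`, edges `E` and
labels `S`: the data.
* `bdry F x`: at the vertex `x` of a finite tile there is an outgoing boundary edge labeled `F`
  (and hence an incoming one labeled `inv F`);
* `conn F x y`: `(x, y, F)` is a connector, i.e. `x` and `y` are connecting points and an arrow
  `x → y` labeled `F` is added when the tile containing them is built.  For paths of length one
  these are the edges of the tiles of the first level.
The laws are collected in `Inflation.IsTileInflation`. -/
structure Inflation (V E S : Type) where
  src : E → V
  rng : E → V
  inv : S → S
  bdry : S → List E → Prop
  conn : S → List E → List E → Prop

namespace Inflation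

variable {V E S : Type} (T : Inflation V E S)

/-- Finite paths of the diagram (last edge first). -/
def IsPath (x : List E) : Prop := x.IsChain (fun e f => T.rng f = T.src e)

/-- The vertex set of the `n`-th level tile `𝒯_{v,n}` (`n ≥ 1`): the paths of length `n` that end
in `v`. -/
def Tile (v : V) (n : ℕ) : Type :=
  {x : List E // T.IsPath x ∧ x.length = n ∧ x.head?.map T.rng = some v}

/-- The labeled edges of the finite tiles: an edge comes from a connector, or is inherited from a
copy `e𝒯` of a tile `𝒯` of the previous level. -/
inductive TileEdge (F : S) : List E → List E → Prop
  | conn {x y : List E} : T.conn F x y → TileEdge F x y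
  | ext (e : E) {x y : List E} : TileEdge F x y → T.IsPath (e :: x) → T.IsPath (e :: y) →
      TileEdge F (e :: x) (e :: y)

/-- The finite tile as a simple graph (orientation, labels, loops and multiplicities forgotten);
used for distances, diameter and connectedness. -/
def tileGraph (v : V) (n : ℕ) : SimpleGraph (T.Tile v n) :=
  SimpleGraph.fromRel fun x y => ∃ F, T.TileEdge F x.1 y.1

/-- The laws of a tile inflation process. -/
structure IsTileInflation : Prop where
  src_surjective : Function.Surjective T.src
  rng_surjective : Function.Surjective T.rng
  inv_inv : ∀ F, T.inv (T.inv F) = F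
  /-- Connectors join two vertices of one and the same tile. -/
  conn_tile : ∀ F x y, T.conn F x y → T.IsPath x ∧ T.IsPath y ∧ x.length = y.length ∧
    ∃ v, x.head?.map T.rng = some v ∧ y.head?.map T.rng = some v
  conn_inv : ∀ F x y, T.conn F x y → T.conn (T.inv F) y x
  /-- Connectors join points whose truncations are boundary points with compatible edges. -/
  conn_admissible : ∀ F e f x y, T.conn F (e :: x) (f :: y) → x ≠ [] →
    T.bdry F x ∧ T.bdry (T.inv F) y
  bdry_path : ∀ F x, T.bdry F x → x ≠ [] ∧ T.IsPath x
  /-- Non-boundary points are not continued to boundary points. -/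
  bdry_tail : ∀ F e x, T.bdry F (e :: x) → x ≠ [] → T.bdry F x
  /-- A boundary point is continued to a boundary point or to a connecting point. -/
  bdry_continue : ∀ F x, T.bdry F x → ∃ e, T.bdry F (e :: x) ∨ ∃ y, T.conn F (e :: x) y
  /-- The tiles are well-labeled (boundary edges included; incoming edges by symmetry). -/
  edge_unique : ∀ F x y z, T.TileEdge F x y → T.TileEdge F x z → y = z
  edge_not_bdry : ∀ F x y, T.TileEdge F x y → ¬ T.bdry F x

/-! ### Infinite paths, infinite tiles, the inverse semigroup -/

/-- The space `Ω(𝖡)` of infinite paths. -/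
abbrev Omega : Type := {γ : ℕ → E // ∀ n, T.rng (γ n) = T.src (γ (n + 1))}

/-- The `n`-th truncation of an infinite path. -/
def trunc (γ : ℕ → E) : ℕ → List E
  | 0 => []
  | n + 1 => γ n :: trunc γ n

/-- The set `Ω(𝖡)x` of all infinite paths that begin with `x`. -/
def cyl (x : List E) : Set T.Omega := {γ | trunc γ.1 x.length = x}

/-- The labeled edges of the infinite tiles (inductive limits of the finite tiles).  As a relation
on `Ω(𝖡)` this is the graph of the partial homeomorphism defined by the label `F`. -/
def Edge (F : S) (η ζ : T.Omega) : Prop :=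
  ∃ n, T.TileEdge F (trunc η.1 n) (trunc ζ.1 n) ∧ ∀ k, n ≤ k → η.1 k = ζ.1 k

/-- The (disjoint) union of all infinite tiles, which are the orbital graphs of the inverse
semigroup, as a simple graph. -/
def graph : SimpleGraph T.Omega := SimpleGraph.fromRel fun η ζ => ∃ F, T.Edge F η ζ

/-- The inverse semigroup generated by the labels; a partial map is represented by its graph
`g η ζ ↔ g(η) = ζ`. -/
inductive InSemigroup : (T.Omega → T.Omega → Prop) → Prop
  | gen (F : S) : InSemigroup (T.Edge F)
  | symm {g : T.Omega → T.Omega → Prop} : InSemigroup g → InSemigroup (fun η ζ => g ζ η)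
  | comp {g h : T.Omega → T.Omega → Prop} : InSemigroup g → InSemigroup h →
      InSemigroup (fun η ζ => ∃ θ, g η θ ∧ h θ ζ)

/-- Regular points: every element of the inverse semigroup that fixes `ζ` fixes a neighbourhood of
`ζ` pointwise. -/
def IsRegular [TopologicalSpace E] (ζ : T.Omega) : Prop :=
  ∀ g, T.InSemigroup g → g ζ ζ → ∀ᶠ η in 𝓝 ζ, g η η

/-- The vertex set of the ball of radius `r` centred at `ζ` in its orbital graph. -/
def ball (ζ : T.Omega) (r : ℕ) : Set T.Omega := {η | T.graph.edist ζ η ≤ r}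

/-- The rooted labeled balls of radius `r` around `ζ` and `η` are isomorphic. -/
def BallIso (ζ η : T.Omega) (r : ℕ) : Prop :=
  ∃ φ : T.ball ζ r ≃ T.ball η r, (∀ u, u.1 = ζ → (φ u).1 = η) ∧
    ∀ F u v, T.Edge F u.1 v.1 ↔ T.Edge F (φ u).1 (φ v).1

/-- The action of the inverse semigroup is linearly repetitive. -/
def LinearlyRepetitive [TopologicalSpace E] : Prop :=
  ∃ K : ℝ, 1 < K ∧ ∃ R : ℕ → ℕ, (∀ r, 1 ≤ r → (R r : ℝ) < K * r) ∧
    ∀ r, 1 ≤ r → ∀ ζ, T.IsRegular ζ → ∀ η, ∃ η',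
      T.graph.edist η η' ≤ R r ∧ T.BallIso ζ η' r

/-- All finite tiles are linearly repetitive in all infinite tiles: within distance
`C · Diam(𝒯_{v,n})` of every point `η` of every infinite tile there is an isomorphic copy of
`𝒯_{v,n}` in that infinite tile. -/
def TilesLinearlyRepetitive : Prop :=
  ∃ C : ℕ, ∀ v n, 1 ≤ n → ∀ η : T.Omega, ∃ φ : T.Tile v n → T.Omega,
    Function.Injective φ ∧ (∀ F x y, T.TileEdge F x.1 y.1 → T.Edge F (φ x) (φ y)) ∧
    ∃ x, T.graph.edist η (φ x) ≤ (C * (T.tileGraph v n).diam : ℕ)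

/-- A tile inflation process of bounded type (with connected tiles). -/
structure IsBoundedType : Prop where
  isTileInflation : T.IsTileInflation
  connected : ∀ v n, 1 ≤ n → (T.tileGraph v n).Connected
  bdry_bounded : ∃ N : ℕ, ∀ v n, 1 ≤ n →
    {x : T.Tile v n | ∃ F, T.bdry F x.1}.encard ≤ N
  bdry_finite : {γ : T.Omega | ∀ n, 1 ≤ n → ∃ F, T.bdry F (trunc γ.1 n)}.Finite
  repetitive : T.TilesLinearlyRepetitive

end Inflation

/-- The growth function of the subgroup generated by `A`: the number of elements of the form
`s₁ ⋯ s_k` with `k ≤ R` and `sᵢ ∈ A ∪ A⁻¹`. -/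
noncomputable def growth {Γ : Type} [Group Γ] (A : Set Γ) (R : ℕ) : ℕ :=
  {g : Γ | ∃ l : List Γ, l.length ≤ R ∧ (∀ s ∈ l, s ∈ A ∨ s⁻¹ ∈ A) ∧ l.prod = g}.ncard

/-! ### The two-tile inflation -/

/-- The two vertices `v₁`, `v₂` of every level. -/
inductive Vert
  | one | two
  deriving DecidableEq

/-- The edges `a₁, a₂, c₁, c₂, b`. -/
inductive Edg
  | a (i : Vert) | c (i : Vert) | b
  deriving DecidableEq

instance : TopologicalSpace Edg := ⊥

instance : DiscreteTopology Edg := ⟨rfl⟩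

open Vert Edg

/-- `𝒯_{1,n+1}` consists of a copy `a₁𝒯_{1,n}` and a copy `c₁𝒯_{2,n}`; `𝒯_{2,n+1}` consists of
copies `a₂𝒯_{1,n}`, `b𝒯_{2,n}`, `c₂𝒯_{2,n}`. -/
def psrc : Edg → Vert
  | a _ => one
  | c _ => two
  | b => two

def prng : Edg → Vert
  | a i => i
  | c i => i
  | b => two

/-- The initial states of the automaton that defines `G₀`, before relabeling.  The names follow the
states: `Laac i` is `L_{aᵢa₁c₁}`, `Lcbc i` is `L_{cᵢbc₂}`, `Lacc` is `L_{a₂c₁c₂}`, `Lbbc` is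
`L_{bbc₂}`, `Laa i` is `L_{aᵢa₁}`, `Lcb i` is `L_{cᵢb}`, `Lac` is `L_{a₂c₁}`, `Lbb` is `L_{bb}`,
`La` is `L_{a₂}`, `Sa i`, `Sc i`, `Sb`, `M` are `S_{aᵢ}`, `S_{cᵢ}`, `S_b`, `M`, and `Lc` is the
directed state `L_{c₂}`. -/
inductive State
  | Lc
  | Laac (i : Vert) | Lcbc (i : Vert) | Lacc | Lbbc
  | Laa (i : Vert) | Lcb (i : Vert) | Lac | Lbb
  | La | Sa (i : Vert) | Sc (i : Vert) | Sb | M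

/-- The three labels after relabeling. -/
inductive Gen
  | L | M | S

def relabel : State → Gen
  | .Sa _ => .S
  | .Sc _ => .S
  | .Sb => .S
  | .M => .M
  | _ => .L

def stateInv : State → State
  | .Laac i => .Lcbc i
  | .Lcbc i => .Laac i
  | .Laa i => .Lcb i
  | .Lcb i => .Laa i
  | .Sa i => .Sc i
  | .Sc i => .Sa i
  | F => F

/-- The pairs `(x, y)` such that the finitary state `F` acts as the prefix switch `wx ↦ wy`. -/
inductive Switch : State → List Edg → List Edg → Prop
  | Laac (i : Vert) : Switch (.Laac i) [a i, a one, c one] [c i, b, c two]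
  | Lcbc (i : Vert) : Switch (.Lcbc i) [c i, b, c two] [a i, a one, c one]
  | Lacc : Switch .Lacc [a two, c one, c two] [a two, c one, c two]
  | Lbbc₁ : Switch .Lbbc [b, b, b, c two] [c two, b, b, c two]
  | Lbbc₂ : Switch .Lbbc [c two, b, b, c two] [b, b, b, c two]
  | Laa (i : Vert) : Switch (.Laa i) [a i, a one] [c i, b]
  | Lcb (i : Vert) : Switch (.Lcb i) [c i, b] [a i, a one]
  | Lac : Switch .Lac [a two, c one] [a two, c one]
  | Lbb₁ : Switch .Lbb [b, b, b] [c two, b, b]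
  | Lbb₂ : Switch .Lbb [c two, b, b] [b, b, b]
  | La : Switch .La [a two] [a two]
  | Sa (i : Vert) : Switch (.Sa i) [a i] [c i]
  | Sc (i : Vert) : Switch (.Sc i) [c i] [a i]
  | Sb₁ : Switch .Sb [b, b] [c two, b]
  | Sb₂ : Switch .Sb [c two, b] [b, b]
  | M₁ : Switch .M [b] [c two]
  | M₂ : Switch .M [c two] [b]

/-- The finitary states in the section of `L_{c₂}` at `c₂`. -/
def IsSection : State → Prop
  | .Laac _ => True
  | .Lcbc _ => True
  | .Lacc => True
  | .Lbbc => True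
  | _ => False

/-- The connectors.  A finitary state connects the pairs that it switches; the directed state
`L_{c₂}` reads and writes `c₂` at least once and then continues as one of the finitary states of
its section.  After relabeling this says that in the tiles of level `n + 1`, `n ≥ 2`, the label `L`
connects `aᵢσ_{1,n}` with `cᵢσ_{2,n}` and `bμ_{2,n}` with `c₂μ_{2,n}` (and has loops at
`a₂λ_{1,n}`), where `λ_{1,n} = c₁c₂ⁿ⁻¹`, `σ_{1,n} = a₁λ_{1,n-1}`, `λ_{2,n} = c₂ⁿ`,
`σ_{2,n} = bλ_{2,n-1}`, `μ_{2,n} = bσ_{2,n-1}`. -/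
def pconn (F : State) (x y : List Edg) : Prop :=
  Switch F x y ∨ (F = .Lc ∧ ∃ F' x' y' k, IsSection F' ∧ Switch F' x' y' ∧ 1 ≤ k ∧
    x = x' ++ List.replicate k (c two) ∧ y = y' ++ List.replicate k (c two))

/-- The two-tile inflation process.  Boundary points are the proper truncations of connecting
points. -/
def penrose : Inflation Vert Edg State where
  src := psrc
  rng := prng
  inv := stateInv
  bdry F x := x ≠ [] ∧ ∃ u z, u ≠ [] ∧ pconn F (u ++ x) z
  conn := pconn

/-- The point `ξ = c₂^ω`. -/
def xi : penrose.Omega := ⟨fun _ => c two, fun _ => rfl⟩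

/-- `X` is the triple of homeomorphisms `L, M, S` of `Ω(𝖡)` obtained by relabeling: each acts as all
the states relabeled by it, and identically where none of these states is defined. -/
def IsRelabeling (X : Gen → (penrose.Omega ≃ₜ penrose.Omega)) : Prop :=
  (∀ F η ζ, penrose.Edge F η ζ → X (relabel F) η = ζ) ∧
  ∀ g η, (∀ F ζ, relabel F = g → ¬ penrose.Edge F η ζ) → X g η = η

/-- The piece `P_j = ⋃ₖ W_{3k+j}` of `{b, c₂}^ω ∖ {ξ}`, where `W_n = {b, c₂}^ω b c₂ⁿ`. -/
def pieceXi (j : Fin 3) : Set penrose.Omega :=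
  {γ | (∀ m, γ.1 m = b ∨ γ.1 m = c two) ∧
    ∃ n, n % 3 = j.1 ∧ γ.1 n = b ∧ ∀ m, m < n → γ.1 m = c two}

/-- The partitions `P₀ ⊔ P₁ ⊔ P₂` of `Ω(𝖡) ∖ {ξ}` used to fragment `L`: the pieces are open and
`L`-invariant, contain the respective pieces of `{b, c₂}^ω ∖ {ξ}`, and every connection of the tiles
by an edge labeled `L` lies over a single piece. -/
structure IsPartition (L : penrose.Omega ≃ₜ penrose.Omega) (P : Fin 3 → Set penrose.Omega) :
    Prop where
  isOpen : ∀ j, IsOpen (P j)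
  disjoint : Pairwise fun i j => Disjoint (P i) (P j)
  iUnion : ⋃ j, P j = {xi}ᶜ
  invariant : ∀ j, ∀ η ∈ P j, L η ∈ P j
  contains : ∀ j, pieceXi j ⊆ P j
  uniform : ∀ F x y, relabel F = .L → penrose.conn F x y → x ≠ y → ∃ j, penrose.cyl x ⊆ P j

/-- `L₀, L₁, L₂` (the maps `N 0`, `N 1`, `N 2`) are the fragments of `L`: `L₀` acts as `L` on
`P₀ ∪ P₁`, `L₁` acts as `L` on `P₀ ∪ P₂`, `L₂` acts as `L` on `P₁ ∪ P₂`, and each of them is the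
identity elsewhere. -/
def IsFragmentation (L : penrose.Omega ≃ₜ penrose.Omega) (P : Fin 3 → Set penrose.Omega)
    (N : Fin 3 → (penrose.Omega ≃ₜ penrose.Omega)) : Prop :=
  (∀ η ∈ P 0 ∪ P 1, N 0 η = L η) ∧ (∀ η ∉ P 0 ∪ P 1, N 0 η = η) ∧
  (∀ η ∈ P 0 ∪ P 2, N 1 η = L η) ∧ (∀ η ∉ P 0 ∪ P 2, N 1 η = η) ∧
  (∀ η ∈ P 1 ∪ P 2, N 2 η = L η) ∧ (∀ η ∉ P 1 ∪ P 2, N 2 η = η)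

end TileInfl

namespace TileInfl
open Vert Edg

-- Everything is governed by the boundary points. From level 2 on, only λ_v, σ_v, μ₂ carry a
-- boundary type for L. One more edge either moves the type through a small automaton (λ₂ to λ_v or
-- σ₂, λ₁ to σ₁, σ₂ to μ₂), or makes a connecting point, or an interior point. So the next tiles are
-- rows of copies, a₁𝒯₁–c₁𝒯₂ and a₂𝒯₁–c₂𝒯₂–b𝒯₂, joined at the σ's and at μ₂ (`pconn_iff`,
-- `TE_cons`). The automaton sees only the relabeled generator, so edges stay unique after
-- relabeling (`TE.unique`) and L, M, S are well-defined involutions; they are continuous because a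
-- boundary point reads c₂ below its two topmost edges (`act_agree`).
--
-- Repetitivity: along a row of copies the distances between boundary points obey a linear recursion
-- (`qA`, `qB`, `qC`, `qD`). Walks give the upper bounds up to a constant factor
-- (`exists_wk_bound`), an explicit 1-Lipschitz function the lower ones (`dd_bp`, `dd_lipschitz`).
-- All these distances are comparable, with each other and with the diameters of the tiles. A ball
-- that is small compared with the level meets at most one boundary point of the tile of its centre
-- and passes there into at most one further tile. Hence it is determined by the position of its
-- centre and by what lies behind that boundary point (`Matched.ballIso`), and all that can lie
-- behind it occurs within five levels of any point (`exists_alike`).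
--
-- Growth: follow the paths of level n while a word of length R is read. Reading a fragment of L at
-- a boundary point is a visit, and consecutive visits to the same boundary point form a run. Within
-- a run the fragments multiply in the Klein four-group, whose nontrivial elements are active on
-- exactly two of the three pieces. A run at μ₂ matters on the next level only if its product is
-- active on the one piece containing that connection. With suitable weights the total weight of the
-- finished runs contracts by h from one level to the next, up to a multiple of the size of the tile
-- (`cost_succ_le`); the weights exist for h < 1 as soon as h⁵ + h⁴ + h³ > 2. Hence there are O(hⁿR
-- + βⁿ) runs on level n (`exists_cnt_le`).
--
-- A group element is recovered from a record with one log entry per run (`dec_record`,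
-- `prod_eq_of_record`), so there are at most exp(O(Y log Y)) elements, where Y bounds the numbers
-- of runs and of positions. Choosing n with (β/h)ⁿ ≈ R balances the two terms and gives Y of order
-- R to the power log β / (log β − log h). Letting h decrease to η, and absorbing the logarithm into
-- the exponent, gives every α above the stated bound.

/-- The types of the boundary points of the tiles: `l v`, `s v`, `m` stand for `λ_v`, `σ_v`, `μ₂`. -/
inductive Bd
  | l (v : Vert) | s (v : Vert) | m
  deriving DecidableEq

/-- The vertex at which the tile having the given boundary point ends. -/
def Bd.vert : Bd → Vert
  | .l v => v
  | .s v => v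
  | .m => two

/-- The boundary type (`none` if it is not a boundary point) of the continuation by an edge. -/
def stp : Edg → Option Bd → Option Bd
  | c v, some (.l two) => some (.l v)
  | b, some (.l two) => some (.s two)
  | a one, some (.l one) => some (.s one)
  | b, some (.s two) => some .m
  | _, _ => none

/-- The boundary type of the empty path. -/
def ini : Gen → Vert → Option Bd
  | .L, v => some (.l v)
  | .S, v => some (.s v)
  | .M, two => some .m
  | .M, one => none

/-- The boundary type of a path that ends in `v` with respect to a relabeled generator. -/
def sta (g : Gen) : List Edg → Vert → Option Bd
  | [], v => ini g v
  | e :: x, _ => stp e (sta g x (psrc e))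

/-- The exchange of `σ_{1,n}` and `σ_{2,n}`. -/
def cv : List Edg → List Edg
  | a one :: c one :: z => b :: c two :: z
  | [a one] => [b]
  | b :: c two :: z => a one :: c one :: z
  | [b] => [a one]
  | x => x

/-- The partner of `e :: x` across a connection, where `x` has the given boundary type. -/
def cr : Edg → Option Bd → List Edg → Option (List Edg)
  | a i, some (.s one), x => some (c i :: cv x)
  | c i, some (.s two), x => some (a i :: cv x)
  | b, some .m, x => some (c two :: x)
  | c two, some .m, x => some (b :: x)
  | a two, some (.l one), x => some (a two :: x)
  | _, _, _ => none

/-- The state that connects `e :: x` with its partner. -/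
def lab : Gen → Edg → Option Bd → ℕ → State
  | .M, _, _, _ => .M
  | .S, a i, _, _ => .Sa i
  | .S, c i, some (.s two), _ => .Sc i
  | .S, _, _, _ => .Sb
  | .L, a i, some (.s one), 1 => .Laa i
  | .L, a i, some (.s one), 2 => .Laac i
  | .L, c i, some (.s two), 1 => .Lcb i
  | .L, c i, some (.s two), 2 => .Lcbc i
  | .L, a two, some (.l one), 0 => .La
  | .L, a two, some (.l one), 1 => .Lac
  | .L, a two, some (.l one), 2 => .Lacc
  | .L, _, some .m, 2 => .Lbb
  | .L, _, some .m, 3 => .Lbbc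
  | .L, _, _, _ => .Lc

/-- The boundary points `λ_{v,n}`. -/
def lam : Vert → ℕ → List Edg
  | two, n => List.replicate n (c two)
  | one, 0 => []
  | one, n + 1 => c one :: List.replicate n (c two)

/-- The boundary points of the tiles of level `n ≥ 2`. -/
def bp : Bd → ℕ → List Edg
  | .l v, n => lam v n
  | .s one, n => a one :: lam one (n - 1)
  | .s two, n => b :: lam two (n - 1)
  | .m, n => b :: b :: lam two (n - 2)

-- The boundary automaton and the connectors.

@[simp] lemma sta_nil (g : Gen) (v : Vert) : sta g [] v = ini g v := rfl

@[simp] lemma sta_cons (g : Gen) (e : Edg) (x : List Edg) (v : Vert) :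
    sta g (e :: x) v = stp e (sta g x (psrc e)) := rfl

@[simp] lemma sta_rep (n : ℕ) : sta .L (List.replicate n (c two)) two = some (.l two) := by
  induction n with
  | zero => rfl
  | succ n ih => simp [List.replicate_succ, psrc, ih, stp]

lemma sta_rep_succ (n : ℕ) (v : Vert) :
    sta .L (List.replicate (n + 1) (c two)) v = some (.l two) := by
  simp [List.replicate_succ, psrc, stp]

lemma stp_eq_some {e : Edg} {o : Option Bd} {q : Bd} (h : stp e o = some q) :
    (∃ v, e = c v ∧ o = some (.l two) ∧ q = .l v) ∨ (e = b ∧ o = some (.l two) ∧ q = .s two) ∨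
    (e = a one ∧ o = some (.l one) ∧ q = .s one) ∨ (e = b ∧ o = some (.s two) ∧ q = .m) := by
  unfold stp at h
  split at h <;> simp_all

lemma cr_eq_some {e : Edg} {o : Option Bd} {x y : List Edg} (h : cr e o x = some y) :
    (∃ i, e = a i ∧ o = some (.s one) ∧ y = c i :: cv x) ∨
    (∃ i, e = c i ∧ o = some (.s two) ∧ y = a i :: cv x) ∨
    (e = b ∧ o = some .m ∧ y = c two :: x) ∨ (e = c two ∧ o = some .m ∧ y = b :: x) ∨
    (e = a two ∧ o = some (.l one) ∧ y = a two :: x) := by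
  unfold cr at h
  split at h <;> simp_all

lemma ini_S_eq_some {v : Vert} {q : Bd} : ini .S v = some q ↔ q = .s v := by
  simp [ini, eq_comm]

lemma ini_M_eq_some {v : Vert} {q : Bd} : ini .M v = some q ↔ v = two ∧ q = .m := by
  cases v <;> simp [ini, eq_comm]

lemma sta_M {x : List Edg} {v : Vert} {q : Bd} :
    sta .M x v = some q → x = [] ∧ v = two ∧ q = .m := by
  induction x generalizing v q with
  | nil => simp [ini_M_eq_some]
  | cons e x ih =>
    intro h
    rcases stp_eq_some h with ⟨_, _, h, _⟩ | ⟨_, h, _⟩ | ⟨_, h, _⟩ | ⟨_, h, _⟩ <;> simpa using ih h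

lemma sta_S {x : List Edg} {v : Vert} {q : Bd} :
    sta .S x v = some q → (x = [] ∧ q = .s v) ∨ (x = [b] ∧ q = .m) := by
  induction x generalizing v q with
  | nil => simp [ini_S_eq_some]
  | cons e x ih =>
    intro h
    rcases stp_eq_some h with ⟨_, _, h', _⟩ | ⟨_, h', _⟩ | ⟨_, h', _⟩ | ⟨rfl, h', rfl⟩ <;>
      have := ih h' <;> simp_all

lemma sta_L_l_two {x : List Edg} {v : Vert} (h : sta .L x v = some (.l two)) :
    x = List.replicate x.length (c two) ∧ (x = [] → v = two) := by
  induction x generalizing v with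
  | nil => simp [ini] at h; simp [h]
  | cons e x ih =>
    rcases stp_eq_some h with ⟨v, rfl, h, h'⟩ | ⟨_, h, h'⟩ | ⟨_, h, h'⟩ | ⟨_, h, h'⟩ <;> simp at h'
    subst h'
    have := (ih h).1
    simp [List.replicate_succ, ← this]

lemma sta_L_l_one {x : List Edg} {v : Vert} (h : sta .L x v = some (.l one)) :
    x = lam one x.length ∧ (x = [] → v = one) := by
  cases x with
  | nil => simp [ini] at h; simp [h, lam]
  | cons e x =>
    rcases stp_eq_some h with ⟨v, rfl, h, h'⟩ | ⟨_, h, h'⟩ | ⟨_, h, h'⟩ | ⟨_, h, h'⟩ <;> simp at h'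
    subst h'
    have := (sta_L_l_two h).1
    simp [lam, ← this]

/-- A path with a boundary type for `L` is the corresponding boundary point. -/
lemma sta_L {x : List Edg} {v : Vert} {q : Bd} (h : sta .L x v = some q) :
    x = bp q x.length ∧ (x = [] → q = .l v) := by
  cases q with
  | l w =>
    cases w
    · have := sta_L_l_one h; exact ⟨this.1, fun hx => by rw [this.2 hx]⟩
    · have := sta_L_l_two h; exact ⟨this.1, fun hx => by rw [this.2 hx]⟩
  | s w =>
    cases x with
    | nil => simp [ini] at h
    | cons e x =>
      rcases stp_eq_some h with ⟨v, rfl, h1, h'⟩ | ⟨rfl, h1, h'⟩ | ⟨rfl, h1, h'⟩ | ⟨rfl, h1, h'⟩ <;>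
        simp at h' <;> subst h'
      · have := (sta_L_l_two h1).1
        simp [bp, lam, ← this]
      · have := (sta_L_l_one h1).1
        simp [bp, ← this]
  | m =>
    cases x with
    | nil => simp [ini] at h
    | cons e x =>
      rcases stp_eq_some h with ⟨v, rfl, h, h'⟩ | ⟨rfl, h, h'⟩ | ⟨rfl, h, h'⟩ | ⟨rfl, h, h'⟩ <;>
        simp at h'
      cases x with
      | nil => simp [ini, psrc] at h
      | cons f x =>
        rcases stp_eq_some h with ⟨v, rfl, h, h'⟩ | ⟨rfl, h, h'⟩ | ⟨rfl, h, h'⟩ | ⟨rfl, h, h'⟩ <;>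
          simp at h'
        have := (sta_L_l_two h).1
        simp [bp, lam, ← this]

lemma sta_lam_succ (v w : Vert) (n : ℕ) : sta .L (lam v (n + 1)) w = some (.l v) := by
  cases v
  · simp [lam, psrc, stp]
  · simp [lam, sta_rep_succ]

lemma sta_bp {n : ℕ} (hn : 2 ≤ n) (q : Bd) (v : Vert) : sta .L (bp q n) v = some q := by
  obtain ⟨n, rfl⟩ := Nat.exists_eq_add_of_le' hn
  cases q with
  | l w => exact sta_lam_succ _ _ _
  | s w => cases w <;> simp [bp, sta_lam_succ, stp]
  | m => simp [bp, lam, psrc, stp]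

lemma lam_length (v : Vert) (n : ℕ) : (lam v n).length = n := by
  cases v <;> cases n <;> simp [lam]

lemma bp_length {n : ℕ} (hn : 2 ≤ n) (q : Bd) : (bp q n).length = n := by
  obtain ⟨n, rfl⟩ := Nat.exists_eq_add_of_le' hn
  cases q with
  | l w => simp [bp, lam_length]
  | s w => cases w <;> simp [bp, lam_length]
  | m => simp [bp, lam_length]

/-- Level 2 is the first on which all five types occur, since μ₂ has two edges b above a power of
c₂. -/
lemma sta_L_iff {n : ℕ} (hn : 2 ≤ n) {x : List Edg} (hx : x.length = n) {v : Vert} {q : Bd} :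
    sta .L x v = some q ↔ x = bp q n := by
  constructor
  · intro h; rw [← hx]; exact (sta_L h).1
  · rintro rfl; exact sta_bp hn q v

/-- The longest boundary path for M is empty and the one for S is `[b]`. So from level 2 on only L
can lead out of a tile. -/
lemma sta_ne_L {x : List Edg} (hx : 2 ≤ x.length) (v : Vert) {g : Gen} (hg : g ≠ .L) :
    sta g x v = none := by
  by_contra h
  obtain ⟨q, hq⟩ := Option.ne_none_iff_exists'.1 h
  cases g
  · exact hg rfl
  · have := sta_M hq; simp [this] at hx
  · rcases sta_S hq with ⟨h, _⟩ | ⟨h, _⟩ <;> simp [h] at hx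

/-- The connectors in terms of boundary types. -/
theorem pconn_iff {F : State} {z y : List Edg} : pconn F z y ↔
    ∃ g e x, z = e :: x ∧ cr e (sta g x (psrc e)) x = some y ∧
      F = lab g e (sta g x (psrc e)) x.length := by
  constructor
  · rintro (h | ⟨rfl, F', x', y', k, h1, h2, h3, rfl, rfl⟩)
    · cases h
      case Sa => exact ⟨.S, _, _, rfl, rfl, rfl⟩
      case Sc => exact ⟨.S, _, _, rfl, rfl, rfl⟩
      case Sb₁ => exact ⟨.S, _, _, rfl, rfl, rfl⟩
      case Sb₂ => exact ⟨.S, _, _, rfl, rfl, rfl⟩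
      case M₁ => exact ⟨.M, _, _, rfl, rfl, rfl⟩
      case M₂ => exact ⟨.M, _, _, rfl, rfl, rfl⟩
      all_goals exact ⟨.L, _, _, rfl, rfl, rfl⟩
    · obtain ⟨k, rfl⟩ := Nat.exists_eq_add_of_le' h3
      cases h2 <;> first | exact h1.elim | skip
      all_goals
        refine ⟨.L, _, _, rfl, ?_, ?_⟩ <;>
          simp [psrc, stp, sta_rep_succ, cr, cv, lab]
  · rintro ⟨g, e, x, rfl, h, rfl⟩
    cases g
    · rcases cr_eq_some h with ⟨i, rfl, hq, rfl⟩ | ⟨i, rfl, hq, rfl⟩ | ⟨rfl, hq, rfl⟩ |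
        ⟨rfl, hq, rfl⟩ | ⟨rfl, hq, rfl⟩ <;> rw [hq]
      -- The length of the boundary point decides the state: short ones belong to the finitary
      -- states, and a longer one to the directed state, with `k` counting the edges c₂ below the
      -- switched prefix.
      · rcases x with _ | ⟨e, _ | ⟨e', _ | ⟨e'', x⟩⟩⟩ <;> have h' := (sta_L hq) <;>
          simp [bp, lam] at h' ⊢
        · subst h'; exact .inl (.Laa _)
        · obtain ⟨rfl, rfl⟩ := h'; exact .inl (.Laac _)
        · obtain ⟨rfl, rfl, h'⟩ := h'
          rw [h']
          refine .inr ⟨rfl, _, _, _, x.length + 1, ?_, Switch.Laac i, by simp, ?_, ?_⟩ <;>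
            simp [IsSection, List.replicate_succ, cv]
      · rcases x with _ | ⟨e, _ | ⟨e', _ | ⟨e'', x⟩⟩⟩ <;> have h' := (sta_L hq) <;>
          simp [bp, lam, List.replicate_succ] at h' ⊢
        · subst h'; exact .inl (.Lcb _)
        · obtain ⟨rfl, rfl⟩ := h'; exact .inl (.Lcbc _)
        · obtain ⟨rfl, rfl, rfl, h'⟩ := h'
          rw [h']
          refine .inr ⟨rfl, _, _, _, x.length + 1, ?_, Switch.Lcbc i, by simp, ?_, ?_⟩ <;>
            simp [IsSection, List.replicate_succ, cv]
      · rcases x with _ | ⟨e, _ | ⟨e', _ | ⟨e'', _ | ⟨e3, x⟩⟩⟩⟩ <;> have h' := (sta_L hq) <;>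
          simp [bp, lam, List.replicate_succ] at h' ⊢
        · obtain ⟨rfl, rfl⟩ := h'; exact .inl .Lbb₁
        · obtain ⟨rfl, rfl, rfl⟩ := h'; exact .inl .Lbbc₁
        · obtain ⟨rfl, rfl, rfl, rfl, h'⟩ := h'
          rw [h']
          refine .inr ⟨rfl, _, _, _, x.length + 1, ?_, Switch.Lbbc₁, by simp, ?_, ?_⟩ <;>
            simp [IsSection, List.replicate_succ]
      · rcases x with _ | ⟨e, _ | ⟨e', _ | ⟨e'', _ | ⟨e3, x⟩⟩⟩⟩ <;> have h' := (sta_L hq) <;>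
          simp [bp, lam, List.replicate_succ] at h' ⊢
        · obtain ⟨rfl, rfl⟩ := h'; exact .inl .Lbb₂
        · obtain ⟨rfl, rfl, rfl⟩ := h'; exact .inl .Lbbc₂
        · obtain ⟨rfl, rfl, rfl, rfl, h'⟩ := h'
          rw [h']
          refine .inr ⟨rfl, _, _, _, x.length + 1, ?_, Switch.Lbbc₂, by simp, ?_, ?_⟩ <;>
            simp [IsSection, List.replicate_succ]
      · rcases x with _ | ⟨e, _ | ⟨e', _ | ⟨e'', x⟩⟩⟩ <;> have h' := (sta_L hq) <;>
          simp [bp, lam, List.replicate_succ] at h' ⊢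
        · exact .inl .La
        · subst h'; exact .inl .Lac
        · obtain ⟨rfl, rfl⟩ := h'; exact .inl .Lacc
        · obtain ⟨rfl, rfl, rfl, h'⟩ := h'
          rw [h']
          refine .inr ⟨rfl, _, _, _, x.length + 1, ?_, Switch.Lacc, by simp, ?_, ?_⟩ <;>
            simp [IsSection, List.replicate_succ]
    · rcases cr_eq_some h with ⟨i, rfl, hq, rfl⟩ | ⟨i, rfl, hq, rfl⟩ | ⟨rfl, hq, rfl⟩ |
        ⟨rfl, hq, rfl⟩ | ⟨rfl, hq, rfl⟩ <;> obtain ⟨rfl, _, h'⟩ := sta_M hq <;> simp at h'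
      · exact .inl .M₁
      · exact .inl .M₂
    · rcases cr_eq_some h with ⟨i, rfl, hq, rfl⟩ | ⟨i, rfl, hq, rfl⟩ | ⟨rfl, hq, rfl⟩ |
        ⟨rfl, hq, rfl⟩ | ⟨rfl, hq, rfl⟩ <;> rcases sta_S hq with ⟨rfl, h'⟩ | ⟨rfl, h'⟩ <;>
        simp [psrc] at h'
      · exact .inl (.Sa _)
      · exact .inl (.Sc _)
      · exact .inl .Sb₁
      · exact .inl .Sb₂

-- Finite paths and the labeled edges of the finite tiles.

/-- `x` is a path that ends in `v`. -/
def pth : Vert → List Edg → Prop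
  | _, [] => True
  | v, e :: x => prng e = v ∧ pth (psrc e) x

@[simp] lemma pth_nil (v : Vert) : pth v [] := trivial

@[simp] lemma pth_cons (v : Vert) (e : Edg) (x : List Edg) :
    pth v (e :: x) ↔ prng e = v ∧ pth (psrc e) x := Iff.rfl

lemma isPath_cons {e : Edg} {x : List Edg} : penrose.IsPath (e :: x) ↔ pth (psrc e) x := by
  unfold Inflation.IsPath
  induction x generalizing e with
  | nil => simp
  | cons f x ih => rw [List.isChain_cons_cons, ih]; rfl

lemma pth_iff {v : Vert} {x : List Edg} (hx : x ≠ []) :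
    pth v x ↔ penrose.IsPath x ∧ x.head?.map penrose.rng = some v := by
  cases x with
  | nil => exact absurd rfl hx
  | cons e x => rw [isPath_cons, pth_cons, and_comm]; simp [penrose]

lemma pth.isPath {v : Vert} {x : List Edg} (h : pth v x) : penrose.IsPath x := by
  cases x with
  | nil => exact List.isChain_nil
  | cons e x => exact isPath_cons.2 h.2

lemma isPath_of_suffix {u x : List Edg} (h : penrose.IsPath (u ++ x)) : penrose.IsPath x :=
  List.IsChain.right_of_append h

lemma pth.unique {v w : Vert} {x : List Edg} (hx : x ≠ []) (h : pth v x) (h' : pth w x) :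
    v = w := by
  cases x with
  | nil => exact absurd rfl hx
  | cons e x => exact h.1.symm.trans h'.1

lemma sta_pth {g : Gen} {x : List Edg} {v : Vert} {q : Bd} (h : sta g x v = some q) :
    pth q.vert x ∧ (x = [] → v = q.vert) := by
  induction x generalizing v q with
  | nil => cases g <;> cases v <;> simp [ini] at h <;> subst h <;> simp [Bd.vert]
  | cons e x ih =>
    rcases stp_eq_some h with ⟨v, rfl, h1, rfl⟩ | ⟨rfl, h1, rfl⟩ |
      ⟨rfl, h1, rfl⟩ | ⟨rfl, h1, rfl⟩ <;>
      exact ⟨⟨rfl, (ih h1).1⟩, by simp⟩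

lemma sta_eq_of_ne_nil {g : Gen} {x : List Edg} (hx : x ≠ []) (v w : Vert) :
    sta g x v = sta g x w := by
  cases x with
  | nil => exact absurd rfl hx
  | cons e x => rfl

lemma stp_none (e : Edg) : stp e none = none := by unfold stp; split <;> simp_all

lemma sta_suffix {g : Gen} {u x : List Edg} {v : Vert} (h : sta g (u ++ x) v ≠ none) :
    ∃ w, sta g x w ≠ none := by
  induction u generalizing v with
  | nil => exact ⟨v, h⟩
  | cons e u ih =>
    refine ih (v := psrc e) fun h0 => h ?_
    simp [h0, stp_none]

/-- Prolonging to a boundary point and prolonging to a connecting point exclude each other. This is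
what keeps boundary points free of edges with their own label. -/
lemma cr_none_of_stp {e : Edg} {o : Option Bd} (h : stp e o ≠ none) (x : List Edg) :
    cr e o x = none := by
  by_contra h0
  obtain ⟨y, hy⟩ := Option.ne_none_iff_exists'.1 h0
  obtain ⟨q, hq⟩ := Option.ne_none_iff_exists'.1 h
  rcases cr_eq_some hy with ⟨_, rfl, rfl, _⟩ | ⟨_, rfl, rfl, _⟩ | ⟨rfl, rfl, _⟩ | ⟨rfl, rfl, _⟩ |
    ⟨rfl, rfl, _⟩ <;> simp [stp] at hq

lemma cr_ne {e : Edg} {o : Option Bd} {x y : List Edg} (h : cr e o x = some y) : o ≠ none := by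
  rintro rfl; rcases cr_eq_some h with h | h | h | h | h <;> simp_all

lemma relabel_lab (g : Gen) (e : Edg) (o : Option Bd) (n : ℕ) : relabel (lab g e o n) = g := by
  unfold lab; split <;> rfl

lemma relabel_stateInv (F : State) : relabel (stateInv F) = relabel F := by cases F <;> rfl

lemma stateInv_stateInv (F : State) : stateInv (stateInv F) = F := by cases F <;> rfl

lemma Switch.symm {F : State} {x y : List Edg} (h : Switch F x y) : Switch (stateInv F) y x := by
  cases h <;> constructor

lemma pconn_symm {F : State} {x y : List Edg} (h : pconn F x y) : pconn (stateInv F) y x := by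
  rcases h with h | ⟨rfl, F', x', y', k, h1, h2, h3, rfl, rfl⟩
  · exact .inl h.symm
  · exact .inr ⟨rfl, stateInv F', y', x', k, by cases F' <;> exact h1, h2.symm, h3, rfl, rfl⟩

lemma Switch.pths {F : State} {x y : List Edg} (h : Switch F x y) :
    ∃ v, pth v x ∧ pth v y ∧ x.length = y.length ∧ x ≠ [] := by
  cases h <;> simp [psrc, prng]

/-- The edge c₂ is a loop at `two`, so it can be repeated at the start of a path. -/
lemma pth_append_rep {v : Vert} {x : List Edg} (k : ℕ) (h : pth v (x ++ [c two])) :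
    pth v (x ++ List.replicate (k + 1) (c two)) := by
  induction x generalizing v with
  | nil =>
    refine ⟨h.1, ?_⟩
    clear h
    induction k with
    | zero => trivial
    | succ k ih => exact ⟨rfl, ih⟩
  | cons e x ih => exact ⟨h.1, ih h.2⟩

lemma pconn_pth {F : State} {x y : List Edg} (h : pconn F x y) :
    ∃ v, pth v x ∧ pth v y ∧ x.length = y.length ∧ x ≠ [] := by
  rcases h with h | ⟨rfl, F', x', y', k, h1, h2, h3, rfl, rfl⟩
  · exact h.pths
  · obtain ⟨k, rfl⟩ := Nat.exists_eq_add_of_le' h3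
    have hl := h2.pths
    cases h2 <;> first | exact h1.elim | skip
    · exact ⟨_, pth_append_rep k ⟨rfl, rfl, rfl, rfl, trivial⟩,
        pth_append_rep k ⟨rfl, rfl, rfl, rfl, trivial⟩, by simp, by simp⟩
    · exact ⟨_, pth_append_rep k ⟨rfl, rfl, rfl, rfl, trivial⟩,
        pth_append_rep k ⟨rfl, rfl, rfl, rfl, trivial⟩, by simp, by simp⟩
    · exact ⟨_, pth_append_rep k ⟨rfl, rfl, rfl, rfl, trivial⟩,
        pth_append_rep k ⟨rfl, rfl, rfl, rfl, trivial⟩, by simp, by simp⟩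
    · exact ⟨_, pth_append_rep k ⟨rfl, rfl, rfl, rfl, rfl, trivial⟩,
        pth_append_rep k ⟨rfl, rfl, rfl, rfl, rfl, trivial⟩, by simp, by simp⟩
    · exact ⟨_, pth_append_rep k ⟨rfl, rfl, rfl, rfl, rfl, trivial⟩,
        pth_append_rep k ⟨rfl, rfl, rfl, rfl, rfl, trivial⟩, by simp, by simp⟩

/-- The labeled edges of the finite tiles. -/
abbrev TE (F : State) (x y : List Edg) : Prop := penrose.TileEdge F x y

lemma TE.nil_left {F : State} {y : List Edg} : ¬ TE F [] y := by
  intro h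
  cases h with
  | conn h => exact (pconn_pth h).choose_spec.2.2.2 rfl

lemma TE_cons {F : State} {e : Edg} {x y : List Edg} : TE F (e :: x) y ↔
    (∃ g, cr e (sta g x (psrc e)) x = some y ∧ F = lab g e (sta g x (psrc e)) x.length) ∨
    ∃ y', y = e :: y' ∧ TE F x y' ∧ pth (psrc e) x ∧ pth (psrc e) y' := by
  constructor
  · intro h
    cases h with
    | conn h =>
      obtain ⟨g, e, x, h1, h2, h3⟩ := pconn_iff.1 h
      obtain ⟨rfl, rfl⟩ := List.cons.inj h1
      exact .inl ⟨g, h2, h3⟩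
    | ext e h h1 h2 => exact .inr ⟨_, rfl, h, isPath_cons.1 h1, isPath_cons.1 h2⟩
  · rintro (⟨g, h1, h2⟩ | ⟨y', rfl, h, h1, h2⟩)
    · exact .conn (pconn_iff.2 ⟨g, e, x, rfl, h1, h2⟩)
    · exact .ext e h (isPath_cons.2 h1) (isPath_cons.2 h2)

lemma TE.symm {F : State} {x y : List Edg} (h : TE F x y) : TE (stateInv F) y x := by
  induction h with
  | conn h => exact .conn (pconn_symm h)
  | ext e _ h1 h2 ih => exact .ext e ih h2 h1

lemma TE.pths {F : State} {x y : List Edg} (h : TE F x y) :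
    ∃ v, pth v x ∧ pth v y ∧ x.length = y.length ∧ x ≠ [] := by
  induction h with
  | conn h => exact pconn_pth h
  | ext e _ h1 h2 ih =>
    obtain ⟨_, _, _, h3, _⟩ := ih
    exact ⟨prng e, ⟨rfl, isPath_cons.1 h1⟩, ⟨rfl, isPath_cons.1 h2⟩, by simp [h3], by simp⟩

/-- A boundary point has no edge with the same (relabeled) label. -/
lemma TE.sta_eq_none {F : State} {x y : List Edg} (h : TE F x y) (v : Vert) :
    sta (relabel F) x v = none := by
  induction x generalizing y v with
  | nil => exact absurd h TE.nil_left
  | cons e x ih =>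
    by_contra h0
    rcases TE_cons.1 h with ⟨g, h1, rfl⟩ | ⟨y', rfl, h, h1, h2⟩
    · rw [relabel_lab] at h0
      rw [cr_none_of_stp h0] at h1
      simp at h1
    · rw [sta_cons, ih h, stp_none] at h0
      exact h0 rfl

/-- A connector at `e :: x` needs a boundary type at `x`, an inherited edge needs its absence, so
the two never compete. Comparing relabeled labels only is stronger than well-labeledness; it is what
turns L, M, S into maps. -/
lemma TE.unique {F F' : State} {x y z : List Edg} (h : TE F x y) (h' : TE F' x z)
    (hF : relabel F = relabel F') : F = F' ∧ y = z := by
  induction x generalizing y z with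
  | nil => exact absurd h TE.nil_left
  | cons e x ih =>
    rcases TE_cons.1 h with ⟨g, h1, rfl⟩ | ⟨y', rfl, h, h1, h2⟩ <;>
    rcases TE_cons.1 h' with ⟨g', h1', rfl⟩ | ⟨y'', rfl, h', h1', h2'⟩
    · rw [relabel_lab, relabel_lab] at hF
      subst hF
      rw [h1] at h1'
      exact ⟨rfl, Option.some.inj h1'⟩
    · have := h'.sta_eq_none (psrc e)
      rw [← hF, relabel_lab] at this
      exact absurd this (cr_ne h1)
    · have := h.sta_eq_none (psrc e)
      rw [hF, relabel_lab] at this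
      exact absurd this (cr_ne h1')
    · obtain ⟨rfl, rfl⟩ := ih h h'
      exact ⟨rfl, rfl⟩

lemma bdry_sta {F : State} {x : List Edg} (h : penrose.bdry F x) :
    ∃ v, sta (relabel F) x v ≠ none := by
  obtain ⟨hx, u, z, hu, h⟩ := h
  obtain ⟨g, e, x', h1, h2, rfl⟩ := pconn_iff.1 h
  rw [relabel_lab]
  cases u with
  | nil => exact absurd rfl hu
  | cons f u =>
    obtain ⟨rfl, rfl⟩ := List.cons.inj h1
    exact sta_suffix (cr_ne h2)

lemma penrose_isTileInflation : penrose.IsTileInflation where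
  src_surjective v := by cases v; exacts [⟨a one, rfl⟩, ⟨b, rfl⟩]
  rng_surjective v := ⟨a v, rfl⟩
  inv_inv := stateInv_stateInv
  conn_tile F x y h := by
    obtain ⟨v, h1, h2, h3, h4⟩ := pconn_pth h
    have h5 : y ≠ [] := by rintro rfl; exact h4 (List.length_eq_zero_iff.1 h3)
    exact ⟨h1.isPath, h2.isPath, h3, v, ((pth_iff h4).1 h1).2, ((pth_iff h5).1 h2).2⟩
  conn_inv F x y h := pconn_symm h
  conn_admissible F e f x y h hx := by
    have hy : y ≠ [] := by
      rintro rfl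
      obtain ⟨_, _, _, h3, _⟩ := pconn_pth h
      exact hx (List.length_eq_zero_iff.1 (by simpa using h3))
    exact ⟨⟨hx, [e], _, by simp, h⟩, ⟨hy, [f], _, by simp, pconn_symm h⟩⟩
  bdry_path F x h := by
    obtain ⟨hx, u, z, hu, h⟩ := h
    obtain ⟨v, h, _⟩ := pconn_pth h
    exact ⟨hx, isPath_of_suffix h.isPath⟩
  bdry_tail F e x h hx := by
    obtain ⟨_, u, z, hu, h⟩ := h
    exact ⟨hx, u ++ [e], z, by simp, by simpa using h⟩
  bdry_continue F x h := by
    obtain ⟨hx, u, z, hu, h⟩ := h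
    obtain ⟨u, e, rfl⟩ := u.eq_nil_or_concat.resolve_left hu
    refine ⟨e, ?_⟩
    by_cases hu : u = []
    · subst hu; exact .inr ⟨z, h⟩
    · exact .inl ⟨by simp, u, z, hu, by simpa using h⟩
  edge_unique F x y z h h' := (TE.unique h h' rfl).2
  edge_not_bdry F x y h h' := by
    obtain ⟨v, hv⟩ := bdry_sta h'
    exact hv (TE.sta_eq_none h v)

-- The number of boundary points.

lemma stp_inj {e f : Edg} {o o' : Option Bd} {q : Bd} (h : stp e o = some q)
    (h' : stp f o' = some q) : e = f ∧ o = o' := by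
  rcases stp_eq_some h with ⟨_, rfl, rfl, rfl⟩ | ⟨rfl, rfl, rfl⟩ | ⟨rfl, rfl, rfl⟩ |
    ⟨rfl, rfl, rfl⟩ <;>
  rcases stp_eq_some h' with ⟨_, rfl, rfl, h⟩ | ⟨rfl, rfl, h⟩ | ⟨rfl, rfl, h⟩ |
    ⟨rfl, rfl, h⟩ <;> simp_all

/-- Each state of the automaton is entered by one edge from one state, so a path can be read off
backwards from its type and its length. -/
lemma sta_inj {g : Gen} {x y : List Edg} (hl : x.length = y.length) {q : Bd} {v w : Vert}
    (h : sta g x v = some q) (h' : sta g y w = some q) : x = y := by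
  induction x generalizing y v w q with
  | nil => exact (List.length_eq_zero_iff.1 hl.symm).symm
  | cons e x ih =>
    cases y with
    | nil => simp at hl
    | cons f y =>
      obtain ⟨rfl, h2⟩ := stp_inj h h'
      congr 1
      cases h3 : sta g x (psrc e) with
      | none => rw [sta_cons, h3, stp_none] at h; simp at h
      | some q' => exact ih (by simpa using hl) h3 (h2 ▸ h3)

instance : DecidableEq Gen := fun g h => by
  cases g <;> cases h <;> first | exact isTrue rfl | exact isFalse nofun

lemma penrose_bdry_bounded : ∃ N : ℕ, ∀ v n, 1 ≤ n →
    {x : penrose.Tile v n | ∃ F, penrose.bdry F x.1}.encard ≤ N := by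
  let A : Finset (Gen × Bd) :=
    {Gen.L, .M, .S} ×ˢ {Bd.l one, .l two, .s one, .s two, .m}
  have hA : ∀ p, p ∈ A := by
    rintro ⟨g, q⟩
    cases g <;> rcases q with (_ | _) | (_ | _) | _ <;> decide
  refine ⟨A.card, fun v n hn => ?_⟩
  rw [← Set.encard_coe_eq_coe_finsetCard]
  have key : ∀ x : penrose.Tile v n, ∃ p : Gen × Bd, (∃ F, penrose.bdry F x.1) →
      sta p.1 x.1 v = some p.2 := by
    intro x
    by_cases hx : ∃ F, penrose.bdry F x.1
    · obtain ⟨F, hF⟩ := hx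
      obtain ⟨w, hw⟩ := bdry_sta hF
      obtain ⟨q, hq⟩ := Option.ne_none_iff_exists'.1 hw
      exact ⟨(_, q), fun _ => (sta_eq_of_ne_nil hF.1 v w).trans hq⟩
    · exact ⟨(.L, .m), fun h => absurd h hx⟩
  choose f hf using key
  refine Set.encard_le_encard_of_injOn (f := f) (fun x _ => hA _) ?_
  intro x hx y hy hxy
  have h1 := hf x hx
  have h2 := hf y hy
  rw [← hxy] at h2
  exact Subtype.ext (sta_inj (x.2.2.1.trans y.2.2.1.symm) h1 h2)

lemma trunc_length {E : Type} (γ : ℕ → E) (n : ℕ) : (Inflation.trunc γ n).length = n := by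
  induction n with
  | zero => rfl
  | succ n ih => simp [Inflation.trunc, ih]

/-- From any type other than λ₂ the automaton survives at most one further edge. Hence c₂^ω is the
only infinite path that can stay on the boundary. -/
lemma stp3 {e f g : Edg} {o : Option Bd} (hs : stp e (stp f (stp g o)) ≠ none) :
    o = some (.l two) := by
  have hm : ∀ e, stp e (some .m) = none := fun e => by unfold stp; split <;> simp_all
  have hs1 : ∀ e, stp e (some (.s one)) = none := fun e => by unfold stp; split <;> simp_all
  have hs2 : ∀ e, stp e (some (.s two)) = none ∨ stp e (some (.s two)) = some .m :=
    fun e => by unfold stp; split <;> simp_all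
  have hl : ∀ e, stp e (some (.l one)) = none ∨ stp e (some (.l one)) = some (.s one) :=
    fun e => by unfold stp; split <;> simp_all
  rcases o with _ | (_ | _) | (_ | _) | _
  · simp [stp_none] at hs
  · rcases hl g with h | h <;> simp [h, hs1, stp_none] at hs
  · rfl
  · simp [hs1, stp_none] at hs
  · rcases hs2 g with h | h <;> simp [h, hm, stp_none] at hs
  · simp [hm, stp_none] at hs

lemma stp4 {e f g h : Edg} {o : Option Bd} (hs : stp e (stp f (stp g (stp h o))) ≠ none) :
    h = c two := by
  rcases stp_eq_some (stp3 hs) with ⟨_, rfl, _, h⟩ | ⟨_, _, h⟩ | ⟨_, _, h⟩ | ⟨_, _, h⟩ <;>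
    simp_all

lemma penrose_bdry_finite :
    {γ : penrose.Omega | ∀ n, 1 ≤ n → ∃ F, penrose.bdry F (Inflation.trunc γ.1 n)}.Finite := by
  refine (Set.finite_singleton xi).subset fun γ hγ => ?_
  refine Subtype.ext (funext fun k => ?_)
  obtain ⟨F, hF⟩ := hγ (k + 4) (by omega)
  obtain ⟨v, hv⟩ := bdry_sta hF
  exact stp4 hv

-- The sizes of the tiles.

/-- The vertices of the tiles, as finite sets of paths. -/
def tl : Vert → ℕ → Finset (List Edg)
  | _, 0 => {[]}
  | one, n + 1 => (tl one n).map ⟨_, List.cons_injective (a := a one)⟩ ∪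
      (tl two n).map ⟨_, List.cons_injective (a := c one)⟩
  | two, n + 1 => (tl one n).map ⟨_, List.cons_injective (a := a two)⟩ ∪
      ((tl two n).map ⟨_, List.cons_injective (a := b)⟩ ∪
      (tl two n).map ⟨_, List.cons_injective (a := c two)⟩)

lemma mem_tl {v : Vert} {n : ℕ} {x : List Edg} : x ∈ tl v n ↔ pth v x ∧ x.length = n := by
  induction n generalizing v x with
  | zero => cases v <;> simp [tl, List.length_eq_zero_iff] <;> rintro rfl <;> trivial
  | succ n ih =>
    rcases x with _ | ⟨e, x⟩
    · cases v <;> simp [tl]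
    · cases v <;> rcases e with (_ | _) | (_ | _) | _ <;> simp [tl, ih, prng, psrc]

lemma sum_tl_one {M : Type*} [AddCommMonoid M] (n : ℕ) (f : List Edg → M) :
    ∑ x ∈ tl one (n + 1), f x = ∑ x ∈ tl one n, f (a one :: x) + ∑ x ∈ tl two n, f (c one :: x) := by
  rw [tl, Finset.sum_union, Finset.sum_map, Finset.sum_map]
  · rfl
  · simp [Finset.disjoint_left]

lemma sum_tl_two {M : Type*} [AddCommMonoid M] (n : ℕ) (f : List Edg → M) :
    ∑ x ∈ tl two (n + 1), f x = ∑ x ∈ tl one n, f (a two :: x) +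
      (∑ x ∈ tl two n, f (b :: x) + ∑ x ∈ tl two n, f (c two :: x)) := by
  rw [tl, Finset.sum_union, Finset.sum_union, Finset.sum_map, Finset.sum_map, Finset.sum_map]
  · rfl
  all_goals
    simp only [Finset.disjoint_left, Finset.mem_union, Finset.mem_map]
    aesop

/-- The recursion has the matrix with rows (1, 1) and (1, 2), which performs two Fibonacci steps at
once; therefore β is the square of the golden ratio. -/
lemma card_tl (n : ℕ) : (tl one (n + 1)).card = Nat.fib (2 * n + 3) ∧
    (tl two (n + 1)).card = Nat.fib (2 * n + 4) := by
  have h1 : ∀ n, (tl one (n + 1)).card = (tl one n).card + (tl two n).card := fun n => by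
    simpa only [Finset.card_eq_sum_ones] using sum_tl_one n (fun _ => 1)
  have h2 : ∀ n, (tl two (n + 1)).card = (tl one n).card + ((tl two n).card + (tl two n).card) :=
    fun n => by
      simpa only [Finset.card_eq_sum_ones] using sum_tl_two n (fun _ => 1)
  induction n with
  | zero => rw [h1, h2]; simp [tl]; decide
  | succ n ih =>
    rw [h1 (n + 1), h2 (n + 1), ih.1, ih.2]
    have e1 : Nat.fib (2 * n + 5) = Nat.fib (2 * n + 3) + Nat.fib (2 * n + 4) := Nat.fib_add_two
    have e2 : Nat.fib (2 * n + 6) = Nat.fib (2 * n + 4) + Nat.fib (2 * n + 5) := Nat.fib_add_two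
    constructor
    · exact e1.symm
    · change _ = Nat.fib (2 * n + 6)
      omega

lemma tile_mem_iff {v : Vert} {n : ℕ} (hn : 1 ≤ n) {x : List Edg} :
    (penrose.IsPath x ∧ x.length = n ∧ x.head?.map penrose.rng = some v) ↔ x ∈ tl v n := by
  rw [mem_tl]
  constructor
  · rintro ⟨h1, h2, h3⟩
    have hx : x ≠ [] := by rintro rfl; simp at h3
    exact ⟨(pth_iff hx).2 ⟨h1, h3⟩, h2⟩
  · rintro ⟨h1, h2⟩
    have hx : x ≠ [] := by rintro rfl; simp at h2; omega
    exact ⟨((pth_iff hx).1 h1).1, h2, ((pth_iff hx).1 h1).2⟩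

/-- The vertices of a tile as members of `tl`. -/
def tileEquiv {v : Vert} {n : ℕ} (hn : 1 ≤ n) : penrose.Tile v n ≃ {x // x ∈ tl v n} :=
  Equiv.subtypeEquivRight fun _ => tile_mem_iff hn

lemma card_tile {v : Vert} {n : ℕ} (hn : 1 ≤ n) :
    Nat.card (penrose.Tile v n) = (tl v n).card := by
  rw [Nat.card_congr (tileEquiv hn)]; simp

lemma beta_eq : (3 + Real.sqrt 5) / 2 = Real.goldenRatio ^ 2 := by
  rw [Real.goldenRatio_sq, Real.goldenRatio]; ring

lemma fib_le_pow (n : ℕ) : (Nat.fib (n + 1) : ℝ) ≤ Real.goldenRatio ^ n := by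
  induction n using Nat.twoStepInduction with
  | zero => simp
  | one => simpa using Real.one_lt_goldenRatio.le
  | more n h1 h2 =>
    rw [Nat.fib_add_two]
    push_cast
    calc _ ≤ Real.goldenRatio ^ n + Real.goldenRatio ^ (n + 1) := add_le_add h1 h2
      _ = Real.goldenRatio ^ n * Real.goldenRatio ^ 2 := by rw [Real.goldenRatio_sq]; ring
      _ = _ := by ring

lemma pow_le_fib (n : ℕ) : Real.goldenRatio ^ n ≤ (Nat.fib (n + 2) : ℝ) := by
  induction n using Nat.twoStepInduction with
  | zero => simp
  | one => simpa [show Nat.fib 3 = 2 from rfl] using Real.goldenRatio_lt_two.le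
  | more n h1 h2 =>
    rw [Nat.fib_add_two (n := n + 2)]
    push_cast
    calc _ = Real.goldenRatio ^ n * Real.goldenRatio ^ 2 := by ring
      _ = Real.goldenRatio ^ n + Real.goldenRatio ^ (n + 1) := by rw [Real.goldenRatio_sq]; ring
      _ ≤ _ := add_le_add h1 h2

lemma tendsto_card_tile : Tendsto
    (fun n : ℕ => (Nat.card (penrose.Tile two n) : ℝ) ^ ((1 : ℝ) / (n : ℝ))) atTop
    (𝓝 ((3 + Real.sqrt 5) / 2)) := by
  rw [beta_eq]
  have hφ : (0 : ℝ) < Real.goldenRatio := Real.goldenRatio_pos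
  have up : Tendsto (fun n : ℕ => Real.goldenRatio ^ 2 * Real.goldenRatio ^ ((1 : ℝ) / (n : ℝ)))
      atTop (𝓝 (Real.goldenRatio ^ 2)) := by
    have : Tendsto (fun n : ℕ => Real.goldenRatio ^ ((1 : ℝ) / (n : ℝ))) atTop
        (𝓝 (Real.goldenRatio ^ (0 : ℝ))) :=
      tendsto_const_nhds.rpow tendsto_one_div_atTop_nhds_zero_nat (.inl hφ.ne')
    simpa only [Real.rpow_zero, mul_one] using this.const_mul (Real.goldenRatio ^ 2)
  have rt : ∀ n : ℕ, 1 ≤ n → (Real.goldenRatio ^ (2 * n)) ^ ((1 : ℝ) / (n : ℝ)) =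
      Real.goldenRatio ^ 2 := fun n hn => by
    rw [pow_mul, one_div, Real.pow_rpow_inv_natCast (by positivity) (by omega)]
  refine tendsto_of_tendsto_of_tendsto_of_le_of_le' tendsto_const_nhds up ?_ ?_
  · filter_upwards [eventually_ge_atTop 1] with n hn
    rw [card_tile hn]
    obtain ⟨n, rfl⟩ := Nat.exists_eq_add_of_le' hn
    rw [(card_tl n).2, ← rt (n + 1) hn]
    exact Real.rpow_le_rpow (by positivity) (pow_le_fib (2 * (n + 1))) (by positivity)
  · filter_upwards [eventually_ge_atTop 1] with n hn
    rw [card_tile hn]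
    obtain ⟨n, rfl⟩ := Nat.exists_eq_add_of_le' hn
    rw [(card_tl n).2, ← rt (n + 1) hn, ← Real.mul_rpow (by positivity) (by positivity)]
    refine Real.rpow_le_rpow (by positivity) ?_ (by positivity)
    rw [← pow_succ]
    exact fib_le_pow (2 * n + 3)

end TileInfl

namespace TileInfl
open Vert Edg Inflation

/-! ### Infinite paths and prefix replacement -/

/-- The sequence `γ` with its prefix replaced by `x`. -/
def gl (x : List Edg) (γ : ℕ → Edg) : ℕ → Edg := fun k => x.reverse.getD k (γ k)

lemma gl_of_le {x : List Edg} {k : ℕ} (h : x.length ≤ k) (γ : ℕ → Edg) : gl x γ k = γ k := by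
  simp [gl, h]

lemma gl_cons_self (e : Edg) (x : List Edg) (γ : ℕ → Edg) : gl (e :: x) γ x.length = e := by
  simp [gl]

lemma gl_cons_of_ne (e : Edg) (x : List Edg) (γ : ℕ → Edg) {k : ℕ} (hk : k ≠ x.length) :
    gl (e :: x) γ k = gl x γ k := by
  rcases lt_or_gt_of_ne hk with h | h
  · simp [gl, List.getElem?_append_left, h]
  · rw [gl_of_le h.le, gl_of_le (by simpa using h)]

lemma trunc_congr {γ δ : ℕ → Edg} {n : ℕ} (h : ∀ k < n, γ k = δ k) : trunc γ n = trunc δ n := by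
  induction n with
  | zero => rfl
  | succ n ih => rw [trunc, trunc, h n (by simp), ih fun k hk => h k (by omega)]

lemma trunc_inj {γ δ : ℕ → Edg} {n : ℕ} (h : trunc γ n = trunc δ n) : ∀ k < n, γ k = δ k := by
  induction n with
  | zero => intro k hk; omega
  | succ n ih =>
    obtain ⟨h1, h2⟩ := List.cons.inj h
    intro k hk
    rcases Nat.lt_succ_iff_lt_or_eq.1 hk with hk | rfl
    · exact ih h2 k hk
    · exact h1

lemma trunc_gl (x : List Edg) (γ : ℕ → Edg) : trunc (gl x γ) x.length = x := by
  induction x with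
  | nil => rfl
  | cons e x ih =>
    rw [List.length_cons, trunc, gl_cons_self,
      trunc_congr fun k hk => gl_cons_of_ne e x γ hk.ne, ih]

lemma trunc_add (γ : ℕ → Edg) (n m : ℕ) : ∃ u : List Edg, u.length = m ∧
    trunc γ (n + m) = u ++ trunc γ n ∧ ∀ δ : ℕ → Edg, (∀ k, n ≤ k → γ k = δ k) →
      trunc δ (n + m) = u ++ trunc δ n := by
  induction m with
  | zero => exact ⟨[], rfl, rfl, fun _ _ => rfl⟩
  | succ m ih =>
    obtain ⟨u, h1, h2, h3⟩ := ih
    refine ⟨γ (n + m) :: u, by simp [h1], by rw [← add_assoc, trunc, h2]; rfl, fun δ h => ?_⟩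
    rw [← add_assoc, trunc, h3 δ h, h (n + m) (by omega)]
    rfl

lemma trunc_append (γ : ℕ → Edg) {n m : ℕ} (h : n ≤ m) : ∃ u : List Edg, u.length = m - n ∧
    trunc γ m = u ++ trunc γ n := by
  obtain ⟨m, rfl⟩ := Nat.exists_eq_add_of_le h
  obtain ⟨u, h1, h2, _⟩ := trunc_add γ n m
  exact ⟨u, by omega, h2⟩

lemma trunc_drop (γ : ℕ → Edg) (n m : ℕ) : (trunc γ (n + m)).drop m = trunc γ n := by
  obtain ⟨u, h1, h2, _⟩ := trunc_add γ n m
  rw [h2, ← h1, List.drop_left]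

lemma pth_trunc (γ : penrose.Omega) (n : ℕ) : pth (psrc (γ.1 n)) (trunc γ.1 n) := by
  induction n with
  | zero => trivial
  | succ n ih => exact ⟨γ.2 n, ih⟩

lemma gl_mem {x : List Edg} {γ : penrose.Omega} (h : pth (psrc (γ.1 x.length)) x) :
    ∀ n, penrose.rng (gl x γ.1 n) = penrose.src (gl x γ.1 (n + 1)) := by
  suffices ∀ (v : Vert) (δ : ℕ → Edg), pth v x → psrc (δ x.length) = v →
      (∀ n, x.length ≤ n → prng (δ n) = psrc (δ (n + 1))) →
      ∀ n, prng (gl x δ n) = psrc (gl x δ (n + 1)) from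
    this _ γ.1 h rfl fun n _ => γ.2 n
  clear h γ
  induction x with
  | nil => intro v δ _ _ h n; exact h n (by simp)
  | cons e x ih =>
    intro v δ h1 h2 h3 n
    rcases lt_trichotomy n x.length with h | h | h
    · have := ih (psrc e) (gl (e :: x) δ) h1.2 (by rw [gl_cons_self]) (by
        intro m hm
        rcases eq_or_lt_of_le hm with rfl | hm
        · rw [gl_cons_self, gl_of_le (by simp), ← List.length_cons (a := e), h2, h1.1]
        · rw [gl_of_le (by simpa using hm), gl_of_le (by simp; omega)]
          exact h3 m (by simpa using hm)) n
      have hg : ∀ k, gl x (gl (e :: x) δ) k = gl (e :: x) δ k := by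
        intro k
        rcases lt_or_ge k x.length with hk | hk
        · rw [gl_cons_of_ne _ _ _ hk.ne]
          simp [gl, hk]
        · rw [gl_of_le hk]
      rwa [hg, hg] at this
    · subst h
      rw [gl_cons_self, gl_of_le (by simp), ← List.length_cons (a := e), h2, h1.1]
    · rw [gl_of_le (by simpa using h), gl_of_le (by simp; omega)]
      exact h3 n (by simpa using h)

/-- The point with the prefix of `γ` replaced by `x`. -/
def glO (x : List Edg) (γ : penrose.Omega) (h : pth (psrc (γ.1 x.length)) x) : penrose.Omega :=
  ⟨gl x γ.1, gl_mem h⟩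

/-! ### The edges of the infinite tiles -/

lemma TE.ext_append {F : State} {u x y : List Edg} (h : TE F x y) {v : Vert}
    (h1 : pth v (u ++ x)) (h2 : pth v (u ++ y)) : TE F (u ++ x) (u ++ y) := by
  induction u generalizing v with
  | nil => exact h
  | cons e u ih => exact .ext e (ih h1.2 h2.2) (isPath_cons.2 h1.2) (isPath_cons.2 h2.2)

/-- An edge comes from one connector. Either that connector lies inside the lower part, and
everything above is inherited, or it lies higher, and then both lower parts are truncations of its
ends, hence boundary points. -/
lemma TE.split {F : State} {u u' x x' : List Edg} (hu : u.length = u'.length)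
    (h : TE F (u ++ x) (u' ++ x')) : (u = u' ∧ TE F x x') ∨
      ((∃ v, sta (relabel F) x v ≠ none) ∧ ∃ v, sta (relabel F) x' v ≠ none) := by
  induction u generalizing u' with
  | nil =>
    obtain rfl := List.length_eq_zero_iff.1 hu.symm
    exact .inl ⟨rfl, h⟩
  | cons e u ih =>
    cases u' with
    | nil => simp at hu
    | cons e' u' =>
      cases h with
      | conn h =>
        right
        constructor
        · obtain ⟨g, f, z, h1, h2, rfl⟩ := pconn_iff.1 h
          obtain ⟨rfl, rfl⟩ := List.cons.inj h1
          rw [relabel_lab]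
          exact sta_suffix (cr_ne h2)
        · obtain ⟨g, f, z, h1, h2, h3⟩ := pconn_iff.1 (pconn_symm h)
          obtain ⟨rfl, rfl⟩ := List.cons.inj h1
          rw [← relabel_stateInv, h3, relabel_lab]
          exact sta_suffix (cr_ne h2)
      | ext e h h1 h2 =>
        rcases ih (by simpa using hu) h with ⟨rfl, h'⟩ | h'
        · exact .inl ⟨rfl, h'⟩
        · exact .inr h'

lemma edge_mono {F : State} {η ζ : penrose.Omega} {n m : ℕ} (hnm : n ≤ m)
    (h : TE F (trunc η.1 n) (trunc ζ.1 n)) (ht : ∀ k, n ≤ k → η.1 k = ζ.1 k) :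
    TE F (trunc η.1 m) (trunc ζ.1 m) := by
  obtain ⟨m, rfl⟩ := Nat.exists_eq_add_of_le hnm
  obtain ⟨u, _, h2, h3⟩ := trunc_add η.1 n m
  have h4 := h3 ζ.1 ht
  have p1 := pth_trunc η (n + m)
  have p2 := pth_trunc ζ (n + m)
  rw [← ht _ hnm] at p2
  rw [h2] at p1 ⊢
  rw [h4] at p2 ⊢
  exact h.ext_append p1 p2

lemma edge_unique {F F' : State} {η ζ ζ' : penrose.Omega} (h : penrose.Edge F η ζ)
    (h' : penrose.Edge F' η ζ') (hF : relabel F = relabel F') : F = F' ∧ ζ = ζ' := by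
  obtain ⟨n, h1, h2⟩ := h
  obtain ⟨m, h3, h4⟩ := h'
  have h5 := edge_mono (le_max_left n m) h1 h2
  have h6 := edge_mono (le_max_right n m) h3 h4
  obtain ⟨rfl, h7⟩ := h5.unique h6 hF
  refine ⟨rfl, Subtype.ext (funext fun k => ?_)⟩
  rcases lt_or_ge k (max n m) with hk | hk
  · exact trunc_inj h7 k hk
  · rw [← h2 k ((le_max_left n m).trans hk), h4 k ((le_max_right n m).trans hk)]

lemma edge_symm {F : State} {η ζ : penrose.Omega} (h : penrose.Edge F η ζ) :
    penrose.Edge (stateInv F) ζ η := by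
  obtain ⟨n, h1, h2⟩ := h
  exact ⟨n, TE.symm h1, fun k hk => (h2 k hk).symm⟩

lemma edge_symm_iff {F : State} {η ζ : penrose.Omega} :
    penrose.Edge F η ζ ↔ penrose.Edge (stateInv F) ζ η :=
  ⟨edge_symm, fun h => by simpa [stateInv_stateInv] using edge_symm h⟩

/-- An edge either lies in the tile of level `n` or connects boundary points of such tiles. -/
lemma edge_split {F : State} {η ζ : penrose.Omega} (h : penrose.Edge F η ζ) (n : ℕ) :
    (TE F (trunc η.1 n) (trunc ζ.1 n) ∧ ∀ k, n ≤ k → η.1 k = ζ.1 k) ∨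
    ((∃ v, sta (relabel F) (trunc η.1 n) v ≠ none) ∧
      ∃ v, sta (relabel F) (trunc ζ.1 n) v ≠ none) := by
  obtain ⟨m, h1, h2⟩ := h
  rcases le_total m n with hmn | hmn
  · exact .inl ⟨edge_mono hmn h1 h2, fun k hk => h2 k (hmn.trans hk)⟩
  · obtain ⟨u, hu, h3⟩ := trunc_append η.1 hmn
    obtain ⟨u', hu', h4⟩ := trunc_append ζ.1 hmn
    have h1' := h1
    rw [h3, h4] at h1'
    rcases TE.split (hu.trans hu'.symm) h1' with ⟨rfl, h⟩ | h
    · refine .inl ⟨h, fun k hk => ?_⟩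
      rcases lt_or_ge k m with hkm | hkm
      · obtain ⟨r, rfl⟩ := Nat.exists_eq_add_of_lt hkm
        have e1 := congrArg (List.drop r) (h3)
        have e2 := congrArg (List.drop r) (h4)
        have d1 := trunc_drop η.1 (k + 1) r
        have d2 := trunc_drop ζ.1 (k + 1) r
        rw [show k + 1 + r = k + r + 1 by omega] at d1 d2
        rw [d1, List.drop_append_of_le_length (by omega)] at e1
        rw [d2, List.drop_append_of_le_length (by omega)] at e2
        obtain ⟨f, w, hw⟩ : ∃ f w, u.drop r = f :: w :=
          List.exists_cons_of_ne_nil (by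
            intro h0; have := congrArg List.length h0; simp at this; omega)
        rw [hw] at e1 e2
        exact (List.cons.inj e1).1.trans (List.cons.inj e2).1.symm
      · exact h2 k hkm
    · exact .inr h

lemma edge_of_TE {F : State} {η : penrose.Omega} {n : ℕ} {y : List Edg} (h : TE F (trunc η.1 n) y) :
    ∃ hy : pth (psrc (η.1 y.length)) y, y.length = n ∧ penrose.Edge F η (glO y η hy) := by
  obtain ⟨v, h1, h2, h3, h4⟩ := h.pths
  have hl : y.length = n := by rw [← h3, trunc_length]
  have hv : v = psrc (η.1 n) := h1.unique h4 (pth_trunc η n)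
  subst hv
  refine ⟨by rwa [hl], hl, n, ?_, fun k hk => (gl_of_le (by omega) _).symm⟩
  have := trunc_gl y η.1
  rw [hl] at this
  change TE F _ (trunc (gl y η.1) n)
  rwa [this]

/-! ### The homeomorphisms obtained by relabeling -/

open Classical in
/-- The map with which a relabeled generator acts. -/
noncomputable def act (g : Gen) (η : penrose.Omega) : penrose.Omega :=
  if h : ∃ ζ F, relabel F = g ∧ penrose.Edge F η ζ then h.choose else η

lemma act_of_edge {F : State} {η ζ : penrose.Omega} (h : penrose.Edge F η ζ) :
    act (relabel F) η = ζ := by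
  have hex : ∃ ζ F', relabel F' = relabel F ∧ penrose.Edge F' η ζ := ⟨ζ, F, rfl, h⟩
  rw [act, dif_pos hex]
  obtain ⟨F', h1, h2⟩ := hex.choose_spec
  exact (edge_unique h2 h h1).2

lemma act_of_not_edge {g : Gen} {η : penrose.Omega}
    (h : ∀ F ζ, relabel F = g → ¬ penrose.Edge F η ζ) : act g η = η := by
  rw [act, dif_neg]
  rintro ⟨ζ, F, h1, h2⟩
  exact h F ζ h1 h2

lemma act_act (g : Gen) (η : penrose.Omega) : act g (act g η) = η := by
  by_cases h : ∃ ζ F, relabel F = g ∧ penrose.Edge F η ζ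
  · obtain ⟨ζ, F, rfl, h⟩ := h
    rw [act_of_edge h]
    have := act_of_edge (edge_symm h)
    rwa [relabel_stateInv] at this
  · have h1 : act g η = η := act_of_not_edge fun F ζ h1 h2 => h ⟨ζ, F, h1, h2⟩
    rw [h1, h1]

lemma nhds_agree (γ : penrose.Omega) (m : ℕ) : {γ' : penrose.Omega | trunc γ'.1 m = trunc γ.1 m} ∈ 𝓝 γ := by
  have h : ∀ k, {γ' : penrose.Omega | γ'.1 k = γ.1 k} ∈ 𝓝 γ := fun k => by
    have hc : Continuous fun γ' : penrose.Omega => γ'.1 k :=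
      (continuous_apply k).comp continuous_subtype_val
    exact hc.continuousAt.preimage_mem_nhds ((isOpen_discrete {γ.1 k}).mem_nhds rfl)
  have : (⋂ k ∈ Finset.range m, {γ' : penrose.Omega | γ'.1 k = γ.1 k}) ∈ 𝓝 γ :=
    (Filter.biInter_finset_mem _).2 fun k _ => h k
  filter_upwards [this] with γ' hγ'
  exact trunc_congr fun k hk => by
    simpa using Set.mem_iInter₂.1 hγ' k (Finset.mem_range.2 hk)

lemma continuous_of_agree {f : penrose.Omega → penrose.Omega}
    (h : ∀ k, ∃ m, ∀ γ γ', trunc γ.1 m = trunc γ'.1 m → (f γ).1 k = (f γ').1 k) :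
    Continuous f := by
  refine continuous_induced_rng.2 (continuous_pi fun k => ?_)
  rw [continuous_discrete_rng]
  intro e
  rw [isOpen_iff_mem_nhds]
  intro γ hγ
  obtain ⟨m, hm⟩ := h k
  filter_upwards [nhds_agree γ m] with γ' h'
  exact (hm γ' γ h').trans hγ

lemma sta_drop_two {g : Gen} {x : List Edg} {v : Vert} (hx : 2 ≤ x.length) (h : sta g x v ≠ none) :
    g = .L ∧ x.drop 2 = List.replicate (x.length - 2) (c two) := by
  by_cases hg : g = .L
  · subst hg
    refine ⟨rfl, ?_⟩
    obtain ⟨q, hq⟩ := Option.ne_none_iff_exists'.1 h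
    rw [(sta_L hq).1, bp_length hx]
    obtain ⟨n, hn⟩ := Nat.exists_eq_add_of_le' hx
    rw [hn]
    rcases q with (_ | _) | (_ | _) | _ <;> simp [bp, lam, List.replicate_succ]
  · exact absurd (sta_ne_L hx v hg) h

/-- The window reaches two edges beyond coordinate `k`. An edge inside the tile of level `k + 3` is
visible in the window. An edge leaving this tile joins two boundary points, which read c₂ in all but
their two topmost places (`sta_drop_two`), so coordinate `k` is unchanged. -/
lemma act_agree (g : Gen) {k : ℕ} {γ γ' : penrose.Omega} (h : trunc γ.1 (k + 3) = trunc γ'.1 (k + 3)) :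
    (act g γ).1 k = (act g γ').1 k := by
  suffices H : ∀ (γ γ' : penrose.Omega), trunc γ.1 (k + 3) = trunc γ'.1 (k + 3) →
      ∀ F ζ, relabel F = g → TE F (trunc γ.1 (k + 3)) (trunc ζ (k + 3)) →
        (act g γ').1 k = ζ k by
    by_cases h1 : ∃ F ζ, relabel F = g ∧ TE F (trunc γ.1 (k + 3)) (trunc ζ (k + 3))
    · obtain ⟨F, ζ, h1, h2⟩ := h1
      rw [H γ γ' h F ζ h1 h2, H γ γ rfl F ζ h1 h2]
    · have N : ∀ γ'' : penrose.Omega, trunc γ.1 (k + 3) = trunc γ''.1 (k + 3) →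
          (act g γ'').1 k = γ''.1 k := by
        intro γ'' h2
        by_cases h3 : ∃ ζ F, relabel F = g ∧ penrose.Edge F γ'' ζ
        · obtain ⟨ζ, F, rfl, h3⟩ := h3
          rw [act_of_edge h3]
          rcases edge_split h3 (k + 3) with h4 | ⟨⟨v, hv⟩, w, hw⟩
          · rw [← h2] at h4; exact absurd ⟨F, ζ.1, rfl, h4.1⟩ h1
          · have h5 := (sta_drop_two (by simp [trunc_length]) hv).2
            have h6 := (sta_drop_two (by simp [trunc_length]) hw).2
            rw [trunc_length] at h5 h6
            have h7 := (trunc_drop γ''.1 (k + 1) 2).symm.trans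
              (h5.trans (h6.symm.trans (trunc_drop ζ.1 (k + 1) 2)))
            exact (trunc_inj h7 k (by omega)).symm
        · rw [act_of_not_edge fun F ζ h1 h2 => h3 ⟨ζ, F, h1, h2⟩]
      rw [N γ rfl, N γ' h]
      exact trunc_inj h k (by omega)
  rintro γ γ' h F ζ rfl hT
  rw [h] at hT
  obtain ⟨hy, hl, hE⟩ := edge_of_TE hT
  rw [act_of_edge hE]
  have := trunc_gl (trunc ζ (k + 3)) γ'.1
  rw [hl] at this
  exact trunc_inj this k (by omega)

lemma act_continuous (g : Gen) : Continuous (act g) :=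
  continuous_of_agree fun k => ⟨k + 3, fun _ _ h => act_agree g h⟩

/-- An involutive continuous map as a homeomorphism. -/
def homeoOfInvol {α : Type} [TopologicalSpace α] (f : α → α) (hf : Function.Involutive f)
    (hc : Continuous f) : α ≃ₜ α where
  toEquiv := hf.toPerm
  continuous_toFun := hc
  continuous_invFun := hc

/-- The homeomorphisms `L, M, S`. -/
noncomputable def genHomeo (g : Gen) : penrose.Omega ≃ₜ penrose.Omega :=
  homeoOfInvol (act g) (act_act g) (act_continuous g)

@[simp] lemma genHomeo_apply (g : Gen) (η : penrose.Omega) : genHomeo g η = act g η := rfl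

lemma isRelabeling_genHomeo : IsRelabeling genHomeo :=
  ⟨fun _ _ _ h => act_of_edge h, fun _ _ h => act_of_not_edge h⟩

/-! ### The existence of partitions -/

/-- The piece determined by a finite path. -/
def pl : List Edg → Option ℕ
  | [] => none
  | e :: x => match pl x with
    | some j => some j
    | none => match e with
      | c two => none
      | c one => some (x.length + 1)
      | _ => some x.length

lemma pl_cons_of_some {e : Edg} {x : List Edg} {j : ℕ} (h : pl x = some j) :
    pl (e :: x) = some j := by simp [pl, h]

@[simp] lemma pl_rep (n : ℕ) : pl (List.replicate n (c two)) = none := by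
  induction n with
  | zero => rfl
  | succ n ih => simp [List.replicate_succ, pl, ih]

lemma pl_eq_none {x : List Edg} (h : pl x = none) : ∀ e ∈ x, e = c two := by
  induction x with
  | nil => simp
  | cons e x ih =>
    cases hx : pl x with
    | some j => simp [pl, hx] at h
    | none =>
      rcases e with (_ | _) | (_ | _) | _ <;> simp [pl, hx] at h
      simpa using ih hx

lemma cv_s_one {n : ℕ} : cv (a one :: lam one n) = b :: lam two n := by
  cases n <;> simp [lam, cv, List.replicate_succ]

lemma cv_s_two {n : ℕ} : cv (b :: lam two n) = a one :: lam one n := by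
  cases n <;> simp [lam, cv, List.replicate_succ]

lemma pl_s_one (n : ℕ) : pl (a one :: lam one n) = some n := by
  cases n <;> simp [lam, pl]

lemma pl_s_two (n : ℕ) : pl (b :: lam two n) = some n := by
  simp [lam, pl]

lemma pl_l_one (n : ℕ) : pl (a two :: lam one n) = some n := by
  cases n <;> simp [lam, pl]

/-- The two sides of an `L`-connector, and the piece in which they lie. -/
lemma pconn_L {F : State} {x y : List Edg} (h : pconn F x y) (hF : relabel F = .L) : ∃ n,
    (∃ i, x = a i :: a one :: lam one n ∧ y = c i :: b :: lam two n) ∨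
    (∃ i, x = c i :: b :: lam two n ∧ y = a i :: a one :: lam one n) ∨
    (x = b :: b :: b :: lam two n ∧ y = c two :: b :: b :: lam two n) ∨
    (x = c two :: b :: b :: lam two n ∧ y = b :: b :: b :: lam two n) ∨
    (x = a two :: lam one n ∧ y = a two :: lam one n) := by
  obtain ⟨g, e, z, rfl, h1, rfl⟩ := pconn_iff.1 h
  rw [relabel_lab] at hF
  subst hF
  rcases cr_eq_some h1 with ⟨i, rfl, hq, rfl⟩ | ⟨i, rfl, hq, rfl⟩ | ⟨rfl, hq, rfl⟩ |
    ⟨rfl, hq, rfl⟩ | ⟨rfl, hq, rfl⟩ <;> have hz := (sta_L hq).1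
  · refine ⟨z.length - 1, .inl ⟨i, ?_, ?_⟩⟩
    · exact congrArg _ hz
    · exact congrArg _ ((congrArg cv hz).trans cv_s_one)
  · refine ⟨z.length - 1, .inr (.inl ⟨i, ?_, ?_⟩)⟩
    · exact congrArg _ hz
    · exact congrArg _ ((congrArg cv hz).trans cv_s_two)
  · refine ⟨z.length - 2, .inr (.inr (.inl ⟨?_, ?_⟩))⟩ <;> exact congrArg _ hz
  · refine ⟨z.length - 2, .inr (.inr (.inr (.inl ⟨?_, ?_⟩)))⟩ <;> exact congrArg _ hz
  · refine ⟨z.length, .inr (.inr (.inr (.inr ⟨?_, ?_⟩)))⟩ <;> exact congrArg _ hz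

/-- This is why `pl` adds one for c₁: across a connection, for n ≥ 1, λ_{1,n} = c₁c₂ⁿ⁻¹ faces bc₂ⁿ,
and the first edges other than c₂ are c₁ at place n − 1 and b at place n. -/
lemma pl_conn {F : State} {x y : List Edg} (h : pconn F x y) (hF : relabel F = .L) :
    ∃ n, pl x = some n ∧ pl y = some n := by
  obtain ⟨n, ⟨i, rfl, rfl⟩ | ⟨i, rfl, rfl⟩ | ⟨rfl, rfl⟩ | ⟨rfl, rfl⟩ | ⟨rfl, rfl⟩⟩ := pconn_L h hF
  · exact ⟨n, pl_cons_of_some (pl_s_one n), pl_cons_of_some (pl_s_two n)⟩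
  · exact ⟨n, pl_cons_of_some (pl_s_two n), pl_cons_of_some (pl_s_one n)⟩
  · exact ⟨n, pl_cons_of_some (pl_cons_of_some (pl_s_two n)),
      pl_cons_of_some (pl_cons_of_some (pl_s_two n))⟩
  · exact ⟨n, pl_cons_of_some (pl_cons_of_some (pl_s_two n)),
      pl_cons_of_some (pl_cons_of_some (pl_s_two n))⟩
  · exact ⟨n, pl_l_one n, pl_l_one n⟩

lemma pl_TE {F : State} {x y : List Edg} (h : TE F x y) (hF : relabel F = .L) :
    ∃ n, pl x = some n ∧ pl y = some n := by
  induction h with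
  | conn h => exact pl_conn h hF
  | ext e _ _ _ ih =>
    obtain ⟨n, h1, h2⟩ := ih
    exact ⟨n, pl_cons_of_some h1, pl_cons_of_some h2⟩

lemma pl_trunc_mono {γ : ℕ → Edg} {n m j : ℕ} (h : n ≤ m) (hj : pl (trunc γ n) = some j) :
    pl (trunc γ m) = some j := by
  induction m, h using Nat.le_induction with
  | base => exact hj
  | succ m _ ih => exact pl_cons_of_some ih

lemma pl_trunc_unique {γ : ℕ → Edg} {n m i j : ℕ} (hi : pl (trunc γ n) = some i)
    (hj : pl (trunc γ m) = some j) : i = j := by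
  have h1 := pl_trunc_mono (le_max_left n m) hi
  have h2 := pl_trunc_mono (le_max_right n m) hj
  exact Option.some.inj (h1.symm.trans h2)

lemma trunc_of_eq_c {γ : ℕ → Edg} {n : ℕ} (h : ∀ m < n, γ m = c two) :
    trunc γ n = List.replicate n (c two) := by
  induction n with
  | zero => rfl
  | succ n ih => rw [trunc, h n (by omega), ih fun m hm => h m (by omega), List.replicate_succ]

/-- A partition with the required properties. -/
def stdPiece (j : Fin 3) : Set penrose.Omega :=
  {γ | ∃ n i, pl (trunc γ.1 n) = some i ∧ i % 3 = j.1}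

lemma isPartition_stdPiece : IsPartition (genHomeo .L) stdPiece where
  isOpen j := by
    rw [isOpen_iff_mem_nhds]
    rintro γ ⟨n, i, h1, h2⟩
    filter_upwards [nhds_agree γ n] with γ' h
    exact ⟨n, i, by rw [h]; exact h1, h2⟩
  disjoint i j hij := by
    refine Set.disjoint_left.2 ?_
    rintro γ ⟨n, k, h1, h2⟩ ⟨m, l, h3, h4⟩
    obtain rfl := pl_trunc_unique h1 h3
    exact hij (Fin.ext (h2.symm.trans h4))
  iUnion := by
    ext γ
    rw [Set.mem_iUnion, Set.mem_compl_singleton_iff]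
    constructor
    · rintro ⟨j, n, i, h1, h2⟩ rfl
      rw [trunc_of_eq_c (γ := xi.1) fun _ _ => rfl, pl_rep] at h1
      simp at h1
    · intro h
      by_contra h0
      refine h (Subtype.ext (funext fun k => ?_))
      have : pl (trunc γ.1 (k + 1)) = none := by
        by_contra h1
        obtain ⟨i, hi⟩ := Option.ne_none_iff_exists'.1 h1
        exact h0 ⟨⟨i % 3, Nat.mod_lt _ (by omega)⟩, k + 1, i, hi, rfl⟩
      exact pl_eq_none this _ (by simp [trunc])
  invariant := by
    rintro j η ⟨n, i, h1, h2⟩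
    by_cases h : ∃ ζ F, relabel F = .L ∧ penrose.Edge F η ζ
    · obtain ⟨ζ, F, h3, h4⟩ := h
      rw [genHomeo_apply, ← h3, act_of_edge h4]
      obtain ⟨m, h5, h6⟩ := h4
      obtain ⟨k, h7, h8⟩ := pl_TE h5 h3
      obtain rfl := pl_trunc_unique h1 h7
      exact ⟨m, i, h8, h2⟩
    · rw [genHomeo_apply, act_of_not_edge fun F ζ h1 h2 => h ⟨ζ, F, h1, h2⟩]
      exact ⟨n, i, h1, h2⟩
  contains := by
    rintro j γ ⟨_, n, h1, h2, h3⟩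
    refine ⟨n + 1, n, ?_, h1⟩
    rw [trunc, h2, trunc_of_eq_c h3]
    exact pl_s_two n
  uniform F x y hF h _ := by
    obtain ⟨n, h1, _⟩ := pl_conn h hF
    refine ⟨⟨n % 3, Nat.mod_lt _ (by omega)⟩, fun γ hγ => ⟨x.length, n, ?_, rfl⟩⟩
    rw [show trunc γ.1 x.length = x from hγ, h1]

/-! ### The finite levels of the action -/

open Classical in
/-- The action of a relabeled generator inside the tiles. -/
noncomputable def fp (g : Gen) (x : List Edg) : List Edg :=
  if h : ∃ y F, relabel F = g ∧ TE F x y then h.choose else x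

lemma fp_of_TE {F : State} {x y : List Edg} (h : TE F x y) : fp (relabel F) x = y := by
  have hex : ∃ y F', relabel F' = relabel F ∧ TE F' x y := ⟨y, F, rfl, h⟩
  rw [fp, dif_pos hex]
  obtain ⟨F', h1, h2⟩ := hex.choose_spec
  exact (h2.unique h h1).2

lemma fp_of_not {g : Gen} {x : List Edg} (h : ∀ F y, relabel F = g → ¬ TE F x y) : fp g x = x := by
  rw [fp, dif_neg]
  rintro ⟨ζ, F, h1, h2⟩
  exact h F ζ h1 h2

lemma fp_cases (g : Gen) (x : List Edg) :
    (∃ F, relabel F = g ∧ TE F x (fp g x)) ∨ ((∀ F y, relabel F = g → ¬ TE F x y) ∧ fp g x = x) := by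
  by_cases h : ∃ y F, relabel F = g ∧ TE F x y
  · obtain ⟨y, F, rfl, h⟩ := h
    rw [fp_of_TE h]
    exact .inl ⟨F, rfl, h⟩
  · have h' : ∀ F y, relabel F = g → ¬ TE F x y := fun F y h1 h2 => h ⟨y, F, h1, h2⟩
    exact .inr ⟨h', fp_of_not h'⟩

lemma fp_fp (g : Gen) (x : List Edg) : fp g (fp g x) = x := by
  rcases fp_cases g x with ⟨F, rfl, h⟩ | ⟨_, h⟩
  · have := fp_of_TE h.symm
    rwa [relabel_stateInv] at this
  · rw [h, h]

lemma fp_mem {g : Gen} {x : List Edg} {v : Vert} {n : ℕ} (hx : x ∈ tl v n) : fp g x ∈ tl v n := by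
  rcases fp_cases g x with ⟨F, rfl, h⟩ | ⟨_, h⟩
  · rw [mem_tl] at hx ⊢
    obtain ⟨w, h1, h2, h3, h4⟩ := h.pths
    obtain rfl := h1.unique h4 hx.1
    exact ⟨h2, h3 ▸ hx.2⟩
  · rwa [h]

lemma fp_of_sta {g : Gen} {x : List Edg} {v : Vert} (h : sta g x v ≠ none) : fp g x = x :=
  fp_of_not fun _ _ hF hT => h (hF ▸ hT.sta_eq_none v)

lemma fp_cons {g : Gen} {e : Edg} {x : List Edg} (hp : pth (psrc e) x)
    (h : cr e (sta g x (psrc e)) x = none) : fp g (e :: x) = e :: fp g x := by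
  rcases fp_cases g x with ⟨F, rfl, h1⟩ | ⟨h1, h2⟩
  · obtain ⟨w, h2, h3, h4, h5⟩ := h1.pths
    obtain rfl := h2.unique h5 hp
    exact fp_of_TE (TE_cons.2 (.inr ⟨_, rfl, h1, hp, h3⟩))
  · rw [h2]
    refine fp_of_not fun F y hF hT => ?_
    rcases TE_cons.1 hT with ⟨g', h3, rfl⟩ | ⟨y', rfl, h3, _⟩
    · rw [relabel_lab] at hF
      subst hF
      rw [h] at h3
      simp at h3
    · exact h1 F y' hF h3

lemma fp_cr {g : Gen} {e : Edg} {x y : List Edg}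
    (h : cr e (sta g x (psrc e)) x = some y) : fp g (e :: x) = y := by
  have := fp_of_TE (TE_cons.2 (.inl ⟨g, h, rfl⟩))
  rwa [relabel_lab] at this

/-- The action of `M`, `S` and, off the boundary, of `L` is the one inside the tiles. -/
lemma act_interior {g : Gen} {η : penrose.Omega} {n : ℕ} (h : sta g (trunc η.1 n) one = none)
    (hn : 1 ≤ n) :
    trunc (act g η).1 n = fp g (trunc η.1 n) ∧ ∀ k, n ≤ k → (act g η).1 k = η.1 k := by
  by_cases h1 : ∃ ζ F, relabel F = g ∧ penrose.Edge F η ζ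
  · obtain ⟨ζ, F, rfl, h1⟩ := h1
    rw [act_of_edge h1]
    rcases edge_split h1 n with ⟨h2, h3⟩ | ⟨⟨v, hv⟩, _⟩
    · exact ⟨(fp_of_TE h2).symm, fun k hk => (h3 k hk).symm⟩
    · refine absurd ((sta_eq_of_ne_nil ?_ v one).trans h) hv
      intro h0
      have := congrArg List.length h0
      rw [trunc_length] at this
      simp at this; omega
  · rw [act_of_not_edge fun F ζ h2 h3 => h1 ⟨ζ, F, h2, h3⟩, fp_of_not]
    · exact ⟨rfl, fun _ _ => rfl⟩
    · intro F y h2 h3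
      obtain ⟨_, _, h4⟩ := edge_of_TE h3
      exact h1 ⟨_, F, h2, h4⟩

/-- On the boundary `L` leads to boundary points. -/
lemma act_boundary {η : penrose.Omega} {n : ℕ} (hn : 2 ≤ n) {q : Bd} (h : trunc η.1 n = bp q n) :
    ∃ q', trunc (act .L η).1 n = bp q' n := by
  by_cases h1 : ∃ ζ F, relabel F = .L ∧ penrose.Edge F η ζ
  · obtain ⟨ζ, F, h2, h1⟩ := h1
    rw [← h2, act_of_edge h1]
    rcases edge_split h1 n with ⟨h3, _⟩ | ⟨_, v, hv⟩
    · have := TE.sta_eq_none h3 one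
      rw [h2, h, sta_bp hn] at this
      simp at this
    · obtain ⟨q', hq'⟩ := Option.ne_none_iff_exists'.1 hv
      rw [h2] at hq'
      exact ⟨q', (sta_L_iff hn (trunc_length _ _)).1 hq'⟩
  · rw [act_of_not_edge fun F ζ h2 h3 => h1 ⟨ζ, F, h2, h3⟩]
    exact ⟨q, h⟩

/-- A point of the space of infinite paths starting in the given vertex. -/
def base : Vert → penrose.Omega
  | one => ⟨fun _ => a one, fun _ => rfl⟩
  | two => xi

lemma psrc_base (v : Vert) (n : ℕ) : psrc ((base v).1 n) = v := by cases v <;> rfl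

lemma cyl_nonempty {v : Vert} {x : List Edg} (h : pth v x) : (penrose.cyl x).Nonempty :=
  ⟨glO x (base v) (by rwa [psrc_base]), trunc_gl _ _⟩

lemma cyl_cons_subset (e : Edg) (x : List Edg) : penrose.cyl (e :: x) ⊆ penrose.cyl x :=
  fun _ h => (List.cons.inj (show trunc _ _ = _ from h)).2

/-! ### Fragmentation -/

/-- Whether the `j`-th fragment acts on the `i`-th piece. -/
def actv (j i : Fin 3) : Bool := i.val + j.val ≠ 2

/-- The five generators. -/
inductive Ltr
  | N (j : Fin 3) | M | S

section Frag

variable (P : Fin 3 → Set penrose.Omega)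

open Classical in
/-- The fragments of `L`. -/
noncomputable def frag (j : Fin 3) (η : penrose.Omega) : penrose.Omega :=
  if ∃ i, actv j i = true ∧ η ∈ P i then act .L η else η

open Classical in
/-- The action of the fragments inside the tiles. -/
noncomputable def hat : Ltr → List Edg → List Edg
  | .N j, x => if ∃ i, actv j i = true ∧ penrose.cyl x ⊆ P i then fp .L x else x
  | .M, x => fp .M x
  | .S, x => fp .S x

variable {P} (hP : IsPartition (genHomeo .L) P)
include hP

lemma piece_unique {η : penrose.Omega} {i j : Fin 3} (hi : η ∈ P i) (hj : η ∈ P j) : i = j := by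
  by_contra h
  exact Set.disjoint_left.1 (hP.disjoint h) hi hj

lemma act_mem_iff {η : penrose.Omega} {i : Fin 3} : act .L η ∈ P i ↔ η ∈ P i := by
  refine ⟨fun h => ?_, hP.invariant i η⟩
  have := hP.invariant i _ h
  rwa [genHomeo_apply, act_act] at this

lemma act_xi : act .L xi = xi := by
  by_contra h
  have h1 : act .L xi ∈ ⋃ j, P j := by rw [hP.iUnion]; exact h
  obtain ⟨j, hj⟩ := Set.mem_iUnion.1 h1
  have h2 : xi ∈ ⋃ j, P j := Set.mem_iUnion.2 ⟨j, (act_mem_iff hP).1 hj⟩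
  rw [hP.iUnion] at h2
  exact h2 rfl

lemma frag_frag (j : Fin 3) (η : penrose.Omega) : frag P j (frag P j η) = η := by
  by_cases h : ∃ i, actv j i = true ∧ η ∈ P i
  · have h' : ∃ i, actv j i = true ∧ act .L η ∈ P i := by simpa only [act_mem_iff hP] using h
    rw [frag, frag, if_pos h, if_pos h', act_act]
  · have h1 : frag P j η = η := if_neg h
    rw [h1, h1]

/-- Away from ξ the pieces are open and the map is locally L or the identity. At ξ, which lies in no
piece, it may switch between the two, but both are continuous and fix ξ. -/
lemma frag_continuous (j : Fin 3) : Continuous (frag P j) := by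
  rw [continuous_iff_continuousAt]
  intro η
  by_cases hη : η = xi
  · have h1 : frag P j η = η := by
      rw [frag]; split_ifs
      · rw [hη, act_xi hP]
      · rfl
    have h2 : act .L η = η := by rw [hη, act_xi hP]
    have h3 : Tendsto (act .L) (𝓝 η) (𝓝 η) := by
      have := (act_continuous .L).tendsto η
      rwa [h2] at this
    rw [ContinuousAt, h1]
    refine fun U (hU : U ∈ 𝓝 η) => ?_
    have : ∀ᶠ γ in 𝓝 η, frag P j γ ∈ U := by
      filter_upwards [h3 hU, hU] with γ h4 h5
      rw [frag]
      split_ifs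
      · exact h4
      · exact h5
    exact this
  · have h1 : η ∈ ⋃ j, P j := by rw [hP.iUnion]; exact hη
    obtain ⟨i, hi⟩ := Set.mem_iUnion.1 h1
    have h2 := (hP.isOpen i).mem_nhds hi
    by_cases hj : actv j i = true
    · refine (act_continuous .L).continuousAt.congr ?_
      filter_upwards [h2] with γ hγ
      exact (if_pos ⟨i, hj, hγ⟩).symm
    · refine continuousAt_id.congr ?_
      filter_upwards [h2] with γ hγ
      refine (if_neg ?_).symm
      rintro ⟨k, hk, hk'⟩
      exact hj (piece_unique hP hγ hk' ▸ hk)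

/-- The homeomorphisms with which the generators act. -/
noncomputable def hom : Ltr → (penrose.Omega ≃ₜ penrose.Omega)
  | .N j => homeoOfInvol (frag P j) (frag_frag hP j) (frag_continuous hP j)
  | .M => genHomeo .M
  | .S => genHomeo .S

lemma hom_hom (s : Ltr) (η : penrose.Omega) : hom hP s (hom hP s η) = η := by
  cases s
  · exact frag_frag hP _ η
  · exact act_act _ η
  · exact act_act _ η

lemma isFragmentation_hom : IsFragmentation (genHomeo .L) P fun j => hom hP (.N j) := by
  have h1 : ∀ (j i k : Fin 3), actv j i = true → actv j k = true →
      ∀ η ∈ P i ∪ P k, hom hP (.N j) η = genHomeo .L η := by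
    rintro j i k hi hk η (h | h)
    · exact if_pos ⟨i, hi, h⟩
    · exact if_pos ⟨k, hk, h⟩
  have h2 : ∀ (j i k : Fin 3), (∀ l, actv j l = true → l = i ∨ l = k) →
      ∀ η ∉ P i ∪ P k, hom hP (.N j) η = η := by
    rintro j i k hl η h
    refine if_neg ?_
    rintro ⟨l, h3, h4⟩
    rcases hl l h3 with rfl | rfl
    · exact h (.inl h4)
    · exact h (.inr h4)
  exact ⟨h1 0 0 1 rfl rfl, h2 0 0 1 (by decide), h1 1 0 2 rfl rfl, h2 1 0 2 (by decide),
    h1 2 1 2 rfl rfl, h2 2 1 2 (by decide)⟩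

/-- Uniformity over the connections passes to inherited edges. Hence a fragment either moves or
fixes a whole cylinder at once, which makes its action on finite paths meaningful. -/
lemma TE_piece {F : State} {x y : List Edg} (h : TE F x y) (hF : relabel F = .L) (hxy : x ≠ y) :
    ∃ j, penrose.cyl x ⊆ P j := by
  induction h with
  | conn h => exact hP.uniform F _ _ hF h hxy
  | ext e _ _ _ ih =>
    obtain ⟨j, hj⟩ := ih fun h => hxy (by rw [h])
    exact ⟨j, (cyl_cons_subset _ _).trans hj⟩

lemma fp_piece {x : List Edg} (h : fp .L x ≠ x) : ∃ j, penrose.cyl x ⊆ P j := by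
  rcases fp_cases .L x with ⟨F, h1, h2⟩ | ⟨_, h1⟩
  · exact TE_piece hP h2 h1 h.symm
  · exact absurd h1 h

lemma piece_of_subset {v : Vert} {x : List Edg} (hx : pth v x) {i j : Fin 3}
    (hi : penrose.cyl x ⊆ P i) (hj : penrose.cyl x ⊆ P j) : i = j := by
  obtain ⟨γ, hγ⟩ := cyl_nonempty hx
  exact piece_unique hP (hi hγ) (hj hγ)

lemma cyl_fp_subset {v : Vert} {n : ℕ} {x : List Edg} (hx : x ∈ tl v n) (hn : 1 ≤ n) {i : Fin 3}
    (h : penrose.cyl x ⊆ P i) : penrose.cyl (fp .L x) ⊆ P i := by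
  intro γ hγ
  rcases fp_cases .L x with ⟨F, h1, h2⟩ | ⟨_, h1⟩
  · have h3 : trunc γ.1 n = fp .L x := by
      have := (mem_tl.1 (fp_mem (g := .L) hx)).2
      rw [cyl, this] at hγ
      exact hγ
    have h4 : sta .L (trunc γ.1 n) one = none := by
      have := h2.symm.sta_eq_none one
      rwa [relabel_stateInv, h1, ← h3] at this
    have h5 := (act_interior h4 hn).1
    rw [h3, fp_fp] at h5
    rw [← act_mem_iff hP]
    refine h ?_
    rw [cyl, (mem_tl.1 hx).2]
    exact h5
  · rw [h1] at hγ; exact h hγ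

lemma hat_hat {v : Vert} {n : ℕ} {x : List Edg} (hx : x ∈ tl v n) (hn : 1 ≤ n) (s : Ltr) :
    hat P s (hat P s x) = x := by
  cases s with
  | N j =>
    by_cases h : ∃ i, actv j i = true ∧ penrose.cyl x ⊆ P i
    · obtain ⟨i, h1, h2⟩ := h
      have h3 : hat P (.N j) x = fp .L x := if_pos ⟨i, h1, h2⟩
      rw [h3, hat, if_pos ⟨i, h1, cyl_fp_subset hP hx hn h2⟩, fp_fp]
    · have h1 : hat P (.N j) x = x := if_neg h
      rw [h1, h1]
  | M => exact fp_fp _ _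
  | S => exact fp_fp _ _

omit hP in
lemma hat_mem {v : Vert} {n : ℕ} {x : List Edg} (hx : x ∈ tl v n) (s : Ltr) :
    hat P s x ∈ tl v n := by
  cases s with
  | N j =>
    rw [hat]; split_ifs
    · exact fp_mem hx
    · exact hx
  | M => exact fp_mem hx
  | S => exact fp_mem hx

omit hP in
lemma hat_bp {n : ℕ} (hn : 2 ≤ n) (q : Bd) (j : Fin 3) : hat P (.N j) (bp q n) = bp q n := by
  rw [hat, fp_of_sta (v := one) (by rw [sta_bp hn]; simp), ite_self]

/-- Off the boundary the generators act inside the tiles. -/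
lemma hom_interior (s : Ltr) {η : penrose.Omega} {n : ℕ} (hn : 2 ≤ n)
    (h : ∀ j, s = .N j → sta .L (trunc η.1 n) one = none) :
    trunc (hom hP s η).1 n = hat P s (trunc η.1 n) ∧ ∀ k, n ≤ k → (hom hP s η).1 k = η.1 k := by
  have hl : 2 ≤ (trunc η.1 n).length := by rwa [trunc_length]
  cases s with
  | M => exact act_interior (sta_ne_L hl one (by simp)) (by omega)
  | S => exact act_interior (sta_ne_L hl one (by simp)) (by omega)
  | N j =>
    have h1 := act_interior (h j rfl) (by omega)
    by_cases h2 : fp .L (trunc η.1 n) = trunc η.1 n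
    · have h3 : act .L η = η := by
        rw [h2] at h1
        refine Subtype.ext (funext fun k => ?_)
        rcases lt_or_ge k n with hk | hk
        · exact trunc_inj h1.1 k hk
        · exact h1.2 k hk
      have h4 : hom hP (.N j) η = η := by
        change frag P j η = η
        rw [frag, h3, ite_self]
      rw [h4, hat, h2, ite_self]
      exact ⟨rfl, fun _ _ => rfl⟩
    · obtain ⟨k, hk⟩ := fp_piece hP h2
      have hη : η ∈ P k := hk (by rw [cyl, trunc_length]; rfl)
      by_cases hj : actv j k = true
      · have h4 : hom hP (.N j) η = act .L η := if_pos ⟨k, hj, hη⟩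
        rw [h4, hat, if_pos ⟨k, hj, hk⟩]
        exact h1
      · have h4 : hom hP (.N j) η = η := by
          refine if_neg ?_
          rintro ⟨i, h5, h6⟩
          exact hj (piece_unique hP hη h6 ▸ h5)
        have h5 : hat P (.N j) (trunc η.1 n) = trunc η.1 n := by
          refine if_neg ?_
          rintro ⟨i, h5, h6⟩
          exact hj (piece_of_subset hP (pth_trunc η n) hk h6 ▸ h5)
        rw [h4, h5]
        exact ⟨rfl, fun _ _ => rfl⟩

/-- The recursion for the action inside the tiles. -/
lemma hat_cons (s : Ltr) {e : Edg} {x : List Edg} (hp : pth (psrc e) x) (hx : 2 ≤ x.length)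
    (h : ∀ j, s = .N j → sta .L x one = none) : hat P s (e :: x) = e :: hat P s x := by
  have hne : x ≠ [] := by rintro rfl; simp at hx
  have key : ∀ g, sta g x (psrc e) = none → fp g (e :: x) = e :: fp g x := fun g hg =>
    fp_cons hp (by rw [hg]; by_contra h0; exact (cr_ne (Option.ne_none_iff_exists'.1 h0).choose_spec) rfl)
  cases s with
  | M => exact key _ (sta_ne_L hx _ (by simp))
  | S => exact key _ (sta_ne_L hx _ (by simp))
  | N j =>
    have h1 := key .L ((sta_eq_of_ne_nil hne _ one).trans (h j rfl))
    by_cases h2 : fp .L x = x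
    · rw [hat, hat, h1, h2, ite_self, ite_self]
    · obtain ⟨k, hk⟩ := fp_piece hP h2
      have hk' := (cyl_cons_subset e x).trans hk
      by_cases hj : actv j k = true
      · rw [hat, hat, if_pos ⟨k, hj, hk'⟩, if_pos ⟨k, hj, hk⟩, h1]
      · rw [hat, hat, if_neg, if_neg]
        · rintro ⟨i, h5, h6⟩
          exact hj (piece_of_subset hP hp hk h6 ▸ h5)
        · rintro ⟨i, h5, h6⟩
          exact hj (piece_of_subset hP ((pth_cons _ e x).2 ⟨rfl, hp⟩) hk' h6 ▸ h5)

omit hP in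
lemma hat_cons_bp_cases {n : ℕ} (hn : 2 ≤ n) (q : Bd) {e : Edg} {y : List Edg}
    (h : cr e (some q) (bp q n) = some y) (j : Fin 3) :
    hat P (.N j) (e :: bp q n) = y ∨ hat P (.N j) (e :: bp q n) = e :: bp q n := by
  have h1 : fp .L (e :: bp q n) = y := fp_cr (by rwa [sta_bp hn])
  rw [hat, h1]
  split_ifs <;> simp

/-- Uniformity provides some piece; one point identifies it. Continuing by c₂ forever gives a point
of {b, c₂}^ω whose first b stands at place `n - 2`, and its piece is prescribed by `contains`. -/
lemma cyl_m_subset {n : ℕ} (hn : 2 ≤ n) (e : Edg) (he : e = b ∨ e = c two) :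
    penrose.cyl (e :: bp .m n) ⊆ P ⟨(n - 2) % 3, Nat.mod_lt _ (by omega)⟩ := by
  have hT : ∃ F y, relabel F = .L ∧ pconn F (e :: bp .m n) y ∧ e :: bp .m n ≠ y := by
    rcases he with rfl | rfl
    · exact ⟨_, _, relabel_lab .L _ _ _, pconn_iff.2 ⟨.L, b, _, rfl, by rw [sta_bp hn]; rfl, rfl⟩,
        by simp⟩
    · exact ⟨_, _, relabel_lab .L _ _ _, pconn_iff.2 ⟨.L, c two, _, rfl, by rw [sta_bp hn]; rfl, rfl⟩,
        by simp⟩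
  obtain ⟨F, y, h1, h2, h3⟩ := hT
  obtain ⟨j, hj⟩ := hP.uniform F _ _ h1 h2 h3
  have hpt : pth two (e :: bp .m n) :=
    ⟨by rcases he with rfl | rfl <;> rfl,
      by have := (sta_pth (sta_bp hn .m one)).1; rcases he with rfl | rfl <;> exact this⟩
  let γ := glO (e :: bp .m n) (base two) (by rwa [psrc_base])
  have hγ : trunc γ.1 (n + 1) = e :: bp .m n := by
    have := trunc_gl (e :: bp .m n) (base two).1
    rw [List.length_cons, bp_length hn] at this
    exact this
  have h4 : γ ∈ P j := hj (by rw [cyl, List.length_cons, bp_length hn]; exact hγ)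
  have hb : bp .m n = b :: b :: List.replicate (n - 2) (c two) := rfl
  have hlow : ∀ m, m < n - 2 → γ.1 m = c two := by
    have h5 := trunc_drop γ.1 (n - 2) 3
    rw [show n - 2 + 3 = n + 1 by omega, hγ, hb] at h5
    have h6 : trunc γ.1 (n - 2) = trunc xi.1 (n - 2) := by
      rw [trunc_of_eq_c (γ := xi.1) fun _ _ => rfl, ← h5]; rfl
    exact fun m hm => trunc_inj h6 m hm
  have h7 : γ.1 (n - 2) = b ∧ γ.1 (n - 1) = b ∧ γ.1 n = e := by
    obtain ⟨m, rfl⟩ := Nat.exists_eq_add_of_le' hn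
    simp only [trunc, bp, List.cons.injEq] at hγ
    exact ⟨hγ.2.2.1, hγ.2.1, hγ.1⟩
  have h8 : γ ∈ pieceXi ⟨(n - 2) % 3, Nat.mod_lt _ (by omega)⟩ := by
    refine ⟨fun m => ?_, n - 2, rfl, h7.1, hlow⟩
    rcases lt_or_ge m (n - 2) with hm | hm
    · exact .inr (hlow m hm)
    · rcases Nat.lt_or_ge n m with hm' | hm'
      · right
        exact gl_of_le (by rw [List.length_cons, bp_length hn]; omega) _
      · obtain rfl | rfl | rfl : m = n - 2 ∨ m = n - 1 ∨ m = n := by omega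
        · exact .inl h7.1
        · exact .inl h7.2.1
        · rw [h7.2.2]; exact he
  rw [← piece_unique hP h4 (hP.contains _ h8)]
  exact hj

/-- A single bit of the fragment, the one of the piece with index `n - 2`, decides whether the
copies b𝒯₂ and c₂𝒯₂ are exchanged at μ₂. -/
lemma hat_m {n : ℕ} (hn : 2 ≤ n) (j : Fin 3) (e f : Edg) (h : e = b ∧ f = c two ∨ e = c two ∧ f = b) :
    hat P (.N j) (e :: bp .m n) =
      if actv j ⟨(n - 2) % 3, Nat.mod_lt _ (by omega)⟩ then f :: bp .m n else e :: bp .m n := by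
  have he : e = b ∨ e = c two := h.imp And.left And.left
  have hc := cyl_m_subset hP hn e he
  have hpt : pth two (e :: bp .m n) :=
    ⟨by rcases he with rfl | rfl <;> rfl,
      by have := (sta_pth (sta_bp hn .m one)).1; rcases he with rfl | rfl <;> exact this⟩
  have hf : fp .L (e :: bp .m n) = f :: bp .m n := by
    refine fp_cr ?_
    rw [sta_bp hn]
    rcases h with ⟨rfl, rfl⟩ | ⟨rfl, rfl⟩ <;> rfl
  by_cases hj : actv j ⟨(n - 2) % 3, Nat.mod_lt _ (by omega)⟩ = true
  · rw [if_pos hj, hat, if_pos ⟨_, hj, hc⟩, hf]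
  · rw [if_neg hj, hat, if_neg]
    rintro ⟨i, h1, h2⟩
    exact hj (piece_of_subset hP hpt h2 hc ▸ h1)

end Frag

/-! ### Runs of visits to boundary points -/

/-- The activity of a product of fragments on the three pieces (an element of the Klein group). -/
abbrev Kln := Bool × Bool

/-- The activity on a piece. -/
def bit (κ : Kln) (i : ℕ) : Bool :=
  if i % 3 = 0 then κ.1 else if i % 3 = 1 then κ.2 else xor κ.1 κ.2

/-- The product. -/
def kmul (κ κ' : Kln) : Kln := (xor κ.1 κ'.1, xor κ.2 κ'.2)

/-- The activity of a single fragment. -/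
def kl (j : Fin 3) : Kln := (actv j 0, actv j 1)

/-- The fragment `j` omits only the piece 2 − j. So the three activities are the nontrivial elements
of the Klein group, in each of which the third bit is the sum of the other two. -/
lemma bit_kl (j i : Fin 3) : bit (kl j) i.1 = actv j i := by revert i j; decide

lemma bit_mod (κ : Kln) (i : ℕ) : bit κ (i % 3) = bit κ i := by simp [bit]

lemma bit_kmul (κ κ' : Kln) (i : ℕ) : bit (kmul κ κ') i = xor (bit κ i) (bit κ' i) := by
  unfold bit kmul
  split_ifs
  · rfl
  · rfl
  · revert κ κ'; decide

lemma kmul_assoc (κ κ' κ'' : Kln) : kmul (kmul κ κ') κ'' = kmul κ (kmul κ' κ'') := by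
  revert κ κ' κ''; decide

lemma kmul_kmul_cancel (κ κ' κ'' : Kln) : kmul (kmul κ κ'') (kmul κ' κ'') = kmul κ κ' := by
  revert κ κ' κ''; decide

lemma kmul_self (κ : Kln) : kmul κ κ = (false, false) := by revert κ; decide

lemma kmul_one (κ : Kln) : kmul κ (false, false) = κ := by revert κ; decide

/-- The memory attached to a position: the boundary point visited last and the product of the
letters read there during the last run of visits. -/
abbrev Mem := Option (Bd × Kln)

/-- The effect on the memory of a visit to a boundary point. -/
def upd : Mem → Bd → Fin 3 → Mem
  | some (q', κ), q, j => if q' = q then some (q, kmul κ (kl j)) else some (q, kl j)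
  | none, q, j => some (q, kl j)

/-- The memory is a run of visits to the given boundary point. -/
def isRun (q : Bd) : Mem → Bool
  | some (q', _) => q' = q
  | none => false

lemma upd_of_isRun {q : Bd} {κ : Kln} {j : Fin 3} :
    upd (some (q, κ)) q j = some (q, kmul κ (kl j)) := by simp [upd]

lemma upd_of_not {q : Bd} {m : Mem} {j : Fin 3} (h : isRun q m = false) :
    upd m q j = some (q, kl j) := by
  rcases m with _ | ⟨q', κ⟩
  · rfl
  · simp [isRun] at h; simp [upd, h]

lemma upd_eq (m : Mem) (q : Bd) (j : Fin 3) : ∃ κ, upd m q j = some (q, κ) := by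
  rcases m with _ | ⟨q', κ⟩
  · exact ⟨_, rfl⟩
  · by_cases h : q' = q
    · exact ⟨kmul κ (kl j), by simp [upd, h]⟩
    · exact ⟨kl j, by simp [upd, h]⟩

lemma isRun_iff {q : Bd} {m : Mem} : isRun q m = true ↔ ∃ κ, m = some (q, κ) := by
  rcases m with _ | ⟨q', κ⟩ <;> simp [isRun, eq_comm]

section Mem

variable (P : Fin 3 → Set penrose.Omega)

/-- The memory at a position after reading a word (the head of the list is read last). -/
noncomputable def mem : List Ltr → List Edg → Mem
  | [], _ => none
  | s :: w, x => match s, sta .L x one with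
    | .N j, some q => upd (mem w x) q j
    | s, _ => mem w (hat P s x)

lemma mem_N_some {w : List Ltr} {x : List Edg} {q : Bd} (h : sta .L x one = some q) (j : Fin 3) :
    mem P (.N j :: w) x = upd (mem P w x) q j := by
  simp only [mem, h]

lemma mem_of_none {w : List Ltr} {x : List Edg} {s : Ltr}
    (h : ∀ j, s = .N j → sta .L x one = none) : mem P (s :: w) x = mem P w (hat P s x) := by
  cases s with
  | N j => simp only [mem, h j rfl]
  | M => rfl
  | S => rfl

lemma mem_bp {n : ℕ} (hn : 2 ≤ n) (w : List Ltr) (q : Bd) (j : Fin 3) :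
    mem P (.N j :: w) (bp q n) = upd (mem P w (bp q n)) q j :=
  mem_N_some P (sta_bp hn q one) j

/-- The boundary types of a tile. -/
def bds : Vert → Finset Bd
  | one => {.l one, .s one}
  | two => {.l two, .s two, .m}

lemma mem_bds {v : Vert} {q : Bd} : q ∈ bds v ↔ q.vert = v := by
  cases v <;> rcases q with (_ | _) | (_ | _) | _ <;> simp [bds, Bd.vert]

lemma bp_mem {n : ℕ} (hn : 2 ≤ n) (q : Bd) : bp q n ∈ tl q.vert n :=
  mem_tl.2 ⟨(sta_pth (sta_bp hn q one)).1, bp_length hn q⟩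

lemma bp_inj {n : ℕ} (hn : 2 ≤ n) {q q' : Bd} (h : bp q n = bp q' n) : q = q' := by
  have h1 := sta_bp hn q one
  rw [h, sta_bp hn q' one] at h1
  exact (Option.some.inj h1).symm

lemma sta_cases {v : Vert} {n : ℕ} (hn : 2 ≤ n) {x : List Edg} (hx : x ∈ tl v n) :
    sta .L x one = none ∨ ∃ q ∈ bds v, x = bp q n := by
  cases h : sta .L x one with
  | none => exact .inl rfl
  | some q =>
    have h1 := (sta_L_iff hn (mem_tl.1 hx).2).1 h
    refine .inr ⟨q, mem_bds.2 ?_, h1⟩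
    have h2 := bp_mem hn q
    rw [← h1] at h2
    refine (mem_tl.1 h2).1.unique ?_ (mem_tl.1 hx).1
    rintro rfl
    have := (mem_tl.1 hx).2
    simp at this; omega

variable {P} (hP : IsPartition (genHomeo .L) P)
include hP

lemma sum_hat {v : Vert} {n : ℕ} (hn : 1 ≤ n) (s : Ltr) (f : List Edg → ℝ) :
    ∑ x ∈ tl v n, f (hat P s x) = ∑ x ∈ tl v n, f x :=
  Finset.sum_nbij' (hat P s) (hat P s) (fun _ hx => hat_mem hx s) (fun _ hx => hat_mem hx s)
    (fun _ hx => hat_hat hP hx hn s) (fun _ hx => hat_hat hP hx hn s) (fun _ _ => rfl)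

/-- Comparison of sums over a tile before and after a step that is trivial off the boundary. -/
lemma sum_step {v : Vert} {n : ℕ} (hn : 2 ≤ n) (j : Fin 3) (f f' : List Edg → ℝ)
    (B : Finset Bd) (hB : B ⊆ bds v)
    (h : ∀ x ∈ tl v n, (∀ q ∈ B, x ≠ bp q n) → f' x = f (hat P (.N j) x)) :
    ∑ x ∈ tl v n, f' x = ∑ x ∈ tl v n, f x + ∑ q ∈ B, (f' (bp q n) - f (bp q n)) := by
  rw [← sum_hat hP (v := v) (by omega) (.N j) f, ← sub_eq_iff_eq_add', ← Finset.sum_sub_distrib]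
  have h1 : ∑ q ∈ B, (f' (bp q n) - f (bp q n)) =
      ∑ x ∈ B.image fun q => bp q n, (f' x - f (hat P (.N j) x)) := by
    rw [Finset.sum_image fun q _ q' _ h => bp_inj hn h]
    refine Finset.sum_congr rfl fun q _ => ?_
    rw [hat_bp hn]
  rw [h1]
  symm
  refine Finset.sum_subset ?_ ?_
  · intro x hx
    obtain ⟨q, hq, rfl⟩ := Finset.mem_image.1 hx
    have := bp_mem hn q
    rwa [mem_bds.1 (hB hq)] at this
  · intro x hx hx'
    rw [h x hx, sub_self]
    rintro q hq rfl
    exact hx' (Finset.mem_image_of_mem _ hq)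

lemma sum_mem_step {v : Vert} {n : ℕ} (hn : 2 ≤ n) (j : Fin 3) (w : List Ltr) (φ : Mem → ℝ) :
    ∑ x ∈ tl v n, φ (mem P (.N j :: w) x) = ∑ x ∈ tl v n, φ (mem P w x) +
      ∑ q ∈ bds v, (φ (upd (mem P w (bp q n)) q j) - φ (mem P w (bp q n))) := by
  rw [sum_step hP hn j (fun x => φ (mem P w x)) (fun x => φ (mem P (.N j :: w) x)) (bds v) subset_rfl]
  · simp only [mem_bp P hn]
  · intro x hx h
    have : sta .L x one = none := (sta_cases hn hx).resolve_right fun ⟨q, hq, h1⟩ => h q hq h1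
    simp only [mem_of_none P (w := w) (s := .N j) fun _ _ => this]

lemma sum_mem_step' {v : Vert} {n : ℕ} (hn : 2 ≤ n) {s : Ltr} (hs : ∀ j, s ≠ .N j) (w : List Ltr)
    (φ : Mem → ℝ) : ∑ x ∈ tl v n, φ (mem P (s :: w) x) = ∑ x ∈ tl v n, φ (mem P w x) := by
  refine .trans ?_ (sum_hat hP (by omega) s fun x => φ (mem P w x))
  refine Finset.sum_congr rfl fun x _ => ?_
  rw [mem_of_none P fun j h => absurd h (hs j)]

omit hP in
/-- The memory refers to boundary points of the right tile. -/
lemma mem_vert {v : Vert} {n : ℕ} (hn : 2 ≤ n) (w : List Ltr) {x : List Edg} (hx : x ∈ tl v n)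
    {q : Bd} {κ : Kln} (h : mem P w x = some (q, κ)) : q.vert = v := by
  induction w generalizing x q κ with
  | nil => simp [mem] at h
  | cons s w ih =>
    by_cases h1 : ∀ j, s = .N j → sta .L x one = none
    · rw [mem_of_none P h1] at h
      exact ih (hat_mem hx s) h
    · push Not at h1
      obtain ⟨j, rfl, h1⟩ := h1
      obtain ⟨q', hq', rfl⟩ := (sta_cases hn hx).resolve_left h1
      rw [mem_bp P hn] at h
      obtain ⟨κ', h2⟩ := upd_eq (mem P w (bp q' n)) q' j
      rw [h2] at h
      simp at h
      rw [← h.1]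
      exact mem_bds.1 hq'

omit hP in
lemma sta_cons_one {e : Edg} {x : List Edg} (hx : x ≠ []) :
    sta .L (e :: x) one = stp e (sta .L x one) := by
  rw [sta_cons, sta_eq_of_ne_nil hx _ one]

omit hP in
lemma ne_nil_of_mem {v : Vert} {n : ℕ} (hn : 2 ≤ n) {x : List Edg} (hx : x ∈ tl v n) : x ≠ [] := by
  rintro rfl; have := (mem_tl.1 hx).2; simp at this; omega

/-- Off the boundary the memory at a continuation moves along with the position. -/
lemma mem_cons_of_none {v : Vert} {n : ℕ} (hn : 2 ≤ n) {w : List Ltr} {x : List Edg} (hx : x ∈ tl v n)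
    {s : Ltr} (h : ∀ j, s = .N j → sta .L x one = none) {e : Edg} (he : psrc e = v) :
    mem P (s :: w) (e :: x) = mem P w (e :: hat P s x) := by
  rw [mem_of_none P fun j hj => by rw [sta_cons_one (ne_nil_of_mem hn hx), h j hj, stp_none],
    hat_cons hP s (he ▸ (mem_tl.1 hx).1) ((mem_tl.1 hx).2 ▸ hn) h]

omit hP in
lemma cons_l {n : ℕ} (_ : 2 ≤ n) (v : Vert) : c v :: bp (.l two) n = bp (.l v) (n + 1) := by
  cases v <;> simp [bp, lam, List.replicate_succ]

omit hP in
lemma cons_b_l {n : ℕ} (_ : 2 ≤ n) : b :: bp (.l two) n = bp (.s two) (n + 1) := by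
  simp [bp, lam]

omit hP in
lemma cons_a_l {n : ℕ} (_ : 2 ≤ n) : a one :: bp (.l one) n = bp (.s one) (n + 1) := by
  simp [bp]

omit hP in
lemma cons_b_s {n : ℕ} (_ : 2 ≤ n) : b :: bp (.s two) n = bp .m (n + 1) := by
  simp [bp]

/-- The relation between the memories of consecutive levels. -/
lemma mem_coupling {n : ℕ} (hn : 2 ≤ n) (w : List Ltr) {x : List Edg} (hx : x ∈ tl two n) :
    (isRun (.l two) (mem P w x) = true → (∀ v, isRun (.l v) (mem P w (c v :: x)) = true) ∧
      isRun (.s two) (mem P w (b :: x)) = true) ∧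
    (isRun (.s two) (mem P w x) = true → isRun .m (mem P w (b :: x)) = true) := by
  induction w generalizing x with
  | nil => simp [mem, isRun]
  | cons s w ih =>
    by_cases h1 : ∀ j, s = .N j → sta .L x one = none
    · have := ih (hat_mem (P := P) hx s)
      rw [mem_of_none P h1, mem_cons_of_none hP hn hx h1 (e := b) rfl]
      refine ⟨fun h => ⟨fun v => ?_, (this.1 h).2⟩, this.2⟩
      rw [mem_cons_of_none hP hn hx h1 (e := c v) rfl]
      exact (this.1 h).1 v
    · push Not at h1
      obtain ⟨j, rfl, h1⟩ := h1
      obtain ⟨q, hq, rfl⟩ := (sta_cases hn hx).resolve_left h1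
      have hrun : ∀ m q j, isRun q (upd m q j) = true := fun m q j => isRun_iff.2 (upd_eq m q j)
      have hrun' : ∀ {m q q' j}, isRun q' (upd m q j) = true → q' = q := fun {m q q' j} h => by
        obtain ⟨κ, h2⟩ := upd_eq m q j
        rw [h2] at h
        simpa [isRun, eq_comm] using h
      -- A visit to λ₂ is at the same time a visit to its continuations λ_v and σ₂, and a visit to
      -- σ₂ is one to μ₂ on the next level.
      rw [mem_bp P hn]
      constructor
      · intro h
        obtain rfl := hrun' h
        constructor
        · intro v
          rw [cons_l hn, mem_bp P (by omega)]
          exact hrun _ _ _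
        · rw [cons_b_l hn, mem_bp P (by omega)]
          exact hrun _ _ _
      · intro h
        obtain rfl := hrun' h
        rw [cons_b_s hn, mem_bp P (by omega)]
        exact hrun _ _ _

end Mem

/-! ### The weights of runs -/

/-- The indicator of a bit. -/
def iv (x : Bool) : ℝ := if x then 1 else 0

lemma iv_nonneg (x : Bool) : 0 ≤ iv x := by cases x <;> simp [iv]

lemma iv_xor (x y : Bool) : iv x ≤ iv (xor x y) + iv y := by cases x <;> cases y <;> simp [iv]

/-- The contraction rates for which the weights exist. -/
structure Rate (h : ℝ) : Prop where
  pos : 0 < h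
  lt_one : h < 1
  lt : 2 < h ^ 5 + h ^ 4 + h ^ 3

/-- The coefficient `1 / (h³ + h² + h)`. -/
noncomputable def cg (h : ℝ) : ℝ := 1 / (h ^ 3 + h ^ 2 + h)

/-- The constant term of the weights. -/
noncomputable def cb (h : ℝ) : ℝ := h ^ 2 - 2 * cg h

/-- The coefficients of the weights of the runs at `λ`. -/
noncomputable def al (h : ℝ) (k : ℕ) : ℝ :=
  if k % 3 = 0 then 1 / h else if k % 3 = 1 then (1 / h - cg h) / h else cg h

/-- The coefficients of the potential of the runs at `λ`. -/
noncomputable def th (h : ℝ) (k : ℕ) : ℝ :=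
  if k % 3 = 0 then 0 else if k % 3 = 1 then 1 / h - cg h else h * cg h

/-- The weight of a run at a boundary point of level `n`. -/
noncomputable def om (h : ℝ) (n : ℕ) : Bd → Kln → ℝ
  | .l _, κ => cb h + (al h (2 * n) * iv (bit κ 0) + al h (1 + 2 * n) * iv (bit κ 1) +
      al h (2 + 2 * n) * iv (bit κ 2))
  | .s _, κ => h * cb h + iv (bit κ (n + 2))
  | .m, κ => h ^ 2 * cb h + h * iv (bit κ (n + 1))

/-- The potential of a run at `λ`. -/
noncomputable def pot (h : ℝ) (n : ℕ) (κ : Kln) : ℝ :=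
  th h (2 * n) * iv (bit κ 0) + th h (1 + 2 * n) * iv (bit κ 1) + th h (2 + 2 * n) * iv (bit κ 2)

namespace Rate

variable {h : ℝ} (H : Rate h)
include H

lemma cg_pos : 0 < cg h := by
  have := H.pos
  unfold cg; positivity

lemma cg_mul : cg h * (h ^ 3 + h ^ 2 + h) = 1 := by
  have := H.pos
  unfold cg; field_simp

/-- Here the quintic enters: multiplied by h³ + h² + h, the constant h² − 2 `cg h` becomes h⁵ + h⁴ +
h³ − 2. -/
lemma cb_pos : 0 < cb h := by
  have h1 := H.cg_mul
  have h2 := H.lt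
  have h3 := H.pos
  have : 0 < cb h * (h ^ 3 + h ^ 2 + h) := by unfold cb; nlinarith
  exact pos_of_mul_pos_left this (by positivity)

lemma inv_sub_pos : 0 < 1 / h - cg h := by
  have h3 := H.pos
  have : 1 / h - cg h = cg h * (h ^ 2 + h) := by
    have := H.cg_mul
    field_simp
    linarith
  rw [this]
  have := H.cg_pos
  positivity

lemma al_nonneg (k : ℕ) : 0 ≤ al h k := by
  have := H.pos
  have := H.cg_pos
  have := H.inv_sub_pos
  unfold al; split_ifs <;> positivity

lemma th_nonneg (k : ℕ) : 0 ≤ th h k := by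
  have := H.pos
  have := H.cg_pos
  have := H.inv_sub_pos
  unfold th; split_ifs <;> positivity

lemma om_nonneg (n : ℕ) (q : Bd) (κ : Kln) : 0 ≤ om h n q κ := by
  have := H.pos
  have := H.cb_pos
  have h1 := H.al_nonneg
  have h2 := iv_nonneg
  cases q with
  | l v => exact add_nonneg this.le (add_nonneg (add_nonneg (mul_nonneg (h1 _) (h2 _))
      (mul_nonneg (h1 _) (h2 _))) (mul_nonneg (h1 _) (h2 _)))
  | s v => have := h2 (bit κ (n + 2)); unfold om; positivity
  | m => have := h2 (bit κ (n + 1)); unfold om; positivity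

lemma le_om (n : ℕ) (q : Bd) (κ : Kln) : h ^ 2 * cb h ≤ om h n q κ := by
  have h0 := H.pos
  have hb := H.cb_pos
  have h1 := H.al_nonneg
  have h2 := iv_nonneg
  have h3 : h * cb h ≤ cb h := by nlinarith [H.lt_one]
  have h4 : h * (h * cb h) ≤ h * cb h := by nlinarith [H.lt_one]
  cases q with
  | l v =>
    have := add_nonneg (add_nonneg (mul_nonneg (h1 (2 * n)) (h2 (bit κ 0)))
      (mul_nonneg (h1 (1 + 2 * n)) (h2 (bit κ 1)))) (mul_nonneg (h1 (2 + 2 * n)) (h2 (bit κ 2)))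
    unfold om; nlinarith
  | s v => have := h2 (bit κ (n + 2)); unfold om; nlinarith
  | m => have := mul_nonneg h0.le (h2 (bit κ (n + 1))); unfold om; nlinarith

/-- A bound for all the weights. -/
lemma om_le (n : ℕ) (q : Bd) (κ : Kln) : om h n q κ ≤ 2 + 3 * (1 / h + (1 / h - cg h) / h + cg h) := by
  have h0 := H.pos
  have h5 := H.lt_one
  have h6 := H.cg_pos
  have hb := H.cb_pos
  have h7 := H.inv_sub_pos
  have h1 : ∀ k, al h k ≤ 1 / h + (1 / h - cg h) / h + cg h := fun k => by
    have a1 : 0 < 1 / h := by positivity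
    have a2 : 0 < (1 / h - cg h) / h := by positivity
    unfold al; split_ifs <;> linarith
  have h2 : ∀ x, iv x ≤ 1 := fun x => by cases x <;> simp [iv]
  have h3 : ∀ k x, al h k * iv x ≤ 1 / h + (1 / h - cg h) / h + cg h := fun k x =>
    (mul_le_of_le_one_right (H.al_nonneg k) (h2 x)).trans (h1 k)
  have h4 := (H.al_nonneg 0).trans (h1 0)
  have hb1 : cb h ≤ 1 := by unfold cb; nlinarith
  have hb2 : h * cb h ≤ 1 := by nlinarith
  have hb3 : h * (h * cb h) ≤ 1 := by nlinarith
  cases q with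
  | l v =>
    have a1 := h3 (2 * n) (bit κ 0)
    have a2 := h3 (1 + 2 * n) (bit κ 1)
    have a3 := h3 (2 + 2 * n) (bit κ 2)
    unfold om; linarith
  | s v => have := h2 (bit κ (n + 2)); unfold om; linarith
  | m =>
    have := mul_le_mul h5.le (h2 (bit κ (n + 1))) (iv_nonneg _) zero_le_one
    unfold om; nlinarith

lemma pot_nonneg (n : ℕ) (κ : Kln) : 0 ≤ pot h n κ := by
  have h1 := H.th_nonneg
  have h2 := iv_nonneg
  exact add_nonneg (add_nonneg (mul_nonneg (h1 _) (h2 _)) (mul_nonneg (h1 _) (h2 _)))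
    (mul_nonneg (h1 _) (h2 _))

/-- Subadditivity: multiplying by κ' changes only those bits in which κ' is active. -/
lemma pot_le (n : ℕ) (κ κ' : Kln) : pot h n κ ≤ pot h n (kmul κ κ') + pot h n κ' := by
  have h1 : ∀ k i, th h k * iv (bit κ i) ≤ th h k * iv (bit (kmul κ κ') i) + th h k * iv (bit κ' i) :=
    fun k i => by
      rw [← mul_add, bit_kmul]
      exact mul_le_mul_of_nonneg_left (iv_xor _ _) (H.th_nonneg k)
  have a1 := h1 (2 * n) 0
  have a2 := h1 (1 + 2 * n) 1
  have a3 := h1 (2 + 2 * n) 2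
  unfold pot; linarith

/-- A run at λ₂ of level n gives one at bλ₂ = σ₂ and one at c₂λ₂ = λ₂ of level n + 1. The first two
terms are the weight of the run at σ₂, as n + 3 ≡ n modulo 3, and the potential is what remains for
λ₂. The index i + 2n stands for i − n modulo 3, the phase of piece i; phase 0 is the piece that
decides the swap when the run has become one at μ₂, two levels higher. -/
lemma mul_om_l (n : ℕ) (v : Vert) (κ : Kln) :
    h * om h n (.l v) κ = h * cb h + iv (bit κ n) + pot h n κ := by
  have h0 := H.pos.ne'
  have h1 : bit κ n = bit κ (n % 3) := (bit_mod κ n).symm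
  rw [h1]
  unfold om pot al th
  have : n % 3 = 0 ∨ n % 3 = 1 ∨ n % 3 = 2 := by omega
  rcases this with h2 | h2 | h2
  · rw [h2, show 2 * n % 3 = 0 by omega, show (1 + 2 * n) % 3 = 1 by omega,
      show (2 + 2 * n) % 3 = 2 by omega]
    simp
    field_simp
    ring
  · rw [h2, show 2 * n % 3 = 2 by omega, show (1 + 2 * n) % 3 = 0 by omega,
      show (2 + 2 * n) % 3 = 1 by omega]
    simp
    field_simp
    ring
  · rw [h2, show 2 * n % 3 = 1 by omega, show (1 + 2 * n) % 3 = 2 by omega,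
      show (2 + 2 * n) % 3 = 0 by omega]
    simp
    field_simp
    ring

/-- One level higher every phase has dropped by one. The coefficients in `al` and `th` are the
solution of the requirement that weight minus potential have the same coefficient g on all three
pieces; going once around the phases forces g(h³ + h² + h) = 1. -/
lemma om_succ_l (n : ℕ) (v : Vert) (κ : Kln) : om h (n + 1) (.l v) κ =
    pot h n κ + (cb h + cg h * (iv (bit κ 0) + iv (bit κ 1) + iv (bit κ 2))) := by
  have h0 := H.pos.ne'
  have e1 : cg h = 1 / h - (1 / h - cg h) := by ring
  have e2 : (1 / h - cg h) / h - h * cg h = cg h := by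
    have := H.cg_mul
    field_simp
    linarith
  unfold om pot al th
  have : n % 3 = 0 ∨ n % 3 = 1 ∨ n % 3 = 2 := by omega
  rcases this with h2 | h2 | h2
  · rw [show 2 * n % 3 = 0 by omega, show (1 + 2 * n) % 3 = 1 by omega,
      show (2 + 2 * n) % 3 = 2 by omega, show 2 * (n + 1) % 3 = 2 by omega,
      show (1 + 2 * (n + 1)) % 3 = 0 by omega, show (2 + 2 * (n + 1)) % 3 = 1 by omega]
    simp only [if_true, one_ne_zero, OfNat.ofNat_ne_zero, OfNat.ofNat_ne_one, if_false]
    linear_combination (iv (bit κ 2)) * e2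
  · rw [show 2 * n % 3 = 2 by omega, show (1 + 2 * n) % 3 = 0 by omega,
      show (2 + 2 * n) % 3 = 1 by omega, show 2 * (n + 1) % 3 = 1 by omega,
      show (1 + 2 * (n + 1)) % 3 = 2 by omega, show (2 + 2 * (n + 1)) % 3 = 0 by omega]
    simp only [if_true, one_ne_zero, OfNat.ofNat_ne_zero, OfNat.ofNat_ne_one, if_false]
    linear_combination (iv (bit κ 0)) * e2
  · rw [show 2 * n % 3 = 1 by omega, show (1 + 2 * n) % 3 = 2 by omega,
      show (2 + 2 * n) % 3 = 0 by omega, show 2 * (n + 1) % 3 = 0 by omega,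
      show (1 + 2 * (n + 1)) % 3 = 1 by omega, show (2 + 2 * (n + 1)) % 3 = 2 by omega]
    simp only [if_true, one_ne_zero, OfNat.ofNat_ne_zero, OfNat.ofNat_ne_one, if_false]
    linear_combination (iv (bit κ 1)) * e2

end Rate

/-- The weight of a memory, if the run stored in it ends. -/
noncomputable def Ub (h : ℝ) (n : ℕ) : Mem → ℝ
  | none => 0
  | some (q, κ) => om h n q κ

/-- The weight of a memory of level `n + 1` in the copies `a₂𝒯` and `c₂𝒯`. -/
noncomputable def Uc (h : ℝ) (n : ℕ) : Mem → ℝ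
  | none => 0
  | some (.l _, κ) => pot h n κ
  | some (q, κ) => om h (n + 1) q κ

@[simp] lemma Ub_none (h : ℝ) (n : ℕ) : Ub h n none = 0 := rfl

@[simp] lemma Ub_some (h : ℝ) (n : ℕ) (q : Bd) (κ : Kln) : Ub h n (some (q, κ)) = om h n q κ := rfl

@[simp] lemma Uc_none (h : ℝ) (n : ℕ) : Uc h n none = 0 := rfl

@[simp] lemma Uc_l (h : ℝ) (n : ℕ) (v : Vert) (κ : Kln) : Uc h n (some (.l v, κ)) = pot h n κ := rfl

@[simp] lemma Uc_s (h : ℝ) (n : ℕ) (v : Vert) (κ : Kln) :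
    Uc h n (some (.s v, κ)) = om h (n + 1) (.s v) κ := rfl

@[simp] lemma Uc_m (h : ℝ) (n : ℕ) (κ : Kln) : Uc h n (some (.m, κ)) = om h (n + 1) .m κ := rfl

/-- The price of ending a run by a visit. -/
noncomputable def wt (h : ℝ) (n : ℕ) (q : Bd) (m : Mem) : ℝ := if isRun q m then 0 else Ub h n m

/-- Multiplication of the stored product. -/
def tw (κ : Kln) : Mem → Mem
  | none => none
  | some (q, κ') => some (q, kmul κ' κ)

/-- The potential of the memories at the two continuations of a position. -/
noncomputable def Wt (h : ℝ) (n : ℕ) : Mem → Mem → Mem → ℝ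
  | none, mc, mb => Uc h n mc + Ub h (n + 1) mb
  | some (.l _, κ), mc, mb => Uc h n (tw κ mc) + Ub h (n + 1) (tw κ mb) - h * cb h
  | some (.s _, κ), mc, mb => Uc h n mc + Ub h (n + 1) (tw κ mb) - h ^ 2 * cb h
  | some (.m, κ), mc, mb => (if bit κ (n + 1) then Uc h n mb + Ub h (n + 1) mc
      else Uc h n mc + Ub h (n + 1) mb) - h ^ 3 * cb h

lemma Wt_l (h : ℝ) (n : ℕ) (v : Vert) (κ : Kln) (mc mb : Mem) : Wt h n (some (.l v, κ)) mc mb =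
    Uc h n (tw κ mc) + Ub h (n + 1) (tw κ mb) - h * cb h := rfl

lemma Wt_s (h : ℝ) (n : ℕ) (v : Vert) (κ : Kln) (mc mb : Mem) : Wt h n (some (.s v, κ)) mc mb =
    Uc h n mc + Ub h (n + 1) (tw κ mb) - h ^ 2 * cb h := rfl

lemma Wt_m (h : ℝ) (n : ℕ) (κ : Kln) (mc mb : Mem) : Wt h n (some (.m, κ)) mc mb =
    (if bit κ (n + 1) then Uc h n mb + Ub h (n + 1) mc else Uc h n mc + Ub h (n + 1) mb) -
      h ^ 3 * cb h := rfl

namespace Rate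

variable {h : ℝ} (H : Rate h)
include H

lemma Ub_nonneg (n : ℕ) (m : Mem) : 0 ≤ Ub h n m := by
  rcases m with _ | ⟨q, κ⟩
  · exact le_rfl
  · exact H.om_nonneg _ _ _

lemma Uc_nonneg (n : ℕ) (m : Mem) : 0 ≤ Uc h n m := by
  rcases m with _ | ⟨q | q | _, κ⟩
  · exact le_rfl
  · exact H.pot_nonneg _ _
  · rw [Uc_s]; exact H.om_nonneg _ _ _
  · rw [Uc_m]; exact H.om_nonneg _ _ _

/-- The gap is a discount for runs at λ₂ seen from the copies c₂𝒯₂ and a₂𝒯₁. The only boundary point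
of the larger tile in these copies is c₂λ₂ = λ₂ itself, so such a run cannot be ended before the
position crosses into b𝒯₂. -/
lemma Uc_le (n : ℕ) (m : Mem) : Uc h n m ≤ Ub h (n + 1) m := by
  rcases m with _ | ⟨q | q | _, κ⟩
  · exact le_rfl
  · rw [Uc_l, Ub_some, H.om_succ_l]
    have h1 := H.cb_pos
    have h2 := H.cg_pos
    have := iv_nonneg (bit κ 0)
    have := iv_nonneg (bit κ 1)
    have := iv_nonneg (bit κ 2)
    have : 0 ≤ cb h + cg h * (iv (bit κ 0) + iv (bit κ 1) + iv (bit κ 2)) := by positivity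
    linarith
  · exact le_rfl
  · exact le_rfl

/-- A nontrivial Klein element has exactly two bits, so the discount is at most `cb h + 2 * cg h`,
which is h². This is what a run at μ₂ with its decisive bit set can pay for. -/
lemma Ub_le (n : ℕ) (m : Mem) : Ub h (n + 1) m ≤ Uc h n m + h ^ 2 := by
  have := sq_nonneg h
  rcases m with _ | ⟨q | q | _, κ⟩
  · change (0 : ℝ) ≤ 0 + h ^ 2
    linarith
  · rw [Uc_l, Ub_some, H.om_succ_l]
    have h2 := H.cg_pos
    have h3 : iv (bit κ 0) + iv (bit κ 1) + iv (bit κ 2) ≤ 2 := by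
      rcases κ with ⟨x, y⟩
      cases x <;> cases y <;> simp [iv, bit] <;> norm_num
    unfold cb
    nlinarith
  · rw [Uc_s, Ub_some]; linarith
  · rw [Uc_m, Ub_some]; linarith

lemma neg_le_Wt (n : ℕ) (m mc mb : Mem) : -(h * cb h) ≤ Wt h n m mc mb := by
  have h0 := H.pos
  have hb := H.cb_pos
  have h3 : h * cb h ≤ cb h := by nlinarith [H.lt_one]
  have h4 : h * (h * cb h) ≤ h * cb h := by nlinarith [H.lt_one]
  have h5 : h * (h * (h * cb h)) ≤ h * (h * cb h) := by nlinarith [H.lt_one]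
  have h6 : 0 < h * cb h := by positivity
  rcases m with _ | ⟨q | q | _, κ⟩
  · have := H.Uc_nonneg n mc
    have := H.Ub_nonneg (n + 1) mb
    simp only [Wt]; linarith
  · have := H.Uc_nonneg n (tw κ mc)
    have := H.Ub_nonneg (n + 1) (tw κ mb)
    simp only [Wt]; linarith
  · have := H.Uc_nonneg n mc
    have := H.Ub_nonneg (n + 1) (tw κ mb)
    simp only [Wt]; nlinarith
  · have := H.Uc_nonneg n mc
    have := H.Ub_nonneg (n + 1) mb
    have := H.Uc_nonneg n mb
    have := H.Ub_nonneg (n + 1) mc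
    simp only [Wt]; split_ifs <;> nlinarith

/-- The end of a run. -/
lemma Wt_end (n : ℕ) {m mc mb : Mem} (h1 : ∀ q κ, m = some (q, κ) → q.vert = two)
    (h2 : isRun (.l two) m = true → isRun (.l two) mc = true ∧ isRun (.s two) mb = true)
    (h3 : isRun (.s two) m = true → isRun .m mb = true) :
    Uc h n mc + Ub h (n + 1) mb ≤ Wt h n m mc mb + h * Ub h n m := by
  rcases m with _ | ⟨q, κ⟩
  · simp [Wt, Ub]
  · have hq := h1 q κ rfl
    rcases q with q | q | _
    · obtain rfl : q = two := hq
      obtain ⟨h4, h5⟩ := h2 (by simp [isRun])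
      obtain ⟨κ1, rfl⟩ := isRun_iff.1 h4
      obtain ⟨κ2, rfl⟩ := isRun_iff.1 h5
      -- In `Wt` the current run κ is cancelled from the products stored at the continuations.
      -- Restoring it costs at most `pot h n κ` and `iv (bit κ n)`; together with the constant `h *
      -- cb h` subtracted in `Wt` this is h times the weight of the run.
      simp only [Wt, Uc, Ub, tw]
      rw [H.mul_om_l]
      have a1 := H.pot_le n κ1 κ
      have a2 := iv_xor (bit κ2 n) (bit κ n)
      rw [← bit_kmul] at a2
      have a3 : ∀ κ : Kln, bit κ (n + 1 + 2) = bit κ n := fun κ => by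
        rw [← bit_mod κ (n + 1 + 2), ← bit_mod κ n]; congr 1; omega
      simp only [om, a3]
      linarith
    · obtain rfl : q = two := hq
      obtain ⟨κ2, rfl⟩ := isRun_iff.1 (h3 (by simp [isRun]))
      simp only [Wt, Uc, Ub, tw, om]
      have a2 := mul_le_mul_of_nonneg_left (iv_xor (bit κ2 (n + 2)) (bit κ (n + 2))) H.pos.le
      rw [← bit_kmul] at a2
      rw [show n + 1 + 1 = n + 2 from rfl]
      linarith
    · simp only [Wt]
      cases hb : bit κ (n + 1)
      · simp [Ub, om, hb, iv]
        nlinarith [H.pos, H.cb_pos]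
      -- With the decisive bit set, `Wt` evaluates the two continuations in exchanged roles. Undoing
      -- the exchange removes at most one discount, and the term h in the weight of μ₂ pays h · h
      -- for it.
      · have a1 := H.Ub_le n mb
        have a2 := H.Uc_le n mc
        have a3 : Ub h n (some (.m, κ)) = h ^ 2 * cb h + h := by simp [om, hb, iv]
        rw [a3, if_pos rfl]
        nlinarith

/-- The start of a visit to a boundary point of level `n + 1`. -/
lemma wt_start (n : ℕ) {q : Bd} (m : Mem) (j : Fin 3) :
    Ub h n (tw (kl j) (upd m q j)) + wt h n q m ≤ Ub h n m + om h n q (false, false) := by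
  cases hr : isRun q m
  · rw [upd_of_not hr, wt, if_neg (by simp [hr])]
    simp only [tw, kmul_self, Ub]
    linarith
  · obtain ⟨κ, rfl⟩ := isRun_iff.1 hr
    rw [upd_of_isRun, wt, if_pos hr]
    simp only [tw, Ub, kmul_assoc, kmul_self, kmul_one]
    have := H.om_nonneg n q (false, false)
    linarith

omit H in
-- Equality holds because the discounted and the full weight differ only for runs at λ, and a visit
-- to λ does not end those.
lemma wt_start_l (n : ℕ) {v : Vert} {m : Mem} (h1 : ∀ q κ, m = some (q, κ) → q.vert = v) (j : Fin 3) :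
    Uc h n (tw (kl j) (upd m (.l v) j)) + wt h (n + 1) (.l v) m = Uc h n m := by
  cases hr : isRun (.l v) m
  · rw [upd_of_not hr, wt, if_neg (by simp [hr])]
    simp only [tw, kmul_self, Uc_l]
    rw [show pot h n (false, false) = 0 by simp [pot, bit, iv]]
    rcases m with _ | ⟨q | q | _, κ⟩
    · simp
    · obtain rfl : q = v := h1 _ κ rfl
      simp [isRun] at hr
    · simp
    · simp
  · obtain ⟨κ, rfl⟩ := isRun_iff.1 hr
    rw [upd_of_isRun, wt, if_pos hr]
    simp only [tw, Uc_l, kmul_assoc, kmul_self, kmul_one]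
    linarith

/-- A visit to `λ`. -/
lemma step_l (n : ℕ) {m mc mb : Mem} (h1 : ∀ q κ, m = some (q, κ) → q.vert = two)
    (h2 : isRun (.l two) m = true → isRun (.l two) mc = true ∧ isRun (.s two) mb = true)
    (h3 : isRun (.s two) m = true → isRun .m mb = true)
    (h4 : ∀ q κ, mc = some (q, κ) → q.vert = two) (j : Fin 3) :
    Wt h n (upd m (.l two) j) (upd mc (.l two) j) (upd mb (.s two) j) +
      (wt h (n + 1) (.l two) mc + wt h (n + 1) (.s two) mb) ≤
    Wt h n m mc mb + h * wt h n (.l two) m := by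
  cases hr : isRun (.l two) m
  · have a1 := H.Wt_end n h1 h2 h3
    have a2 := wt_start_l (h := h) n h4 j
    have a3 := H.wt_start (n + 1) (q := .s two) mb j
    rw [upd_of_not hr, wt, wt, wt, if_neg (c := isRun (.l two) m = true) (by simp [hr])]
    rw [wt] at a2 a3
    rw [Wt_l]
    have a4 : om h (n + 1) (.s two) (false, false) = h * cb h := by simp [om, bit, iv]
    linarith
  · obtain ⟨h5, h6⟩ := h2 hr
    obtain ⟨κ, rfl⟩ := isRun_iff.1 hr
    obtain ⟨κ1, rfl⟩ := isRun_iff.1 h5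
    obtain ⟨κ2, rfl⟩ := isRun_iff.1 h6
    simp [upd_of_isRun, Wt, wt, isRun, tw, kmul_kmul_cancel]

/-- A visit to `σ`. -/
lemma step_s (n : ℕ) {m mc mb : Mem} (mc' : Mem) (h1 : ∀ q κ, m = some (q, κ) → q.vert = two)
    (h2 : isRun (.l two) m = true → isRun (.l two) mc = true ∧ isRun (.s two) mb = true)
    (h3 : isRun (.s two) m = true → isRun .m mb = true) (j : Fin 3) :
    Wt h n (upd m (.s two) j) mc' (upd mb .m j) + wt h (n + 1) .m mb ≤
    Wt h n m mc mb + h * wt h n (.s two) m + (Uc h n mc' - Uc h n mc) := by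
  cases hr : isRun (.s two) m
  · have a1 := H.Wt_end n h1 h2 h3
    have a3 := H.wt_start (n + 1) (q := .m) mb j
    rw [upd_of_not hr, wt, wt, if_neg (c := isRun (.s two) m = true) (by simp [hr])]
    rw [wt] at a3
    rw [Wt_s]
    have a4 : om h (n + 1) .m (false, false) = h ^ 2 * cb h := by simp [om, bit, iv]
    linarith
  · have h6 := h3 hr
    obtain ⟨κ, rfl⟩ := isRun_iff.1 hr
    obtain ⟨κ2, rfl⟩ := isRun_iff.1 h6
    simp [upd_of_isRun, Wt, wt, isRun, tw, kmul_kmul_cancel]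
    linarith

/-- A visit to `μ`. -/
lemma step_m {n : ℕ} (hn : 2 ≤ n) {m mc mb : Mem} (h1 : ∀ q κ, m = some (q, κ) → q.vert = two)
    (h2 : isRun (.l two) m = true → isRun (.l two) mc = true ∧ isRun (.s two) mb = true)
    (h3 : isRun (.s two) m = true → isRun .m mb = true) (j : Fin 3) :
    (if actv j ⟨(n - 2) % 3, Nat.mod_lt _ (by omega)⟩ then Wt h n (upd m .m j) mb mc
      else Wt h n (upd m .m j) mc mb) ≤ Wt h n m mc mb + h * wt h n .m m := by
  -- The index n + 1 in the weight of μ₂ and the piece n − 2 of its connection agree modulo 3.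
  have hbit : actv j ⟨(n - 2) % 3, Nat.mod_lt _ (by omega)⟩ = bit (kl j) (n + 1) := by
    rw [← bit_kl, ← bit_mod (kl j) (n + 1)]
    congr 1
    change (n - 2) % 3 = (n + 1) % 3
    omega
  rw [hbit]
  have hpos : 0 < h ^ 3 * cb h := mul_pos (pow_pos H.pos 3) H.cb_pos
  cases hr : isRun .m m
  · have a1 := H.Wt_end n h1 h2 h3
    rw [upd_of_not hr, wt, if_neg (c := isRun .m m = true) (by simp [hr])]
    rw [Wt_m, Wt_m]
    cases hb : bit (kl j) (n + 1) <;> simp <;> linarith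
  · obtain ⟨κ, rfl⟩ := isRun_iff.1 hr
    rw [upd_of_isRun]
    cases hb : bit (kl j) (n + 1) <;> cases hb' : bit κ (n + 1) <;>
      simp [Wt, bit_kmul, hb, hb', wt, isRun]

end Rate

section Cost

variable (P : Fin 3 → Set penrose.Omega) (h : ℝ)

/-- The total weight of the runs that have ended. -/
noncomputable def cost (n : ℕ) : List Ltr → ℝ
  | [] => 0
  | .N _ :: w => cost n w + ∑ q ∈ bds two, wt h n q (mem P w (bp q n))
  | .M :: w => cost n w
  | .S :: w => cost n w

lemma cost_of_ne {n : ℕ} {s : Ltr} (hs : ∀ j, s ≠ .N j) (w : List Ltr) :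
    cost P h n (s :: w) = cost P h n w := by
  cases s with
  | N j => exact absurd rfl (hs j)
  | M => rfl
  | S => rfl

variable {P h} (hP : IsPartition (genHomeo .L) P) (H : Rate h)
include hP

omit hP in
lemma sum_bds_two (f : Bd → ℝ) : ∑ q ∈ bds two, f q = f (.l two) + f (.s two) + f .m := by
  simp [bds, add_assoc]

omit hP in
lemma sum_bds_one (f : Bd → ℝ) : ∑ q ∈ bds one, f q = f (.l one) + f (.s one) := by
  simp [bds]

/-- The potential of a level. -/
noncomputable def potential (P : Fin 3 → Set penrose.Omega) (h : ℝ) (n : ℕ) (w : List Ltr) : ℝ :=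
  ∑ x ∈ tl two n, Wt h n (mem P w x) (mem P w (c two :: x)) (mem P w (b :: x)) +
    ∑ z ∈ tl one n, Uc h n (mem P w (a two :: z))

lemma potential_of_ne {n : ℕ} (hn : 2 ≤ n) {s : Ltr} (hs : ∀ j, s ≠ .N j) (w : List Ltr) :
    potential P h n (s :: w) = potential P h n w := by
  have hs' : ∀ x, ∀ j, s = .N j → sta .L x one = none := fun x j h => absurd h (hs j)
  unfold potential
  congr 1
  · rw [← sum_hat hP (by omega) s fun x => Wt h n (mem P w x) (mem P w (c two :: x)) (mem P w (b :: x))]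
    refine Finset.sum_congr rfl fun x hx => ?_
    rw [mem_of_none P (hs' x), mem_cons_of_none hP hn hx (hs' x) (e := c two) rfl,
      mem_cons_of_none hP hn hx (hs' x) (e := b) rfl]
  · rw [← sum_hat hP (by omega) s fun x => Uc h n (mem P w (a two :: x))]
    refine Finset.sum_congr rfl fun x hx => ?_
    rw [mem_cons_of_none hP hn hx (hs' x) (e := a two) rfl]

lemma potential_N {n : ℕ} (hn : 2 ≤ n) (j : Fin 3) (w : List Ltr) :
    potential P h n (.N j :: w) = potential P h n w +
      (∑ q ∈ bds two, (Wt h n (mem P (.N j :: w) (bp q n)) (mem P (.N j :: w) (c two :: bp q n))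
          (mem P (.N j :: w) (b :: bp q n)) -
        Wt h n (mem P w (bp q n)) (mem P w (c two :: bp q n)) (mem P w (b :: bp q n))) +
      ∑ q ∈ bds one, (Uc h n (mem P (.N j :: w) (a two :: bp q n)) -
        Uc h n (mem P w (a two :: bp q n)))) := by
  unfold potential
  rw [sum_step hP hn j (fun x => Wt h n (mem P w x) (mem P w (c two :: x)) (mem P w (b :: x)))
      (fun x => Wt h n (mem P (.N j :: w) x) (mem P (.N j :: w) (c two :: x))
        (mem P (.N j :: w) (b :: x))) (bds two) subset_rfl,
    sum_step hP hn j (fun x => Uc h n (mem P w (a two :: x)))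
      (fun x => Uc h n (mem P (.N j :: w) (a two :: x))) (bds one) subset_rfl]
  · ring
  · intro x hx h0
    have : sta .L x one = none := (sta_cases hn hx).resolve_right fun ⟨q, hq, h1⟩ => h0 q hq h1
    rw [mem_cons_of_none hP hn hx (fun _ _ => this) (e := a two) rfl]
  · intro x hx h0
    have : sta .L x one = none := (sta_cases hn hx).resolve_right fun ⟨q, hq, h1⟩ => h0 q hq h1
    rw [mem_of_none P (w := w) (s := .N j) fun _ _ => this,
      mem_cons_of_none hP hn hx (fun _ _ => this) (e := c two) rfl,
      mem_cons_of_none hP hn hx (fun _ _ => this) (e := b) rfl]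

/-- The swap of `c₂σ₂` and `a₂σ₁` and the loop at `a₂λ₁`. -/
lemma Uc_swap {n : ℕ} (hn : 2 ≤ n) (j : Fin 3) (w : List Ltr) (f : Mem → ℝ) :
    f (mem P (.N j :: w) (c two :: bp (.s two) n)) + (f (mem P (.N j :: w) (a two :: bp (.l one) n)) +
      f (mem P (.N j :: w) (a two :: bp (.s one) n))) =
    f (mem P w (c two :: bp (.s two) n)) + (f (mem P w (a two :: bp (.l one) n)) +
      f (mem P w (a two :: bp (.s one) n))) := by
  have hb : ∀ q, bp q n ≠ [] := fun q h0 => by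
    have := bp_length hn q
    rw [h0] at this
    simp at this; omega
  have hm : ∀ e q, stp e (some q) = none → mem P (.N j :: w) (e :: bp q n) =
      mem P w (hat P (.N j) (e :: bp q n)) := fun e q h0 =>
    mem_of_none P fun _ _ => by rw [sta_cons_one (hb q), sta_bp hn, h0]
  rw [hm _ _ rfl, hm _ _ rfl, hm _ _ rfl]
  have h1 : hat P (.N j) (a two :: bp (.l one) n) = a two :: bp (.l one) n := by
    rcases hat_cons_bp_cases hn (.l one) (e := a two) (y := a two :: bp (.l one) n) rfl j with h0 | h0 <;>
      exact h0
  have hcv : cv (bp (.s two) n) = bp (.s one) n := by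
    obtain ⟨k, rfl⟩ := Nat.exists_eq_add_of_le' hn
    simp [bp, lam, cv, List.replicate_succ]
  have hcv' : cv (bp (.s one) n) = bp (.s two) n := by
    obtain ⟨k, rfl⟩ := Nat.exists_eq_add_of_le' hn
    simp [bp, lam, cv, List.replicate_succ]
  have hx : c two :: bp (.s two) n ∈ tl two (n + 1) := by
    have := bp_mem hn (.s two)
    rw [mem_tl] at this ⊢
    exact ⟨(pth_cons _ _ _).2 ⟨rfl, this.1⟩, by simp [this.2]⟩
  rw [h1]
  -- The action on paths is an involution, so the fragment either exchanges c₂σ₂ and a₂σ₁ or fixes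
  -- both; the sum is the same in either case.
  have h2 := hat_hat hP hx (by omega) (.N j)
  rcases hat_cons_bp_cases (P := P) hn (.s two) (e := c two) (y := a two :: cv (bp (.s two) n)) rfl j with
    h0 | h0
  · rw [hcv] at h0
    rw [h0] at h2
    rw [h0, h2]
    ring
  · rcases hat_cons_bp_cases (P := P) hn (.s one) (e := a two) (y := c two :: cv (bp (.s one) n)) rfl j
      with h3 | h3
    · rw [hcv'] at h3
      have hx' : a two :: bp (.s one) n ∈ tl two (n + 1) := by
        have := bp_mem hn (.s one)
        rw [mem_tl] at this ⊢
        exact ⟨(pth_cons _ _ _).2 ⟨rfl, this.1⟩, by simp [this.2]⟩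
      have h4 := hat_hat hP hx' (by omega) (.N j)
      rw [h3, h0] at h4
      simp at h4
    · rw [h0, h3]

include H

/-- The contraction inequality with the potential. -/
lemma cost_add_potential {n : ℕ} (hn : 2 ≤ n) (w : List Ltr) :
    cost P h (n + 1) w + potential P h n w ≤ h * cost P h n w := by
  induction w with
  | nil => simp [cost, potential, mem, Wt]
  | cons s w ih =>
    by_cases hs : ∀ j, s ≠ .N j
    · rwa [cost_of_ne P h hs, cost_of_ne P h hs, potential_of_ne hP hn hs]
    · push Not at hs
      obtain ⟨j, rfl⟩ := hs
      have hv : ∀ q ∈ bds two, bp q n ∈ tl two n := fun q hq => by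
        have := bp_mem hn q
        rwa [mem_bds.1 hq] at this
      have hm := fun q hq => mem_coupling hP hn w (hv q hq)
      have hb1 : ∀ q ∈ bds two, ∀ q' κ, mem P w (bp q n) = some (q', κ) → q'.vert = two :=
        fun q hq q' κ h0 => mem_vert hn w (hv q hq) h0
      have hl : Bd.l two ∈ bds two := by decide
      have hs : Bd.s two ∈ bds two := by decide
      have hmm : Bd.m ∈ bds two := by decide
      have c1 : ∀ q κ, mem P w (c two :: bp (.l two) n) = some (q, κ) → q.vert = two := by
        rw [cons_l hn]
        have := bp_mem (n := n + 1) (by omega) (.l two)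
        exact fun q κ h0 => mem_vert (by omega) w this h0
      have e1 := H.step_l n (hb1 _ hl) (fun h0 => ⟨((hm _ hl).1 h0).1 two, ((hm _ hl).1 h0).2⟩)
        (hm _ hl).2 c1 j
      have e2 := H.step_s n (mem P (.N j :: w) (c two :: bp (.s two) n)) (hb1 _ hs)
        (fun h0 => ⟨((hm _ hs).1 h0).1 two, ((hm _ hs).1 h0).2⟩) (hm _ hs).2 j
      have e3 := H.step_m hn (hb1 _ hmm)
        (fun h0 => ⟨((hm _ hmm).1 h0).1 two, ((hm _ hmm).1 h0).2⟩) (hm _ hmm).2 j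
      -- The change of the memory at c₂σ₂, left open in `e2`, cancels against the changes at a₂λ₁
      -- and a₂σ₁.
      have e4 := Uc_swap hP hn j w (Uc h n)
      have hb : bp .m n ≠ [] := ne_nil_of_mem hn (hv _ hmm)
      have d1 : mem P (.N j :: w) (c two :: bp .m n) =
          if actv j ⟨(n - 2) % 3, Nat.mod_lt _ (by omega)⟩ then mem P w (b :: bp .m n)
            else mem P w (c two :: bp .m n) := by
        rw [mem_of_none P fun _ _ => by rw [sta_cons_one hb, sta_bp hn]; rfl,
          hat_m hP hn j _ b (.inr ⟨rfl, rfl⟩)]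
        split_ifs <;> rfl
      have d2 : mem P (.N j :: w) (b :: bp .m n) =
          if actv j ⟨(n - 2) % 3, Nat.mod_lt _ (by omega)⟩ then mem P w (c two :: bp .m n)
            else mem P w (b :: bp .m n) := by
        rw [mem_of_none P fun _ _ => by rw [sta_cons_one hb, sta_bp hn]; rfl,
          hat_m hP hn j _ (c two) (.inl ⟨rfl, rfl⟩)]
        split_ifs <;> rfl
      have e3' : Wt h n (upd (mem P w (bp .m n)) .m j) (mem P (.N j :: w) (c two :: bp .m n))
          (mem P (.N j :: w) (b :: bp .m n)) ≤
          Wt h n (mem P w (bp .m n)) (mem P w (c two :: bp .m n)) (mem P w (b :: bp .m n)) +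
            h * wt h n .m (mem P w (bp .m n)) := by
        rw [d1, d2]
        refine le_trans (le_of_eq ?_) e3
        split_ifs <;> rfl
      rw [potential_N hP hn, cost, cost, sum_bds_two, sum_bds_two, sum_bds_two,
        sum_bds_one, mem_bp P hn, mem_bp P hn, mem_bp P hn]
      rw [cons_l hn, cons_b_l hn, cons_b_s hn, mem_bp P (by omega), mem_bp P (by omega),
        mem_bp P (by omega)]
      rw [cons_l hn, cons_b_l hn] at e1
      rw [cons_b_s hn] at e2
      linarith

/-- The contraction inequality. -/
lemma cost_succ_le {n : ℕ} (hn : 2 ≤ n) (w : List Ltr) :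
    cost P h (n + 1) w ≤ h * cost P h n w + h * cb h * (tl two n).card := by
  have h1 := cost_add_potential hP H hn w
  have h2 : -(h * cb h * (tl two n).card) ≤ potential P h n w := by
    have h3 : ∑ _x ∈ tl two n, -(h * cb h) ≤
        ∑ x ∈ tl two n, Wt h n (mem P w x) (mem P w (c two :: x)) (mem P w (b :: x)) :=
      Finset.sum_le_sum fun x _ => H.neg_le_Wt n _ _ _
    have h4 : 0 ≤ ∑ z ∈ tl one n, Uc h n (mem P w (a two :: z)) :=
      Finset.sum_nonneg fun z _ => H.Uc_nonneg n _
    rw [Finset.sum_const, nsmul_eq_mul] at h3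
    unfold potential
    linarith
  linarith

end Cost

/-! ### The number of runs -/

section Cost

lemma two_mul_card_tl (n : ℕ) : 2 * (tl two n).card ≤ (tl two (n + 1)).card := by
  have h1 := sum_tl_two n fun _ => 1
  simp only [Finset.sum_const, smul_eq_mul, mul_one] at h1
  omega

lemma card_tl_one (n : ℕ) : (tl one (n + 1)).card ≤ (tl two (n + 1)).card := by
  have h1 := sum_tl_two n fun _ => 1
  have h2 := sum_tl_one n fun _ => 1
  simp only [Finset.sum_const, smul_eq_mul, mul_one] at h1 h2
  omega

variable {P : Fin 3 → Set penrose.Omega} {h : ℝ} (hP : IsPartition (genHomeo .L) P) (H : Rate h)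

include H in
lemma cost_two_le (w : List Ltr) : cost P h 2 w ≤
    3 * (2 + 3 * (1 / h + (1 / h - cg h) / h + cg h)) * w.length := by
  have h0 : 0 ≤ 2 + 3 * (1 / h + (1 / h - cg h) / h + cg h) :=
    (H.om_nonneg 0 .m (false, false)).trans (H.om_le 0 .m (false, false))
  induction w with
  | nil => simp [cost]
  | cons s w ih =>
    rw [List.length_cons]
    push_cast
    by_cases hs : ∀ j, s ≠ .N j
    · rw [cost_of_ne P h hs]; linarith
    · push Not at hs
      obtain ⟨j, rfl⟩ := hs
      have h1 : ∀ q m, wt h 2 q m ≤ 2 + 3 * (1 / h + (1 / h - cg h) / h + cg h) := fun q m => by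
        unfold wt; split_ifs
        · exact h0
        · rcases m with _ | ⟨q, κ⟩
          · exact h0
          · exact H.om_le _ _ _
      rw [cost, sum_bds_two]
      have := h1 (.l two) (mem P w (bp (.l two) 2))
      have := h1 (.s two) (mem P w (bp (.s two) 2))
      have := h1 .m (mem P w (bp .m 2))
      linarith

include hP H in
-- The tiles at least double in size from level to level, so one multiple of the size of the current
-- tile absorbs the inhomogeneous terms of all levels below.
lemma cost_le (n : ℕ) (w : List Ltr) : cost P h (n + 2) w ≤
    h ^ n * (3 * (2 + 3 * (1 / h + (1 / h - cg h) / h + cg h)) * w.length) +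
      cb h * (tl two (n + 2)).card := by
  have hb := H.cb_pos
  have h0 := H.pos
  induction n with
  | zero =>
    have := cost_two_le (P := P) H w
    have : 0 ≤ cb h * (tl two (0 + 2)).card := by positivity
    rw [pow_zero]; linarith
  | succ n ih =>
    have h1 := cost_succ_le hP H (n := n + 2) (by omega) w
    have h2 : (2 : ℝ) * (tl two (n + 2)).card ≤ (tl two (n + 2 + 1)).card := by
      exact_mod_cast two_mul_card_tl (n + 2)
    have h3 := mul_le_mul_of_nonneg_left ih h0.le
    have h4 := mul_le_mul_of_nonneg_left h2 hb.le
    have h5 : h * (cb h * (tl two (n + 2)).card) ≤ 1 * (cb h * (tl two (n + 2)).card) :=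
      mul_le_mul_of_nonneg_right H.lt_one.le (by positivity)
    rw [show n + 1 + 2 = n + 2 + 1 from rfl, pow_succ]
    linarith

variable (P) in
/-- The number of runs at the boundary points of a tile. -/
noncomputable def cnt (v : Vert) (n : ℕ) : List Ltr → ℝ
  | [] => 0
  | .N _ :: w => cnt v n w + ∑ q ∈ bds v, if isRun q (mem P w (bp q n)) then 0 else 1
  | .M :: w => cnt v n w
  | .S :: w => cnt v n w

lemma cnt_of_ne {v : Vert} {n : ℕ} {s : Ltr} (hs : ∀ j, s ≠ .N j) (w : List Ltr) :
    cnt P v n (s :: w) = cnt P v n w := by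
  cases s with
  | N j => exact absurd rfl (hs j)
  | M => rfl
  | S => rfl

/-- The number of positions at which a memory satisfies a condition. -/
noncomputable def num (P : Fin 3 → Set penrose.Omega) (v : Vert) (n : ℕ) (p : Mem → Bool)
    (w : List Ltr) : ℝ := ∑ x ∈ tl v n, if p (mem P w x) then 1 else 0

lemma num_nonneg (v : Vert) (n : ℕ) (p : Mem → Bool) (w : List Ltr) : 0 ≤ num P v n p w :=
  Finset.sum_nonneg fun _ _ => by split_ifs <;> norm_num

lemma num_le (v : Vert) (n : ℕ) (p : Mem → Bool) (w : List Ltr) : num P v n p w ≤ (tl v n).card := by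
  have h1 : num P v n p w ≤ ∑ _x ∈ tl v n, (1 : ℝ) :=
    Finset.sum_le_sum fun _ _ => by split_ifs <;> norm_num
  simpa using h1

include hP in
lemma num_of_ne {v : Vert} {n : ℕ} (hn : 2 ≤ n) {s : Ltr} (hs : ∀ j, s ≠ .N j) (p : Mem → Bool)
    (w : List Ltr) : num P v n p (s :: w) = num P v n p w :=
  sum_mem_step' hP hn hs w fun m => if p m then 1 else 0

include hP H in
/-- The runs that have ended have been paid for. -/
lemma cnt_two_le {n : ℕ} (hn : 2 ≤ n) (w : List Ltr) :
    h ^ 2 * cb h * (cnt P two n w + num P two n Option.isNone w) ≤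
      h ^ 2 * cb h * (tl two n).card + cost P h n w := by
  have h2 : 0 < h ^ 2 * cb h := mul_pos (pow_pos H.pos 2) H.cb_pos
  induction w with
  | nil =>
    have := num_le (P := P) two n Option.isNone []
    simp only [cnt, cost, zero_add, add_zero]
    exact mul_le_mul_of_nonneg_left this h2.le
  | cons s w ih =>
    by_cases hs : ∀ j, s ≠ .N j
    · rwa [cost_of_ne P h hs, cnt_of_ne hs, num_of_ne hP hn hs]
    · push Not at hs
      obtain ⟨j, rfl⟩ := hs
      have h1 : num P two n Option.isNone (.N j :: w) = _ :=
        sum_mem_step hP hn j w fun m => if m.isNone then (1 : ℝ) else 0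
      rw [h1, cnt, cost]
      -- A visit that starts a run either ends an earlier run, whose weight is at least h² `cb h`,
      -- or uses up a position with empty memory.
      have key : ∀ q m, h ^ 2 * cb h * ((if isRun q m then 0 else 1) +
          ((if (upd m q j).isNone then (1 : ℝ) else 0) - if m.isNone then 1 else 0)) ≤ wt h n q m := by
        intro q m
        obtain ⟨κ, h3⟩ := upd_eq m q j
        rw [h3]
        rcases m with _ | ⟨q', κ'⟩
        · simp [isRun, wt]
        · cases hr : isRun q (some (q', κ'))
          · simp only [wt, hr]
            simpa using H.le_om n q' κ'
          · simp [wt, hr]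
      have h4 := Finset.sum_le_sum fun q (_ : q ∈ bds two) => key q (mem P w (bp q n))
      rw [← Finset.mul_sum, Finset.sum_add_distrib] at h4
      rw [num] at ih
      linarith

include hP in
-- The tile 𝒯₁ has only the boundary points λ₁ and σ₁. So a run at σ₁ is either still current for
-- its position or was ended by a new run at λ₁, and by the coupling a new run at λ₁ starts only
-- together with a new run at λ₂ one level below.
lemma cnt_one_le {n : ℕ} (hn : 2 ≤ n) (w : List Ltr) :
    cnt P one (n + 1) w ≤ 2 * cnt P two n w + num P one (n + 1) (isRun (.s one)) w := by
  induction w with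
  | nil => simpa [cnt] using num_nonneg (P := P) one (n + 1) (isRun (.s one)) []
  | cons s w ih =>
    by_cases hs : ∀ j, s ≠ .N j
    · rwa [cnt_of_ne hs, cnt_of_ne hs, num_of_ne hP (by omega) hs]
    · push Not at hs
      obtain ⟨j, rfl⟩ := hs
      have h1 : num P one (n + 1) (isRun (.s one)) (.N j :: w) = _ :=
        sum_mem_step hP (by omega) j w fun m => if isRun (.s one) m then (1 : ℝ) else 0
      rw [h1, cnt, cnt, sum_bds_one, sum_bds_one, sum_bds_two]
      have h2 := ((mem_coupling hP hn w (bp_mem hn (.l two))).1)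
      simp only [cons_l hn] at h2
      obtain ⟨κ, h3⟩ := upd_eq (mem P w (bp (.l one) (n + 1))) (.l one) j
      obtain ⟨κ', h4⟩ := upd_eq (mem P w (bp (.s one) (n + 1))) (.s one) j
      rw [h3, h4]
      rw [num] at ih
      have i1 : (0 : ℝ) ≤ if isRun (.s two) (mem P w (bp (.s two) n)) then 0 else 1 := by
        split_ifs <;> norm_num
      have i2 : (0 : ℝ) ≤ if isRun .m (mem P w (bp .m n)) then 0 else 1 := by
        split_ifs <;> norm_num
      have i3 : (if isRun (.s one) (some (.s one, κ')) then (1 : ℝ) else 0) = 1 := by simp [isRun]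
      have i4 : (if isRun (.s one) (some (.l one, κ)) then (1 : ℝ) else 0) = 0 := by simp [isRun]
      rw [i3, i4]
      have i5 : (if isRun (.s one) (mem P w (bp (.s one) (n + 1))) then (0 : ℝ) else 1) +
          (if isRun (.s one) (mem P w (bp (.s one) (n + 1))) then (1 : ℝ) else 0) = 1 := by
        split_ifs <;> norm_num
      have i6 : (if isRun (.l one) (mem P w (bp (.l one) (n + 1))) then (0 : ℝ) else 1) +
          (if isRun (.s one) (mem P w (bp (.l one) (n + 1))) then (1 : ℝ) else 0) ≤
          2 * if isRun (.l two) (mem P w (bp (.l two) n)) then 0 else 1 := by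
        cases h5 : isRun (.l two) (mem P w (bp (.l two) n))
        · have : (if isRun (.l one) (mem P w (bp (.l one) (n + 1))) then (0 : ℝ) else 1) ≤ 1 := by
            split_ifs <;> norm_num
          have : (if isRun (.s one) (mem P w (bp (.l one) (n + 1))) then (1 : ℝ) else 0) ≤ 1 := by
            split_ifs <;> norm_num
          simp only [Bool.false_eq_true, if_false]
          linarith
        · obtain ⟨κ2, h6⟩ := isRun_iff.1 ((h2 h5).1 one)
          rw [h6]
          simp [isRun]
      linarith

include hP H in
/-- The total number of runs. -/
theorem exists_cnt_le : ∃ C : ℝ, 0 < C ∧ ∀ (n : ℕ) (w : List Ltr),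
    cnt P one (n + 3) w + cnt P two (n + 3) w ≤ C * (h ^ n * w.length + (tl two (n + 3)).card) := by
  have h0 := H.pos
  have hb := H.cb_pos
  have h2 : 0 < h ^ 2 * cb h := mul_pos (pow_pos H.pos 2) H.cb_pos
  set K := 3 * (2 + 3 * (1 / h + (1 / h - cg h) / h + cg h)) with hK
  have hK0 : 0 ≤ K := by
    have := (H.om_nonneg 0 .m (false, false)).trans (H.om_le 0 .m (false, false))
    positivity
  have key : ∀ n w, cnt P two (n + 2) w ≤ (1 + 1 / h ^ 2) * (tl two (n + 2)).card +
      K / (h ^ 2 * cb h) * (h ^ n * w.length) := by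
    intro n w
    have h3 := cnt_two_le hP H (n := n + 2) (by omega) w
    have h4 := cost_le hP H n w
    have h5 := mul_nonneg h2.le (num_nonneg (P := P) two (n + 2) Option.isNone w)
    rw [← hK] at h4
    have h6 : h ^ 2 * cb h * cnt P two (n + 2) w ≤
        h ^ 2 * cb h * (tl two (n + 2)).card + (h ^ n * (K * w.length) + cb h * (tl two (n + 2)).card) := by
      linarith
    refine le_of_mul_le_mul_left (h6.trans (le_of_eq ?_)) h2
    field_simp
    ring
  refine ⟨4 + 3 * (1 / h ^ 2) + 3 * (K / (h ^ 2 * cb h)), by positivity, fun n w => ?_⟩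
  have h3 := key (n + 1) w
  have h4 := key n w
  have h5 := cnt_one_le hP (n := n + 2) (by omega) w
  have h6 := num_le (P := P) one (n + 3) (isRun (.s one)) w
  have h7 : ((tl one (n + 3)).card : ℝ) ≤ (tl two (n + 3)).card := by exact_mod_cast card_tl_one (n + 2)
  have h8 : (2 : ℝ) * (tl two (n + 2)).card ≤ (tl two (n + 3)).card := by
    exact_mod_cast two_mul_card_tl (n + 2)
  have h9 : K / (h ^ 2 * cb h) * (h ^ (n + 1) * w.length) ≤ K / (h ^ 2 * cb h) * (h ^ n * w.length) := by
    refine mul_le_mul_of_nonneg_left (mul_le_mul_of_nonneg_right ?_ (by positivity)) (by positivity)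
    rw [pow_succ]
    exact mul_le_of_le_one_right (by positivity) H.lt_one.le
  have e0 : (0 : ℝ) < 1 + 1 / h ^ 2 := by positivity
  have e1 := mul_le_mul_of_nonneg_left h8 e0.le
  have e2 : 0 ≤ (4 + 3 * (1 / h ^ 2)) * (h ^ n * w.length) := by positivity
  have e3 : 0 ≤ K / (h ^ 2 * cb h) * (tl two (n + 3)).card := by positivity
  have e4 : (0 : ℝ) ≤ (tl two (n + 3)).card := by positivity
  rw [show n + 1 + 2 = n + 3 from rfl] at h3
  rw [show n + 2 + 1 = n + 3 from rfl] at h5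
  have e6 : 0 ≤ 1 / h ^ 2 * (tl two (n + 3)).card := by positivity
  have e7 : 0 ≤ 1 / h ^ 2 * (h ^ n * w.length) := by positivity
  nlinarith

end Cost

/-! ### Encoding of group elements by histories -/

instance : Fintype Bd := ⟨{.l one, .s one, .l two, .s two, .m}, by
  rintro ((_ | _) | (_ | _) | _) <;> decide⟩

lemma card_bd : Fintype.card Bd = 5 := rfl

instance : Nonempty Bd := ⟨.m⟩

/-- The positions: the paths of length `n`. -/
abbrev Pos (n : ℕ) : Type := {x : List Edg // x ∈ tl one n ∪ tl two n}

lemma mem_pos {n : ℕ} {x : List Edg} : x ∈ tl one n ∪ tl two n ↔ ∃ v, x ∈ tl v n := by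
  rw [Finset.mem_union]
  refine ⟨fun h => h.elim (fun h => ⟨_, h⟩) fun h => ⟨_, h⟩, ?_⟩
  rintro ⟨v, h⟩
  cases v
  · exact .inl h
  · exact .inr h

/-- The position of a point. -/
def cur (n : ℕ) (ζ : penrose.Omega) : Pos n :=
  ⟨trunc ζ.1 n, mem_pos.2 ⟨_, mem_tl.2 ⟨pth_trunc ζ n, trunc_length _ _⟩⟩⟩

/-- The boundary point of a type as a position. -/
def bpos (n : ℕ) (hn : 2 ≤ n) (q : Bd) : Pos n := ⟨bp q n, mem_pos.2 ⟨_, bp_mem hn q⟩⟩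

lemma bpos_inj {n : ℕ} {hn : 2 ≤ n} {q q' : Bd} (h : bpos n hn q = bpos n hn q') : q = q' :=
  bp_inj hn (congrArg Subtype.val h)

/-- What is recorded about the past of the points at a position: either nothing has happened since
the start, or the boundary point visited last, and for each kind of neighbours there the index of an
earlier record and whether to continue with the neighbour. -/
abbrev Val (n M : ℕ) : Type := Pos n ⊕ (Bd × (Bd → Fin 3 → Fin (M + 1) × Bool))

/-- The boundary point visited last. -/
def kind {n M : ℕ} : Val n M → Option Bd
  | .inl _ => none
  | .inr v => some v.1

lemma kind_eq_some {n M : ℕ} {v : Val n M} {q : Bd} (h : kind v = some q) : ∃ o, v = .inr (q, o) := by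
  rcases v with x | ⟨q', o⟩
  · simp [kind] at h
  · simp only [kind, Option.some.injEq] at h
    subst h
    exact ⟨o, rfl⟩

/-- The record of a word. -/
structure Hist (n M : ℕ) where
  hist : Pos n → Val n M
  log : List (Val n M)

/-- The type of the neighbour of a boundary point. -/
noncomputable def bt (n : ℕ) (ζ : penrose.Omega) : Bd :=
  Classical.epsilon fun q => trunc (act .L ζ).1 n = bp q n

lemma bt_eq {n : ℕ} (hn : 2 ≤ n) {ζ : penrose.Omega} {q : Bd} (h : trunc (act .L ζ).1 n = bp q n) :
    bt n ζ = q := by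
  have h1 : trunc (act .L ζ).1 n = bp (bt n ζ) n :=
    Classical.epsilon_spec (p := fun q => trunc (act .L ζ).1 n = bp q n) ⟨q, h⟩
  exact bp_inj hn (h1.symm.trans h)

/-- Start a new run at a boundary point, if necessary. -/
def touch {n M : ℕ} (hn : 2 ≤ n) (q : Bd) (st : Hist n M) : Hist n M :=
  if kind (st.hist (bpos n hn q)) = some q then st else
    ⟨Function.update st.hist (bpos n hn q)
      (.inr (q, fun _ _ => (Fin.ofNat (M + 1) st.log.length, false))),
      st.log ++ [st.hist (bpos n hn q)]⟩

/-- Start new runs at all boundary points. -/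
def touchAll {n M : ℕ} (hn : 2 ≤ n) (qs : List Bd) (st : Hist n M) : Hist n M :=
  qs.foldr (touch hn) st

lemma kind_touch_self {n M : ℕ} (hn : 2 ≤ n) (q : Bd) (st : Hist n M) :
    kind ((touch hn q st).hist (bpos n hn q)) = some q := by
  unfold touch
  split_ifs with h
  · exact h
  · simp [kind]

lemma touch_of_ne {n M : ℕ} (hn : 2 ≤ n) {q : Bd} (st : Hist n M) {x : Pos n} (h : x ≠ bpos n hn q) :
    (touch hn q st).hist x = st.hist x := by
  unfold touch
  split_ifs
  · rfl
  · simp [Function.update_of_ne h]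

lemma touchAll_of_ne {n M : ℕ} (hn : 2 ≤ n) {qs : List Bd} (st : Hist n M) {x : Pos n}
    (h : ∀ q ∈ qs, x ≠ bpos n hn q) : (touchAll hn qs st).hist x = st.hist x := by
  induction qs with
  | nil => rfl
  | cons q qs ih =>
    rw [List.forall_mem_cons] at h
    exact (touch_of_ne hn _ h.1).trans (ih h.2)

lemma kind_touchAll {n M : ℕ} (hn : 2 ≤ n) {qs : List Bd} (st : Hist n M) {q : Bd} (h : q ∈ qs) :
    kind ((touchAll hn qs st).hist (bpos n hn q)) = some q := by
  induction qs with
  | nil => simp at h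
  | cons q' qs ih =>
    by_cases hq : q = q'
    · subst hq
      exact kind_touch_self hn _ _
    · change kind ((touch hn q' (touchAll hn qs st)).hist (bpos n hn q)) = some q
      rw [touch_of_ne hn _ fun h => hq (bpos_inj h)]
      exact ih ((List.mem_cons.1 h).resolve_left hq)

lemma length_touchAll {n M : ℕ} (hn : 2 ≤ n) {qs : List Bd} (hqs : qs.Nodup) (st : Hist n M) :
    ((touchAll hn qs st).log.length : ℝ) = st.log.length +
      (qs.map fun q => if kind (st.hist (bpos n hn q)) = some q then (0 : ℝ) else 1).sum := by
  induction qs with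
  | nil => simp [touchAll]
  | cons q qs ih =>
    rw [List.nodup_cons] at hqs
    change ((touch hn q (touchAll hn qs st)).log.length : ℝ) = _
    rw [List.map_cons, List.sum_cons]
    have h1 := touchAll_of_ne hn (qs := qs) st (x := bpos n hn q)
      fun q' hq' h => hqs.1 (bpos_inj h ▸ hq')
    rw [touch, h1]
    split_ifs
    · rw [ih hqs.2]; ring
    · rw [List.length_append]
      push_cast
      rw [ih hqs.2]
      simp
      ring

/-- The outcomes at a boundary point after reading a fragment of `L`. -/
def swapOut {n M : ℕ} (hist : Bd → Val n M) (j : Fin 3) (q : Bd) :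
    Bd → Fin 3 → Fin (M + 1) × Bool := fun q' i =>
  let out : Bd → Bd → Fin (M + 1) × Bool := fun r r' => match hist r with
    | .inr (_, o) => o r' i
    | .inl _ => (0, false)
  if actv j i then ((out q' q).1, !(out q' q).2) else out q q'

section Record

variable (P : Fin 3 → Set penrose.Omega)

/-- The action of the letters on positions. -/
noncomputable def hatp {n : ℕ} (s : Ltr) (x : Pos n) : Pos n :=
  ⟨hat P s x.1, by
    obtain ⟨v, hv⟩ := mem_pos.1 x.2
    exact mem_pos.2 ⟨v, hat_mem hv s⟩⟩

/-- All boundary types. -/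
def allBd : List Bd := [.l one, .s one, .l two, .s two, .m]

lemma mem_allBd (q : Bd) : q ∈ allBd := by rcases q with (_ | _) | (_ | _) | _ <;> decide

open Classical in
/-- The record of a word (the head of the list is read last). -/
noncomputable def record (n M : ℕ) (hn : 2 ≤ n) : List Ltr → Hist n M
  | [] => ⟨.inl, []⟩
  | .N j :: w =>
    let st := touchAll hn allBd (record n M hn w)
    ⟨fun x => if h : ∃ q, x = bpos n hn q then
        .inr (h.choose, swapOut (fun r => st.hist (bpos n hn r)) j h.choose)
      else st.hist (hatp P (.N j) x), st.log⟩
  | .M :: w => ⟨fun x => (record n M hn w).hist (hatp P .M x), (record n M hn w).log⟩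
  | .S :: w => ⟨fun x => (record n M hn w).hist (hatp P .S x), (record n M hn w).log⟩

variable {n M : ℕ} (hn : 2 ≤ n)

lemma record_of_ne {s : Ltr} (hs : ∀ j, s ≠ .N j) (w : List Ltr) : record P n M hn (s :: w) =
    ⟨fun x => (record P n M hn w).hist (hatp P s x), (record P n M hn w).log⟩ := by
  cases s with
  | N j => exact absurd rfl (hs j)
  | M => rfl
  | S => rfl

lemma record_N_bpos (j : Fin 3) (w : List Ltr) (q : Bd) :
    (record P n M hn (.N j :: w)).hist (bpos n hn q) =
      .inr (q, swapOut (fun r => (touchAll hn allBd (record P n M hn w)).hist (bpos n hn r)) j q) := by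
  have h : ∃ q', bpos n hn q = bpos n hn q' := ⟨q, rfl⟩
  have h1 : h.choose = q := (bpos_inj h.choose_spec).symm
  simp only [record]
  rw [dif_pos h, h1]

lemma record_N_of_ne (j : Fin 3) (w : List Ltr) {x : Pos n} (h : ∀ q, x ≠ bpos n hn q) :
    (record P n M hn (.N j :: w)).hist x =
      (touchAll hn allBd (record P n M hn w)).hist (hatp P (.N j) x) := by
  simp only [record]
  rw [dif_neg]
  rintro ⟨q, hq⟩
  exact h q hq

lemma sta_of_ne_bpos {x : Pos n} (h : ∀ q, x ≠ bpos n hn q) : sta .L x.1 one = none := by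
  obtain ⟨v, hv⟩ := mem_pos.1 x.2
  exact (sta_cases hn hv).resolve_right fun ⟨q, _, h1⟩ => h q (Subtype.ext h1)

/-- Recovering the starting point. -/
inductive Dec (n : ℕ) {M : ℕ} (P : Fin 3 → Set penrose.Omega) (r : ℕ → Option (Val n M)) :
    Val n M → penrose.Omega → penrose.Omega → Prop
  | start {x : Pos n} {ζ ω : penrose.Omega} (h : trunc ω.1 n = x.1) (ht : ∀ k, n ≤ k → ω.1 k = ζ.1 k) :
      Dec n P r (.inl x) ζ ω
  | node {q : Bd} {o : Bd → Fin 3 → Fin (M + 1) × Bool} {ζ ζ₀ ω : penrose.Omega} {v : Val n M}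
      (h : trunc ζ₀.1 n = bp q n) (ht : ∀ k, n ≤ k → ζ₀.1 k = ζ.1 k)
      (hv : r (o (bt n ζ₀) (Classical.epsilon fun i => ζ₀ ∈ P i)).1 = some v)
      (hd : Dec n P r v (if (o (bt n ζ₀) (Classical.epsilon fun i => ζ₀ ∈ P i)).2 then act .L ζ₀ else ζ₀) ω) :
      Dec n P r (.inr (q, o)) ζ ω

lemma ext_of_trunc {n : ℕ} {ζ ω : penrose.Omega} (h : trunc ζ.1 n = trunc ω.1 n)
    (ht : ∀ k, n ≤ k → ζ.1 k = ω.1 k) : ζ = ω :=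
  Subtype.ext (funext fun k => (lt_or_ge k n).elim (trunc_inj h k) (ht k))

variable {P}

/-- Decoding is deterministic: the boundary point and the tail of `ζ` fix `ζ₀`, and then the type of
its neighbour and its piece select the entry to follow. -/
lemma Dec.unique {r : ℕ → Option (Val n M)} {v : Val n M} {ζ ω ω' : penrose.Omega}
    (h : Dec n P r v ζ ω) (h' : Dec n P r v ζ ω') : ω = ω' := by
  induction h generalizing ω' with
  | start h1 h2 =>
    cases h' with
    | start h3 h4 => exact ext_of_trunc (h1.trans h3.symm) fun k hk => (h2 k hk).trans (h4 k hk).symm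
  | node h1 h2 h3 _ ih =>
    cases h' with
    | node h4 h5 h6 h7 =>
      obtain rfl := ext_of_trunc (h1.trans h4.symm) fun k hk => (h2 k hk).trans (h5 k hk).symm
      rw [h3] at h6
      obtain rfl := Option.some.inj h6
      exact ih h7

lemma Dec.mono {r r' : ℕ → Option (Val n M)} (hr : ∀ k v, r k = some v → r' k = some v) {v : Val n M}
    {ζ ω : penrose.Omega} (h : Dec n P r v ζ ω) : Dec n P r' v ζ ω := by
  induction h with
  | start h1 h2 => exact .start h1 h2
  | node h1 h2 h3 _ ih => exact .node h1 h2 (hr _ _ h3) ih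

lemma Dec.tail {r : ℕ → Option (Val n M)} {v : Val n M} {ζ ζ' ω : penrose.Omega}
    (h : Dec n P r v ζ ω) (ht : ∀ k, n ≤ k → ζ.1 k = ζ'.1 k) : Dec n P r v ζ' ω := by
  cases h with
  | start h1 h2 => exact .start h1 fun k hk => (h2 k hk).trans (ht k hk)
  | node h1 h2 h3 h4 => exact .node h1 (fun k hk => (h2 k hk).trans (ht k hk)) h3 h4

/-- A fresh run moves the old value to the log and refers to it without a move, so the decoded point
does not change. The bound on the length keeps the index from wrapping around in `Fin (M + 1)`. -/
lemma Dec.touch {st : Hist n M} {f : penrose.Omega → penrose.Omega} (hM : st.log.length ≤ M)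
    (h : ∀ ζ, Dec n P (st.log[·]?) (st.hist (cur n ζ)) ζ (f ζ)) (q : Bd) (ζ : penrose.Omega) :
    Dec n P ((touch hn q st).log[·]?) ((touch hn q st).hist (cur n ζ)) ζ (f ζ) := by
  unfold TileInfl.touch
  split_ifs with h1
  · exact h ζ
  · have hr : ∀ k v, st.log[k]? = some v → (st.log ++ [st.hist (bpos n hn q)])[k]? = some v :=
      fun k v hk => by
        rw [List.getElem?_append_left (List.getElem?_eq_some_iff.1 hk).1, hk]
    by_cases h2 : cur n ζ = bpos n hn q
    · simp only [h2, Function.update_self]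
      refine .node (congrArg Subtype.val h2) (fun _ _ => rfl) (v := st.hist (bpos n hn q)) ?_ ?_
      · simp [Nat.mod_eq_of_lt (Nat.lt_succ_of_le hM)]
      · simp only [Bool.false_eq_true, if_false]
        rw [← h2]
        exact (h ζ).mono (by rw [h2]; exact hr)
    · simp only [Function.update_of_ne h2]
      exact (h ζ).mono hr

lemma length_le_touch (q : Bd) (st : Hist n M) : st.log.length ≤ (touch hn q st).log.length := by
  unfold touch
  split_ifs <;> simp

lemma length_le_touchAll (qs : List Bd) (st : Hist n M) :
    st.log.length ≤ (touchAll hn qs st).log.length := by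
  induction qs with
  | nil => exact le_rfl
  | cons q qs ih => exact ih.trans (length_le_touch hn q _)

lemma Dec.touchAll {st : Hist n M} {f : penrose.Omega → penrose.Omega} {qs : List Bd}
    (hM : (touchAll hn qs st).log.length ≤ M)
    (h : ∀ ζ, Dec n P (st.log[·]?) (st.hist (cur n ζ)) ζ (f ζ)) (ζ : penrose.Omega) :
    Dec n P ((touchAll hn qs st).log[·]?) ((touchAll hn qs st).hist (cur n ζ)) ζ (f ζ) := by
  induction qs generalizing ζ with
  | nil => exact h ζ
  | cons q qs ih =>
    have h1 := (length_le_touch hn q (TileInfl.touchAll hn qs st)).trans hM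
    exact Dec.touch hn h1 (ih h1) q ζ

variable (hP : IsPartition (genHomeo .L) P)

include hP

/-- The inverse of the element represented by a word. -/
noncomputable def undo (hP : IsPartition (genHomeo .L) P) : List Ltr → penrose.Omega → penrose.Omega
  | [], ζ => ζ
  | s :: w, ζ => undo hP w (hom hP s ζ)

/-- At ξ, which lies in no piece, the choice operator returns an arbitrary index; this is harmless
because L fixes ξ. -/
lemma hom_N_eq (j : Fin 3) (ζ : penrose.Omega) : hom hP (.N j) ζ =
    if actv j (Classical.epsilon fun i => ζ ∈ P i) then act .L ζ else ζ := by
  by_cases h : ∃ i, ζ ∈ P i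
  · have h1 : ζ ∈ P (Classical.epsilon fun i => ζ ∈ P i) := Classical.epsilon_spec h
    by_cases h2 : actv j (Classical.epsilon fun i => ζ ∈ P i) = true
    · rw [if_pos h2]
      exact if_pos ⟨_, h2, h1⟩
    · rw [if_neg h2]
      refine if_neg ?_
      rintro ⟨i, h3, h4⟩
      exact h2 (piece_unique hP h4 h1 ▸ h3)
  · have h1 : ζ = xi := by
      by_contra h2
      have h3 : ζ ∈ ⋃ i, P i := by rw [hP.iUnion]; exact h2
      exact h (Set.mem_iUnion.1 h3)
    have h4 : hom hP (.N j) ζ = ζ := if_neg fun ⟨i, _, hi⟩ => h ⟨i, hi⟩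
    rw [h4, h1, act_xi hP, ite_self]

lemma piece_act (ζ : penrose.Omega) : (fun i => act .L ζ ∈ P i) = fun i => ζ ∈ P i :=
  funext fun _ => propext (act_mem_iff hP)

/-- A record determines the element represented by the word. -/
lemma dec_record (w : List Ltr) (hM : (record P n M hn w).log.length ≤ M) (ζ : penrose.Omega) :
    Dec n P ((record P n M hn w).log[·]?) ((record P n M hn w).hist (cur n ζ)) ζ (undo hP w ζ) := by
  induction w generalizing ζ with
  | nil => exact .start rfl fun _ _ => rfl
  | cons s w ih =>
    by_cases hs : ∀ j, s ≠ .N j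
    · rw [record_of_ne P hn hs] at hM ⊢
      have h1 := hom_interior hP s (η := ζ) hn fun j hj => absurd hj (hs j)
      have h2 : hatp P s (cur n ζ) = cur n (hom hP s ζ) := Subtype.ext h1.1.symm
      have h3 := ih hM (hom hP s ζ)
      simp only [h2]
      exact h3.tail h1.2
    · push Not at hs
      obtain ⟨j, rfl⟩ := hs
      have hM' : (touchAll hn allBd (record P n M hn w)).log.length ≤ M := hM
      have ih' := Dec.touchAll hn hM' (ih ((length_le_touchAll hn _ _).trans hM'))
      change Dec n P ((touchAll hn allBd (record P n M hn w)).log[·]?) _ ζ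
        (undo hP w (hom hP (.N j) ζ))
      set st := touchAll hn allBd (record P n M hn w) with hst
      by_cases h1 : ∃ q, cur n ζ = bpos n hn q
      · obtain ⟨q, hq⟩ := h1
        rw [hq, record_N_bpos, ← hst]
        have hq' : trunc ζ.1 n = bp q n := congrArg Subtype.val hq
        obtain ⟨q', h2⟩ := act_boundary hn hq'
        have h3 := bt_eq hn h2
        obtain ⟨o, ho⟩ := kind_eq_some (kind_touchAll hn (record P n M hn w) (mem_allBd q))
        obtain ⟨o', ho'⟩ := kind_eq_some (kind_touchAll hn (record P n M hn w) (mem_allBd q'))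
        rw [← hst] at ho ho'
        -- If the fragment moves `ζ`, its past is that of the neighbour `act .L ζ`, which has `ζ` as
        -- its own neighbour and lies in the same piece. So the entry can be taken over from there,
        -- with the flag negated since L is an involution.
        by_cases h4 : actv j (Classical.epsilon fun i => ζ ∈ P i) = true
        · rw [hom_N_eq, if_pos h4]
          have h5 := ih' (act .L ζ)
          have h6 : cur n (act .L ζ) = bpos n hn q' := Subtype.ext h2
          rw [h6, ho'] at h5
          cases h5 with
          | @node _ _ _ _ _ v₁ h7 h8 h9 h10 =>
            obtain rfl := ext_of_trunc (h7.trans h2.symm) h8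
            have h11 : bt n (act .L ζ) = q := bt_eq hn (by rw [act_act]; exact hq')
            rw [h11, piece_act hP] at h9 h10
            rw [act_act] at h10
            refine .node hq' (fun _ _ => rfl) (v := v₁) ?_ ?_
            · simp only [swapOut, h3, ho', h4, if_true]
              exact h9
            · simp only [swapOut, h3, ho', h4, if_true]
              refine cast ?_ h10
              congr 1
              cases (o' q (Classical.epsilon fun i => ζ ∈ P i)).2 <;> rfl
        · rw [hom_N_eq, if_neg h4]
          have h5 := ih' ζ
          rw [hq, ho] at h5
          cases h5 with
          | @node _ _ _ _ _ v₁ h7 h8 h9 h10 =>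
            obtain rfl := ext_of_trunc (h7.trans hq'.symm) h8
            rw [h3] at h9 h10
            refine .node hq' (fun _ _ => rfl) (v := v₁) ?_ ?_
            · simp only [swapOut, h3, ho, h4]
              exact h9
            · simp only [swapOut, h3, ho, h4]
              exact h10
      · push Not at h1
        have h2 := hom_interior hP (.N j) (η := ζ) hn fun _ _ => sta_of_ne_bpos hn h1
        have h3 : hatp P (.N j) (cur n ζ) = cur n (hom hP (.N j) ζ) := Subtype.ext h2.1.symm
        rw [record_N_of_ne P hn j w h1, h3, ← hst]
        exact (ih' _).tail h2.2

/-- The runs in the record are those in the memory. -/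
lemma kind_record (w : List Ltr) (x : Pos n) :
    kind ((record P n M hn w).hist x) = (mem P w x.1).map Prod.fst := by
  induction w generalizing x with
  | nil => rfl
  | cons s w ih =>
    by_cases h1 : ∀ j, s = .N j → ∀ q, x ≠ bpos n hn q
    · rw [mem_of_none P fun j hj => sta_of_ne_bpos hn (h1 j hj)]
      by_cases hs : ∀ j, s ≠ .N j
      · rw [record_of_ne P hn hs]
        exact ih _
      · push Not at hs
        obtain ⟨j, rfl⟩ := hs
        rw [record_N_of_ne P hn j w (h1 j rfl), touchAll_of_ne, ih]
        · rfl
        · intro q _ h2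
          refine h1 j rfl q ?_
          obtain ⟨v, hv⟩ := mem_pos.1 x.2
          have h3 := hat_hat hP hv (by omega) (.N j)
          have h4 : hat P (.N j) x.1 = bp q n := congrArg Subtype.val h2
          rw [h4, hat_bp hn] at h3
          exact Subtype.ext h3.symm
    · push Not at h1
      obtain ⟨j, rfl, q, rfl⟩ := h1
      rw [record_N_bpos]
      change some q = (mem P (.N j :: w) (bp q n)).map Prod.fst
      obtain ⟨κ, hκ⟩ := upd_eq (mem P w (bp q n)) q j
      rw [mem_bp P hn, hκ]
      rfl

/-- The log grows exactly when a boundary point is touched at which no run is in progress, so it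
counts the runs in both tiles. -/
lemma length_record (w : List Ltr) :
    ((record P n M hn w).log.length : ℝ) = cnt P one n w + cnt P two n w := by
  induction w with
  | nil => simp [record, cnt]
  | cons s w ih =>
    by_cases hs : ∀ j, s ≠ .N j
    · rwa [record_of_ne P hn hs, cnt_of_ne hs, cnt_of_ne hs]
    · push Not at hs
      obtain ⟨j, rfl⟩ := hs
      change ((touchAll hn allBd (record P n M hn w)).log.length : ℝ) = _
      rw [length_touchAll hn (by decide), ih, cnt, cnt, sum_bds_one, sum_bds_two]
      have : ∀ q, (kind ((record P n M hn w).hist (bpos n hn q)) = some q) =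
          (isRun q (mem P w (bp q n)) = true) := fun q => by
        rw [kind_record hn hP]
        change ((mem P w (bp q n)).map Prod.fst = some q) = _
        rcases mem P w (bp q n) with _ | ⟨q', κ⟩ <;> simp [isRun]
      simp only [allBd, List.map_cons, List.map_nil, List.sum_cons, List.sum_nil, this]
      ring

lemma undo_eq_symm (w : List Ltr) (ζ : penrose.Omega) :
    undo hP w ζ = ((w.map (hom hP)).prod)⁻¹ ζ := by
  induction w generalizing ζ with
  | nil => rfl
  | cons s w ih =>
    rw [undo, ih, List.map_cons, List.prod_cons, mul_inv_rev]
    change _ = ((w.map (hom hP)).prod)⁻¹ ((hom hP s)⁻¹ ζ)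
    congr 1
    change _ = (hom hP s).symm ζ
    rw [Homeomorph.eq_symm_apply, hom_hom]

/-- Elements are determined by their records. -/
lemma prod_eq_of_record {w w' : List Ltr} (hM : (record P n M hn w).log.length ≤ M)
    (hM' : (record P n M hn w').log.length ≤ M)
    (h : (record P n M hn w).hist = (record P n M hn w').hist)
    (h' : ∀ k : ℕ, (record P n M hn w).log[k]? = (record P n M hn w').log[k]?) :
    (w.map (hom hP)).prod = (w'.map (hom hP)).prod := by
  refine inv_injective (Homeomorph.ext fun ζ => ?_)
  rw [← undo_eq_symm, ← undo_eq_symm]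
  have h1 := dec_record hn hP w hM ζ
  have h2 := dec_record hn hP w' hM' ζ
  rw [← h] at h2
  simp only [← h'] at h2
  exact h1.unique h2

end Record

/-! ### The growth of the fragmentation -/

lemma card_val (n M : ℕ) : Fintype.card (Val n M) =
    Fintype.card (Pos n) + 5 * (((M + 1) * 2) ^ 3) ^ 5 := by
  simp [Val, card_bd]

lemma card_pos (n : ℕ) : Fintype.card (Pos (n + 1)) ≤ 2 * (tl two (n + 1)).card := by
  have h1 : Fintype.card (Pos (n + 1)) = (tl one (n + 1) ∪ tl two (n + 1)).card := Fintype.card_coe _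
  have h2 := Finset.card_union_le (tl one (n + 1)) (tl two (n + 1))
  have h3 := card_tl_one n
  omega

variable {P : Fin 3 → Set penrose.Omega} (hP : IsPartition (genHomeo .L) P)

lemma exists_word {l : List (penrose.Omega ≃ₜ penrose.Omega)}
    (h : ∀ s ∈ l, s ∈ ({hom hP (.N 0), hom hP (.N 1), hom hP (.N 2), hom hP .M, hom hP .S} : Set _) ∨
      s⁻¹ ∈ ({hom hP (.N 0), hom hP (.N 1), hom hP (.N 2), hom hP .M, hom hP .S} : Set _)) :
    ∃ w : List Ltr, w.map (hom hP) = l := by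
  have hA : ∀ s ∈ ({hom hP (.N 0), hom hP (.N 1), hom hP (.N 2), hom hP .M, hom hP .S} : Set _),
      s ∈ Set.range (hom hP) := by
    rintro s (rfl | rfl | rfl | rfl | rfl) <;> exact ⟨_, rfl⟩
  have h1 : l ∈ Set.range (List.map (hom hP)) := by
    rw [Set.range_list_map]
    intro s hs
    rcases h s hs with h2 | h2
    · exact hA _ h2
    · obtain ⟨t, ht⟩ := hA _ h2
      refine ⟨t, ?_⟩
      have h3 : hom hP t * hom hP t = 1 := Homeomorph.ext fun ζ => hom_hom hP t ζ
      rw [← inv_inv s, ← ht]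
      exact eq_inv_of_mul_eq_one_left h3
  exact h1

lemma growth_le_card {n M R : ℕ} (hn : 2 ≤ n)
    (h : ∀ w : List Ltr, w.length ≤ R → cnt P one n w + cnt P two n w ≤ M) :
    growth ({hom hP (.N 0), hom hP (.N 1), hom hP (.N 2), hom hP .M, hom hP .S} : Set _) R ≤
      Fintype.card (Val n M) ^ Fintype.card (Pos n) * (Fintype.card (Val n M) + 1) ^ M := by
  have h1 : ∀ g ∈ {g : penrose.Omega ≃ₜ penrose.Omega | ∃ l : List _, l.length ≤ R ∧
      (∀ s ∈ l, s ∈ ({hom hP (.N 0), hom hP (.N 1), hom hP (.N 2), hom hP .M, hom hP .S} : Set _) ∨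
        s⁻¹ ∈ ({hom hP (.N 0), hom hP (.N 1), hom hP (.N 2), hom hP .M, hom hP .S} : Set _)) ∧
      l.prod = g}, ∃ w : List Ltr, w.length ≤ R ∧ (w.map (hom hP)).prod = g := by
    rintro g ⟨l, hl, h2, rfl⟩
    obtain ⟨w, rfl⟩ := exists_word hP h2
    exact ⟨w, by simpa using hl, rfl⟩
  choose! w hw hg using h1
  have hlen : ∀ g ∈ _, (record P n M hn (w g)).log.length ≤ M := fun g hg' => by
    have := h (w g) (hw g hg')
    rw [← length_record (M := M) hn hP] at this
    exact_mod_cast this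
  let f : (penrose.Omega ≃ₜ penrose.Omega) → (Pos n → Val n M) × (Fin M → Option (Val n M)) := fun g =>
    ((record P n M hn (w g)).hist, fun k => (record P n M hn (w g)).log[(k : ℕ)]?)
  have hf : Set.InjOn f {g : penrose.Omega ≃ₜ penrose.Omega | ∃ l : List _, l.length ≤ R ∧
      (∀ s ∈ l, s ∈ ({hom hP (.N 0), hom hP (.N 1), hom hP (.N 2), hom hP .M, hom hP .S} : Set _) ∨
        s⁻¹ ∈ ({hom hP (.N 0), hom hP (.N 1), hom hP (.N 2), hom hP .M, hom hP .S} : Set _)) ∧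
      l.prod = g} := by
    intro g hg1 g' hg2 hgg
    rw [← hg g hg1, ← hg g' hg2]
    refine prod_eq_of_record hn hP (hlen g hg1) (hlen g' hg2) (congrArg Prod.fst hgg) fun k => ?_
    rcases lt_or_ge k M with hk | hk
    · exact congrFun (congrArg Prod.snd hgg) ⟨k, hk⟩
    · rw [List.getElem?_eq_none ((hlen g hg1).trans hk), List.getElem?_eq_none ((hlen g' hg2).trans hk)]
  have h2 := Set.ncard_le_ncard_of_injOn (t := Set.univ) f (fun _ _ => Set.mem_univ _) hf
    Set.finite_univ
  rw [Set.ncard_univ, Nat.card_eq_fintype_card, Fintype.card_prod, Fintype.card_fun, Fintype.card_fun,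
    Fintype.card_option, Fintype.card_fin] at h2
  exact h2

lemma growth_le_exp {n M R : ℕ} (hn : 2 ≤ n)
    (h : ∀ w : List Ltr, w.length ≤ R → cnt P one n w + cnt P two n w ≤ M) {Y : ℝ} (hY : 1 ≤ Y)
    (hp : (Fintype.card (Pos n) : ℝ) ≤ Y) (hM : (M : ℝ) ≤ Y) :
    (growth ({hom hP (.N 0), hom hP (.N 1), hom hP (.N 2), hom hP .M, hom hP .S} : Set _) R : ℝ) ≤
      Real.exp (30 * Y * Real.log (28 * Y)) := by
  have h1 : (growth ({hom hP (.N 0), hom hP (.N 1), hom hP (.N 2), hom hP .M, hom hP .S} : Set _) R : ℝ) ≤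
      (Fintype.card (Val n M) : ℝ) ^ Fintype.card (Pos n) * ((Fintype.card (Val n M) : ℝ) + 1) ^ M := by
    exact_mod_cast growth_le_card hP hn h
  set V : ℝ := (Fintype.card (Val n M) : ℝ) + 1 with hV
  -- The exponent 15 is the number of pairs of a neighbour type and a piece, each with 2(M + 1) ≤ 4Y
  -- outcomes; the constant 28 is generous.
  have h2 : V ≤ (28 * Y) ^ 15 := by
    rw [hV, card_val]
    push_cast
    have h3 : ((M : ℝ) + 1) * 2 ≤ 4 * Y := by linarith
    have h4 : ((((M : ℝ) + 1) * 2) ^ 3) ^ 5 ≤ (4 * Y) ^ 15 := by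
      rw [← pow_mul]
      exact pow_le_pow_left₀ (by positivity) h3 _
    have h5 : Y ≤ Y ^ 15 := le_self_pow₀ hY (by norm_num)
    have h6 : (1 : ℝ) ≤ Y ^ 15 := one_le_pow₀ hY
    have h7 : (4 * Y) ^ 15 = 4 ^ 15 * Y ^ 15 := mul_pow _ _ _
    have h8 : (28 * Y) ^ 15 = 28 ^ 15 * Y ^ 15 := mul_pow _ _ _
    rw [h8]
    rw [h7] at h4
    have h9 : (5 * 4 ^ 15 + 2 : ℝ) * Y ^ 15 ≤ 28 ^ 15 * Y ^ 15 :=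
      mul_le_mul_of_nonneg_right (by norm_num) (by positivity)
    linarith
  have hV1 : 1 ≤ V := by rw [hV]; exact le_add_of_nonneg_left (by positivity)
  have h3 : (Fintype.card (Val n M) : ℝ) ^ Fintype.card (Pos n) ≤ V ^ Fintype.card (Pos n) :=
    pow_le_pow_left₀ (by positivity) (by rw [hV]; linarith) _
  have h4 := h1.trans (mul_le_mul_of_nonneg_right h3 (by positivity))
  rw [← pow_add] at h4
  have h5 : V ^ (Fintype.card (Pos n) + M) = Real.exp (((Fintype.card (Pos n) : ℝ) + M) * Real.log V) := by
    rw [← Nat.cast_add, mul_comm, Real.exp_mul, Real.exp_log (by linarith), Real.rpow_natCast]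
  rw [h5] at h4
  refine h4.trans (Real.exp_le_exp.2 ?_)
  have h6 : Real.log V ≤ 15 * Real.log (28 * Y) := by
    have := Real.log_le_log (by linarith) h2
    rwa [Real.log_pow] at this
  have h7 : 0 ≤ Real.log V := Real.log_nonneg hV1
  calc ((Fintype.card (Pos n) : ℝ) + M) * Real.log V ≤ (2 * Y) * (15 * Real.log (28 * Y)) :=
        mul_le_mul (by linarith) h6 h7 (by linarith)
    _ = 30 * Y * Real.log (28 * Y) := by ring

lemma log_golden_pos : 0 < Real.log ((3 + Real.sqrt 5) / 2) :=
  Real.log_pos (by have := Real.sqrt_nonneg 5; linarith)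

/-- Stretched exponential bounds for the growth. -/
lemma exists_growth_le {h : ℝ} (H : Rate h) : ∃ C : ℝ, 1 ≤ C ∧ ∀ R : ℕ, 1 ≤ R → ∀ Y : ℝ,
    Y = C * (R : ℝ) ^ (Real.log ((3 + Real.sqrt 5) / 2) / (Real.log ((3 + Real.sqrt 5) / 2) - Real.log h)) →
    1 ≤ Y ∧ (growth ({hom hP (.N 0), hom hP (.N 1), hom hP (.N 2), hom hP .M, hom hP .S} : Set _) R : ℝ) ≤
      Real.exp (30 * Y * Real.log (28 * Y)) := by
  obtain ⟨C, hC, hcnt⟩ := exists_cnt_le hP H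
  have hβ := log_golden_pos
  set β := (3 + Real.sqrt 5) / 2 with hβd
  have hβ1 : 0 < β := by positivity
  have hh := Real.log_neg H.pos H.lt_one
  have hd : 0 < Real.log β - Real.log h := by linarith
  set α := Real.log β / (Real.log β - Real.log h) with hα
  have hα0 : 0 < α := div_pos hβ hd
  -- The tile of level n + 3 has F_{2n+8} vertices, which is at most φ⁷βⁿ for the golden ratio φ.
  set D : ℝ := Real.goldenRatio ^ 7 with hD
  have hD0 : 0 < D := by have := Real.goldenRatio_pos; positivity
  set A : ℝ := C * (β / h + D) + 2 * D + 1 with hA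
  have hA0 : 0 < C * (β / h + D) := by have := H.pos; positivity
  refine ⟨A, by rw [hA]; linarith, fun R hR Y hY => ?_⟩
  have hR1 : (1 : ℝ) ≤ R := by exact_mod_cast hR
  have hRα : 1 ≤ (R : ℝ) ^ α := Real.one_le_rpow hR1 hα0.le
  have hlogR : 0 ≤ Real.log R := Real.log_nonneg hR1
  -- The level at which (β/h)ⁿ equals R up to a factor β/h, so that hⁿR and βⁿ have the same order.
  set n := ⌊Real.log R / (Real.log β - Real.log h)⌋₊ with hn
  have hn1 : (n : ℝ) * (Real.log β - Real.log h) ≤ Real.log R := by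
    rw [← le_div_iff₀ hd]
    exact Nat.floor_le (by positivity)
  have hn2 : Real.log R ≤ (n + 1) * (Real.log β - Real.log h) := by
    rw [← div_le_iff₀ hd]
    exact (Nat.lt_floor_add_one _).le
  have e1 : β ^ n ≤ (R : ℝ) ^ α := by
    rw [← Real.exp_log hβ1, ← Real.exp_nat_mul, Real.rpow_def_of_pos (by linarith)]
    refine Real.exp_le_exp.2 ?_
    rw [hα, mul_div_assoc', le_div_iff₀ hd]
    nlinarith
  have e2 : h ^ n * R ≤ β / h * β ^ n := by
    have a1 : h ^ n = Real.exp (n * Real.log h) := by rw [Real.exp_nat_mul, Real.exp_log H.pos]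
    have a2 : β ^ n = Real.exp (n * Real.log β) := by rw [Real.exp_nat_mul, Real.exp_log hβ1]
    have a3 : β / h = Real.exp (Real.log β - Real.log h) := by
      rw [Real.exp_sub, Real.exp_log hβ1, Real.exp_log H.pos]
    have a4 : (R : ℝ) = Real.exp (Real.log R) := (Real.exp_log (by linarith)).symm
    rw [a1, a2, a3, a4, ← Real.exp_add, ← Real.exp_add]
    refine Real.exp_le_exp.2 ?_
    linarith
  have e3 : ((tl two (n + 3)).card : ℝ) ≤ D * β ^ n := by
    rw [(card_tl (n + 2)).2, hD, hβd, beta_eq, ← pow_mul, ← pow_add]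
    have := fib_le_pow (2 * n + 7)
    rw [show 2 * (n + 2) + 4 = 2 * n + 7 + 1 by ring, add_comm 7]
    exact this
  have hβn : 0 < β ^ n := by positivity
  set M := ⌈C * (β / h + D) * β ^ n⌉₊ with hM
  have hMle : (M : ℝ) ≤ C * (β / h + D) * β ^ n + 1 := (Nat.ceil_lt_add_one (by positivity)).le
  have hY1 : C * (β / h + D) * β ^ n ≤ C * (β / h + D) * (R : ℝ) ^ α :=
    mul_le_mul_of_nonneg_left e1 hA0.le
  have hY2 : 2 * D * β ^ n ≤ 2 * D * (R : ℝ) ^ α := mul_le_mul_of_nonneg_left e1 (by positivity)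
  have hYe : Y = C * (β / h + D) * (R : ℝ) ^ α + 2 * D * (R : ℝ) ^ α + (R : ℝ) ^ α := by
    rw [hY, hA]; ring
  have hp1 : 0 < C * (β / h + D) * (R : ℝ) ^ α := by positivity
  have hp2 : 0 < 2 * D * (R : ℝ) ^ α := by positivity
  have hY0 : 1 ≤ Y := by linarith
  refine ⟨hY0, growth_le_exp hP (n := n + 3) (M := M) (by omega) ?_ hY0 ?_ (by linarith)⟩
  · intro w hw
    refine (hcnt n w).trans (le_trans ?_ (Nat.le_ceil _))
    have hw' : (w.length : ℝ) ≤ R := by exact_mod_cast hw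
    rw [mul_assoc C]
    refine mul_le_mul_of_nonneg_left ?_ hC.le
    have := mul_le_mul_of_nonneg_left hw' (pow_pos H.pos n).le
    linarith
  · have h1 : (Fintype.card (Pos (n + 3)) : ℝ) ≤ 2 * (tl two (n + 3)).card := by
      exact_mod_cast card_pos (n + 2)
    linarith

/-- The bound for the growth of the fragmentation. -/
theorem exists_growth_le_rpow {h α : ℝ} (H : Rate h)
    (hα : Real.log ((3 + Real.sqrt 5) / 2) / (Real.log ((3 + Real.sqrt 5) / 2) - Real.log h) < α) :
    ∃ C : ℝ, 1 ≤ C ∧ ∀ R : ℕ, 1 ≤ R →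
      (growth ({hom hP (.N 0), hom hP (.N 1), hom hP (.N 2), hom hP .M, hom hP .S} : Set _) R : ℝ) ≤
        Real.exp ((C * (R : ℝ)) ^ α) := by
  obtain ⟨C, hC, hg⟩ := exists_growth_le hP H
  have hβ := log_golden_pos
  have hh := Real.log_neg H.pos H.lt_one
  set β := (3 + Real.sqrt 5) / 2 with hβd
  have hd : 0 < Real.log β - Real.log h := by linarith
  set a := Real.log β / (Real.log β - Real.log h)
  have ha : 0 < a := div_pos hβ hd
  have hα0 : 0 < α := ha.trans hα
  -- The logarithmic factor is bounded by a power with exponent ε, and a(1 + ε) = α.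
  set ε := α / a - 1 with hε
  have hε0 : 0 < ε := by rw [hε, sub_pos, one_lt_div ha]; exact hα
  have haε : a * (1 + ε) = α := by rw [hε]; field_simp; ring
  set K : ℝ := 30 * (28 ^ ε / ε) * C ^ (1 + ε) with hK
  have hK0 : 0 < K := by positivity
  refine ⟨(K + 1) ^ (1 / α), Real.one_le_rpow (by linarith) (by positivity), fun R hR => ?_⟩
  obtain ⟨hY, h1⟩ := hg R hR _ rfl
  refine h1.trans (Real.exp_le_exp.2 ?_)
  have hR1 : (1 : ℝ) ≤ R := by exact_mod_cast hR
  set Y := C * (R : ℝ) ^ a with hYd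
  have hY0 : 0 < Y := by linarith
  have h2 : Real.log (28 * Y) ≤ (28 * Y) ^ ε / ε := Real.log_le_rpow_div (by positivity) hε0
  have h3 : 30 * Y * Real.log (28 * Y) ≤ K * (R : ℝ) ^ α := by
    refine (mul_le_mul_of_nonneg_left h2 (by positivity)).trans (le_of_eq ?_)
    have h4 : Y ^ (1 + ε) = C ^ (1 + ε) * (R : ℝ) ^ α := by
      rw [hYd, Real.mul_rpow (by linarith) (by positivity), ← Real.rpow_mul (by linarith), haε]
    have h5 : Y ^ (1 + ε) = Y * Y ^ ε := by rw [Real.rpow_add hY0, Real.rpow_one]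
    rw [Real.mul_rpow (by norm_num) hY0.le, hK, mul_assoc (30 * (28 ^ ε / ε)), ← h4, h5]
    ring
  rw [Real.mul_rpow (by positivity) (by linarith), ← Real.rpow_mul (by linarith), one_div,
    inv_mul_cancel₀ hα0.ne', Real.rpow_one]
  have : 0 ≤ (R : ℝ) ^ α := by positivity
  linarith

end TileInfl

namespace TileInfl

/-! ### The numerical constants -/

lemma quintic_strictMono {x y : ℝ} (hx : 0 ≤ x) (h : x < y) :
    x ^ 5 + x ^ 4 + x ^ 3 < y ^ 5 + y ^ 4 + y ^ 3 := by
  have h1 := pow_lt_pow_left₀ h hx (n := 5) (by norm_num)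
  have h2 := pow_lt_pow_left₀ h hx (n := 4) (by norm_num)
  have h3 := pow_lt_pow_left₀ h hx (n := 3) (by norm_num)
  linarith

lemma exists_root : ∃ η : ℝ, 0.90281 ≤ η ∧ η ≤ 0.90282 ∧ η ^ 5 + η ^ 4 + η ^ 3 - 2 = 0 := by
  have hc : ContinuousOn (fun x : ℝ => x ^ 5 + x ^ 4 + x ^ 3 - 2) (Set.Icc 0.90281 0.90282) := by
    fun_prop
  have h := intermediate_value_Icc (by norm_num) hc
  obtain ⟨η, hη, h0⟩ := h (show (0 : ℝ) ∈ _ from ⟨by norm_num, by norm_num⟩)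
  exact ⟨η, hη.1, hη.2, h0⟩

lemma golden_bounds : (2.618033 : ℝ) ≤ (3 + Real.sqrt 5) / 2 ∧ (3 + Real.sqrt 5) / 2 ≤ 2.618035 := by
  have h1 : (2.236067 : ℝ) ≤ Real.sqrt 5 := Real.le_sqrt_of_sq_le (by norm_num)
  have h2 : Real.sqrt 5 ≤ (2.236069 : ℝ) := Real.sqrt_le_iff.2 ⟨by norm_num, by norm_num⟩
  constructor <;> linarith

lemma log_golden_bounds : (0.9624 : ℝ) ≤ Real.log ((3 + Real.sqrt 5) / 2) ∧
    Real.log ((3 + Real.sqrt 5) / 2) ≤ 0.96243 := by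
  obtain ⟨h1, h2⟩ := golden_bounds
  constructor
  -- The series of log((1 + x)/(1 − x)), evaluated just below x = (β − 1)/(β + 1) = 1/√5.
  · have h3 := Real.sum_range_le_log_div (x := 0.447213) (by norm_num) (by norm_num) 8
    have h4 := Real.log_le_log (x := (1 + 0.447213) / (1 - 0.447213)) (by norm_num)
      (le_trans (by norm_num) h1)
    norm_num [Finset.sum_range_succ] at h3 h4 ⊢
    linarith
  · have h3 := Real.log_div_le_sum_range_add (x := 0.447215) (by norm_num) (by norm_num) 8
    have h4 := Real.log_le_log (y := (1 + 0.447215) / (1 - 0.447215)) (by linarith)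
      (h2.trans (by norm_num))
    norm_num [Finset.sum_range_succ] at h3 h4 ⊢
    linarith

lemma neg_log_bounds {η : ℝ} (h1 : 0.90281 ≤ η) (h2 : η ≤ 0.90282) :
    (0.1022 : ℝ) ≤ -Real.log η ∧ -Real.log η ≤ 0.10225 := by
  have h0 : 0 < η := by linarith
  rw [← Real.log_inv]
  have h5 : (1.10764 : ℝ) ≤ η⁻¹ := by rw [le_inv_comm₀ (by norm_num) h0]; exact h2.trans (by norm_num)
  have h6 : η⁻¹ ≤ (1.107653 : ℝ) := by
    rw [inv_le_comm₀ h0 (by norm_num)]; exact le_trans (by norm_num) h1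
  constructor
  -- Again log((1 + x)/(1 − x)), with x close to (1 − η)/(1 + η).
  · have h3 := Real.sum_range_le_log_div (x := 0.05107) (by norm_num) (by norm_num) 3
    have h4 := Real.log_le_log (x := (1 + 0.05107) / (1 - 0.05107)) (by norm_num)
      (le_trans (by norm_num) h5)
    norm_num [Finset.sum_range_succ] at h3 h4 ⊢
    linarith
  · have h3 := Real.log_div_le_sum_range_add (x := 0.05108) (by norm_num) (by norm_num) 3
    have h4 := Real.log_le_log (y := (1 + 0.05108) / (1 - 0.05108)) (by positivity)
      (h6.trans (by norm_num))
    norm_num [Finset.sum_range_succ] at h3 h4 ⊢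
    linarith

lemma abs_exponent_sub {η : ℝ} (h1 : 0.90281 ≤ η) (h2 : η ≤ 0.90282) :
    |Real.log ((3 + Real.sqrt 5) / 2) / (Real.log ((3 + Real.sqrt 5) / 2) - Real.log η) - 0.9040| <
      0.00005 := by
  obtain ⟨h3, h4⟩ := log_golden_bounds
  obtain ⟨h5, h6⟩ := neg_log_bounds h1 h2
  rw [abs_lt, lt_sub_iff_add_lt, sub_lt_iff_lt_add, lt_div_iff₀ (by linarith),
    div_lt_iff₀ (by linarith)]
  constructor <;> linarith

/-- Near the root the exponent is continuous. -/
lemma exists_rate {η α β : ℝ} (hη : 0 < η) (hη1 : η < 1) (h0 : η ^ 5 + η ^ 4 + η ^ 3 - 2 = 0)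
    (hβ : 0 < Real.log β) (hα : Real.log β / (Real.log β - Real.log η) < α) :
    ∃ h, Rate h ∧ Real.log β / (Real.log β - Real.log h) < α := by
  have hd : Real.log β - Real.log η ≠ 0 := by have := Real.log_neg hη hη1; linarith
  have hc : ContinuousAt (fun h => Real.log β / (Real.log β - Real.log h)) η :=
    continuousAt_const.div (continuousAt_const.sub (Real.continuousAt_log hη.ne')) hd
  have h1 : ∀ᶠ h in 𝓝 η, Real.log β / (Real.log β - Real.log h) < α := hc.eventually_lt_const hα
  have h2 : ∀ᶠ h in 𝓝 η, h < 1 := eventually_lt_nhds hη1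
  obtain ⟨h, ⟨h3, h4⟩, h5⟩ := (((h1.and h2).filter_mono nhdsWithin_le_nhds).and
    (self_mem_nhdsWithin : ∀ᶠ h in 𝓝[>] η, h ∈ Set.Ioi η)).exists
  exact ⟨h, ⟨hη.trans h5, h4, by have := quintic_strictMono hη.le h5; linarith⟩, h3⟩

end TileInfl

namespace TileInfl
open Vert Edg Inflation

/-! ### Walks in the tiles -/

/-- `Wk k x y`: there is a walk of length at most `k` from `x` to `y` in a finite tile. -/
inductive Wk : ℕ → List Edg → List Edg → Prop
  | refl (k : ℕ) (x : List Edg) : Wk k x x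
  | cons {k : ℕ} {F : State} {x y z : List Edg} (h : TE F x y) (hw : Wk k y z) : Wk (k + 1) x z

namespace Wk

lemma mono {k l : ℕ} {x y : List Edg} (h : Wk k x y) (hkl : k ≤ l) : Wk l x y := by
  induction h generalizing l with
  | refl k x => exact .refl l x
  | cons h _ ih =>
    obtain ⟨l, rfl⟩ := Nat.exists_eq_add_of_le' (show 1 ≤ l by omega)
    exact .cons h (ih (by omega))

lemma trans {k l : ℕ} {x y z : List Edg} (h : Wk k x y) (h' : Wk l y z) : Wk (k + l) x z := by
  induction h with
  | refl k x => exact h'.mono (by omega)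
  | cons h _ ih => exact (Wk.cons h (ih h')).mono (by omega)

lemma of_TE {F : State} {x y : List Edg} (h : TE F x y) : Wk 1 x y := .cons h (.refl 0 y)

lemma symm {k : ℕ} {x y : List Edg} (h : Wk k x y) : Wk k y x := by
  induction h with
  | refl k x => exact .refl k x
  | cons h _ ih => exact ih.trans (of_TE h.symm)

lemma ext {k : ℕ} {x y : List Edg} (h : Wk k x y) (e : Edg) (hx : pth (psrc e) x) :
    Wk k (e :: x) (e :: y) := by
  induction h with
  | refl k x => exact .refl k _
  | cons h _ ih =>
    obtain ⟨v, h1, h2, h3, h4⟩ := h.pths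
    obtain rfl := h1.unique h4 hx
    exact .cons (TE_cons.2 (.inr ⟨_, rfl, h, h1, h2⟩)) (ih h2)

lemma mem_tl {k : ℕ} {x y : List Edg} (h : Wk k x y) {v : Vert} {n : ℕ} (hx : x ∈ tl v n) :
    y ∈ tl v n := by
  induction h with
  | refl k x => exact hx
  | cons h _ ih =>
    obtain ⟨w, h1, h2, h3, h4⟩ := h.pths
    rw [TileInfl.mem_tl] at hx
    obtain rfl := h1.unique h4 hx.1
    exact ih (TileInfl.mem_tl.2 ⟨h2, h3 ▸ hx.2⟩)

end Wk

/-- The copies `aᵢ𝒯` and `cᵢ𝒯` are joined by an edge. -/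
lemma exists_join_ac (n : ℕ) : ∃ x ∈ tl one n, ∃ y ∈ tl two n, ∀ i, ∃ F, TE F (a i :: x) (c i :: y) := by
  rcases n with _ | _ | n
  · exact ⟨[], by simp [tl], [], by simp [tl], fun i => ⟨_, .conn (.inl (.Sa i))⟩⟩
  · exact ⟨[a one], by decide, [b], by decide, fun i => ⟨_, .conn (.inl (.Laa i))⟩⟩
  · refine ⟨bp (.s one) (n + 2), bp_mem (by omega) _, bp (.s two) (n + 2), bp_mem (by omega) (.s two),
      fun i => ⟨_, TE_cons.2 (.inl ⟨.L, ?_, rfl⟩)⟩⟩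
    rw [sta_bp (by omega)]
    simp [bp, lam, cr, cv, List.replicate_succ]

/-- The copies `c₂𝒯₂` and `b𝒯₂` are joined by an edge. -/
lemma exists_join_cb (n : ℕ) : ∃ x ∈ tl two n, ∃ F, TE F (c two :: x) (b :: x) := by
  rcases n with _ | _ | n
  · exact ⟨[], by simp [tl], _, .conn (.inl .M₂)⟩
  · exact ⟨[b], by decide, _, .conn (.inl .Sb₂)⟩
  · refine ⟨bp .m (n + 2), bp_mem (by omega) .m, _, TE_cons.2 (.inl ⟨.L, ?_, rfl⟩)⟩
    rw [sta_bp (by omega)]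
    rfl

lemma wk_ac {n : ℕ} (hn : 2 ≤ n) (i : Vert) : Wk 1 (a i :: bp (.s one) n) (c i :: bp (.s two) n) := by
  refine .of_TE (F := lab .L (a i) (some (.s one)) (bp (.s one) n).length) (TE_cons.2 (.inl ⟨.L, ?_, ?_⟩))
  · rw [sta_bp hn]
    obtain ⟨k, rfl⟩ := Nat.exists_eq_add_of_le' hn
    simp [bp, lam, cr, cv, List.replicate_succ]
  · rw [sta_bp hn]

lemma wk_cb {n : ℕ} (hn : 2 ≤ n) : Wk 1 (c two :: bp .m n) (b :: bp .m n) := by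
  refine .of_TE (F := lab .L (c two) (some .m) (bp .m n).length) (TE_cons.2 (.inl ⟨.L, ?_, ?_⟩))
  · rw [sta_bp hn]
    rfl
  · rw [sta_bp hn]

lemma tl_succ_cases {v : Vert} {n : ℕ} {x : List Edg} (h : x ∈ tl v (n + 1)) :
    ∃ e y, x = e :: y ∧ prng e = v ∧ y ∈ tl (psrc e) n := by
  rw [mem_tl] at h
  obtain ⟨h1, h2⟩ := h
  rcases x with _ | ⟨e, y⟩
  · simp at h2
  · obtain ⟨h3, h4⟩ := (pth_cons _ _ _).1 h1
    exact ⟨e, y, rfl, h3, mem_tl.2 ⟨h4, by simpa using h2⟩⟩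

lemma cons_mem_tl {n : ℕ} {e : Edg} {y : List Edg} (h : y ∈ tl (psrc e) n) : e :: y ∈ tl (prng e) (n + 1) := by
  rw [mem_tl] at h ⊢
  exact ⟨(pth_cons _ _ _).2 ⟨rfl, h.1⟩, by simp [h.2]⟩

/-- The tiles are connected. -/
lemma exists_wk (n : ℕ) {v : Vert} {x y : List Edg} (hx : x ∈ tl v n) (hy : y ∈ tl v n) :
    ∃ k, Wk k x y := by
  induction n generalizing v x y with
  | zero =>
    have h1 := (mem_tl.1 hx).2
    have h2 := (mem_tl.1 hy).2
    rw [List.length_eq_zero_iff.1 h1, List.length_eq_zero_iff.1 h2]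
    exact ⟨0, .refl _ _⟩
  | succ n ih =>
    have key : ∀ e, ∀ x ∈ tl (psrc e) n, ∀ y ∈ tl (psrc e) n, ∃ k, Wk k (e :: x) (e :: y) :=
      fun e x hx y hy => by
        obtain ⟨k, hk⟩ := ih hx hy
        exact ⟨k, hk.ext e (mem_tl.1 hx).1⟩
    obtain ⟨x1, hx1, y1, hy1, h1⟩ := exists_join_ac n
    obtain ⟨x2, hx2, F, h2⟩ := exists_join_cb n
    -- The copy c_v𝒯₂ is adjacent to all the others in the row, so it serves as the hub.
    have toc : ∀ x ∈ tl v (n + 1), ∃ k, Wk k x (c v :: x2) := by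
      intro x hx
      obtain ⟨e, z, rfl, rfl, hz⟩ := tl_succ_cases hx
      have hac : ∀ i, ∀ z ∈ tl one n, ∃ k, Wk k (a i :: z) (c i :: x2) := fun i z hz => by
        obtain ⟨k, hk⟩ := key (a i) z hz x1 hx1
        obtain ⟨F, hF⟩ := h1 i
        obtain ⟨l, hl⟩ := key (c i) y1 hy1 x2 hx2
        exact ⟨_, (hk.trans (.of_TE hF)).trans hl⟩
      rcases e with i | i | _
      · exact hac i z hz
      · exact key (c i) z hz x2 hx2
      · obtain ⟨k, hk⟩ := key b z hz x2 hx2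
        exact ⟨_, hk.trans (.of_TE h2.symm)⟩
    obtain ⟨k, hk⟩ := toc x hx
    obtain ⟨l, hl⟩ := toc y hy
    exact ⟨_, hk.trans hl.symm⟩

/-! ### The distances of the boundary points -/

mutual

/-- One plus the distance of `λ₁` and `σ₁`. -/
def qA : ℕ → ℕ
  | 0 => 1
  | k + 1 => qA k + qB k

/-- One plus the distance of `λ₂` and `σ₂`. -/
def qB : ℕ → ℕ
  | 0 => 1
  | k + 1 => 2 * qC k

/-- One plus the distance of `λ₂` and `μ₂`. -/
def qC : ℕ → ℕ
  | 0 => 1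
  | k + 1 => qC k + qD k

/-- One plus the distance of `σ₂` and `μ₂`. -/
def qD : ℕ → ℕ
  | 0 => 1
  | k + 1 => qB k

end

/-- A system of inequalities closed under the recursion; it makes the four distances comparable up
to constants. -/
lemma qs_bounds (k : ℕ) : 1 ≤ qD k ∧ qD k ≤ qC k ∧ qC k ≤ qB k ∧ qB k ≤ qC k + qD k ∧
    qC k ≤ 2 * qD k ∧ qD k ≤ qA k ∧ qA k ≤ 4 * qC k := by
  induction k with
  | zero => simp [qA, qB, qC, qD]
  | succ k ih => simp only [qA, qB, qC, qD]; omega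

lemma qC_succ_le (k : ℕ) : qC (k + 1) ≤ 2 * qC k := by
  have := qs_bounds k
  simp only [qC]; omega

lemma qC_add_le (k l : ℕ) : qC (k + l) ≤ 2 ^ l * qC k := by
  induction l with
  | zero => simp
  | succ l ih =>
    have := qC_succ_le (k + l)
    rw [← add_assoc, pow_succ]; linarith

lemma lt_qD (k : ℕ) : k ≤ 2 * qD k := by
  suffices h : k + 1 ≤ qC k by have := qs_bounds k; omega
  induction k with
  | zero => simp [qC]
  | succ k ih => have := qs_bounds k; simp only [qC]; omega

lemma exists_wk_bound_of_level {n : ℕ} (hn : 2 ≤ n) :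
    ∃ κ, ∀ v, ∀ x ∈ tl v n, ∀ q ∈ bds v, Wk κ x (bp q n) := by
  have h1 : ∀ p ∈ ((tl one n ×ˢ bds one) ∪ (tl two n ×ˢ bds two)), ∃ k, Wk k p.1 (bp p.2 n) := by
    intro p hp
    rw [Finset.mem_union, Finset.mem_product, Finset.mem_product] at hp
    rcases hp with ⟨h1, h2⟩ | ⟨h1, h2⟩ <;>
    · have h3 := bp_mem hn p.2
      rw [mem_bds.1 h2] at h3
      exact exists_wk n h1 h3
  choose! f hf using h1
  refine ⟨((tl one n ×ˢ bds one) ∪ (tl two n ×ˢ bds two)).sup f, fun v x hx q hq => ?_⟩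
  have h2 : (x, q) ∈ ((tl one n ×ˢ bds one) ∪ (tl two n ×ˢ bds two)) := by
    rw [Finset.mem_union, Finset.mem_product, Finset.mem_product]
    cases v
    · exact .inl ⟨hx, hq⟩
    · exact .inr ⟨hx, hq⟩
  exact (hf _ h2).mono (Finset.le_sup (f := f) h2)

/-- Upper bounds for the distances. -/
lemma exists_wk_bound : ∃ κ : ℕ, 1 ≤ κ ∧ ∀ k,
    ((∃ l, l + 1 ≤ κ * qA k ∧ Wk l (bp (.l one) (k + 4)) (bp (.s one) (k + 4))) ∧
    (∃ l, l + 1 ≤ κ * qB k ∧ Wk l (bp (.l two) (k + 4)) (bp (.s two) (k + 4))) ∧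
    (∃ l, l + 1 ≤ κ * qC k ∧ Wk l (bp (.l two) (k + 4)) (bp .m (k + 4))) ∧
    (∃ l, l + 1 ≤ κ * qD k ∧ Wk l (bp (.s two) (k + 4)) (bp .m (k + 4)))) ∧
    ∀ v, ∀ x ∈ tl v (k + 4), ∀ q ∈ bds v, Wk (8 * (κ * qC k)) x (bp q (k + 4)) := by
  obtain ⟨κ, hκ⟩ := exists_wk_bound_of_level (n := 4) (by omega)
  refine ⟨κ + 1, by omega, fun k => ?_⟩
  induction k with
  | zero =>
    have h4 : 2 ≤ 4 := by omega
    have key : ∀ q q' : Bd, q.vert = q'.vert → ∃ l, l + 1 ≤ (κ + 1) * 1 ∧ Wk l (bp q 4) (bp q' 4) :=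
      fun q q' h => ⟨κ, by omega, hκ _ _ (bp_mem h4 q) q' (mem_bds.2 h.symm)⟩
    exact ⟨⟨key (.l one) (.s one) rfl, key (.l two) (.s two) rfl, key (.l two) .m rfl,
      key (.s two) .m rfl⟩, fun v x hx q hq => (hκ v x hx q hq).mono (by simp only [qC]; omega)⟩
  | succ k ih =>
    generalize κ + 1 = κ at *
    obtain ⟨⟨⟨lA, hA, wA⟩, ⟨lB, hB, wB⟩, ⟨lC, hC, wC⟩, ⟨lD, hD, wD⟩⟩, he⟩ := ih
    have hq := qs_bounds k
    have hn : 2 ≤ k + 4 := by omega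
    have pt : ∀ q, pth q.vert (bp q (k + 4)) := fun q => (mem_tl.1 (bp_mem hn q)).1
    have L : ∀ v, bp (.l v) (k + 1 + 4) = c v :: bp (.l two) (k + 4) := fun v => (cons_l hn v).symm
    have S1 : bp (.s one) (k + 1 + 4) = a one :: bp (.l one) (k + 4) := (cons_a_l hn).symm
    have S2 : bp (.s two) (k + 1 + 4) = b :: bp (.l two) (k + 4) := (cons_b_l hn).symm
    have M : bp .m (k + 1 + 4) = b :: bp (.s two) (k + 4) := (cons_b_s hn).symm
    have m1 : κ * qD k ≤ κ * qC k := Nat.mul_le_mul_left _ hq.2.1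
    have m2 : κ * qB k ≤ κ * qC k + κ * qD k := by rw [← mul_add]; exact Nat.mul_le_mul_left _ hq.2.2.2.1
    have m3 : κ * qA k ≤ 4 * (κ * qC k) := by
      have := Nat.mul_le_mul_left κ hq.2.2.2.2.2.2; linarith
    have m4 : κ * qC k ≤ 2 * (κ * qD k) := by
      have := Nat.mul_le_mul_left κ hq.2.2.2.2.1; linarith
    have X : ∀ i, ∀ x ∈ tl one (k + 4), Wk (8 * (κ * qC k) + 1) (a i :: x) (c i :: bp (.s two) (k + 4)) :=
      fun i x hx => ((he one x hx (.s one) (by decide)).ext (a i) (mem_tl.1 hx).1).trans (wk_ac hn i)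
    have cx : ∀ {l q q'} (i), q.vert = two → Wk l (bp q (k + 4)) (bp q' (k + 4)) →
        Wk l (c i :: bp q (k + 4)) (c i :: bp q' (k + 4)) := fun {l q q'} i hq h => h.ext (c i) (by
          have := pt q; rwa [hq] at this)
    have bx : ∀ {l q q'}, q.vert = two → Wk l (bp q (k + 4)) (bp q' (k + 4)) →
        Wk l (b :: bp q (k + 4)) (b :: bp q' (k + 4)) := fun {l q q'} hq h => h.ext b (by
          have := pt q; rwa [hq] at this)
    refine ⟨⟨⟨lB + 1 + lA, ?_, ?_⟩, ⟨lC + 1 + lC, ?_, ?_⟩, ⟨lC + 1 + lD, ?_, ?_⟩, ⟨lB, ?_, ?_⟩⟩, ?_⟩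
    · simp only [qA]; linarith
    · rw [L, S1]
      exact ((cx one rfl wB).trans (wk_ac hn one).symm).trans (wA.symm.ext (a one) (pt (.s one)))
    · simp only [qB]; linarith
    · rw [L, S2]
      exact ((cx two rfl wC).trans (wk_cb hn)).trans (bx rfl wC.symm)
    · simp only [qC]; linarith
    · rw [L, M]
      exact ((cx two rfl wC).trans (wk_cb hn)).trans (bx rfl wD.symm)
    · simp only [qD]; exact hB
    · rw [S2, M]
      exact bx rfl wB
    -- The walk leaves its own copy through a boundary point and follows the row of copies. The
    -- increase 8κ `qD k` of the bound pays for the crossings.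
    · intro v x hx q hq'
      have hC' : 8 * (κ * qC (k + 1)) = 8 * (κ * qC k) + 8 * (κ * qD k) := by simp only [qC]; ring
      rw [hC']
      obtain ⟨e, y, rfl, rfl, hy⟩ := tl_succ_cases hx
      rcases e with i | i | _
      · have h0 := X i y hy
        cases i
        · rcases q with (_ | _) | (_ | _) | _ <;> simp [bds, prng] at hq'
          · rw [L]
            exact (h0.trans (cx one rfl wB.symm)).mono (by omega)
          · rw [S1]
            exact ((he one y hy (.l one) (by decide)).ext (a one) (mem_tl.1 hy).1).mono (by omega)
        · rcases q with (_ | _) | (_ | _) | _ <;> simp [bds, prng] at hq'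
          · rw [L]
            exact (h0.trans (cx two rfl wB.symm)).mono (by omega)
          · rw [S2]
            exact (((h0.trans (cx two rfl wD)).trans (wk_cb hn)).trans (bx rfl wC.symm)).mono (by omega)
          · rw [M]
            exact (((h0.trans (cx two rfl wD)).trans (wk_cb hn)).trans (bx rfl wD.symm)).mono (by omega)
      · have h0 : ∀ q ∈ bds two, Wk (8 * (κ * qC k)) (c i :: y) (c i :: bp q (k + 4)) :=
          fun q hq => (he two y hy q hq).ext (c i) (mem_tl.1 hy).1
        cases i
        · rcases q with (_ | _) | (_ | _) | _ <;> simp [bds, prng] at hq'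
          · rw [L]
            exact (h0 (.l two) (by decide)).mono (by omega)
          · rw [S1]
            exact (((h0 (.s two) (by decide)).trans (wk_ac hn one).symm).trans
              (wA.symm.ext (a one) (pt (.s one)))).mono (by omega)
        · rcases q with (_ | _) | (_ | _) | _ <;> simp [bds, prng] at hq'
          · rw [L]
            exact (h0 (.l two) (by decide)).mono (by omega)
          · rw [S2]
            exact (((h0 .m (by decide)).trans (wk_cb hn)).trans (bx rfl wC.symm)).mono (by omega)
          · rw [M]
            exact (((h0 .m (by decide)).trans (wk_cb hn)).trans (bx rfl wD.symm)).mono (by omega)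
      · have h0 : ∀ q ∈ bds two, Wk (8 * (κ * qC k)) (b :: y) (b :: bp q (k + 4)) :=
          fun q hq => (he two y hy q hq).ext b (mem_tl.1 hy).1
        rcases q with (_ | _) | (_ | _) | _ <;> simp [bds, prng] at hq'
        · rw [L]
          exact (((h0 .m (by decide)).trans (wk_cb hn).symm).trans (cx two rfl wC.symm)).mono (by omega)
        · rw [S2]
          exact (h0 (.l two) (by decide)).mono (by omega)
        · rw [M]
          exact (h0 (.s two) (by decide)).mono (by omega)

/-! ### Lower bounds for the distances -/

/-- The recursion for the function `dd`. -/
def ddStep (d : Bd → ℤ) (k : ℕ) : Bd → Edg → ℤ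
  | .l two, c _ => d (.l two)
  | .l two, b => d .m + qC k
  | .l two, a _ => d (.s one) + qB k
  | .s two, b => d (.l two)
  | .s two, c _ => d .m + qC k
  | .s two, a _ => d (.s one) + qD k + qC k
  | .m, b => d (.s two)
  | .m, c _ => d .m + qD k
  | .m, a _ => d (.s one) + 2 * qD k
  | .l one, c _ => d (.l two)
  | .l one, a _ => d (.s one) + qB k
  | .l one, b => 0
  | .s one, a _ => d (.l one)
  | .s one, c _ => d (.s two) + qA k
  | .s one, b => 0

/-- A Lipschitz function that vanishes at a boundary point and takes the values given by the
distances of the boundary points at the other ones. -/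
def dd : List Edg → Bd → ℤ
  | [], _ => 0
  | e :: x, q => if x.length < 4 then 0 else ddStep (dd x) (x.length - 4) q e

lemma dd_cons {k : ℕ} {x : List Edg} (hx : x.length = k + 4) (e : Edg) (q : Bd) :
    dd (e :: x) q = ddStep (dd x) k q e := by
  rw [dd, if_neg (by omega), hx, Nat.add_sub_cancel]

/-- One plus the distance of two boundary points. -/
def bdd (k : ℕ) : Bd → Bd → ℕ
  | .l one, .s one => qA k
  | .s one, .l one => qA k
  | .l two, .s two => qB k
  | .s two, .l two => qB k
  | .l two, .m => qC k
  | .m, .l two => qC k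
  | .s two, .m => qD k
  | .m, .s two => qD k
  | _, _ => 1

lemma dd_of_length {x : List Edg} (h : x.length ≤ 4) (q : Bd) : dd x q = 0 := by
  cases x with
  | nil => rfl
  | cons e x => simp only [List.length_cons] at h; rw [dd, if_pos (by omega)]

/-- The increments in `ddStep` are distances along the row of copies, so at boundary points they
reproduce the recursion of `qA`, …, `qD`. It starts from zero on level 4, where these sequences are
1. -/
lemma dd_bp (k : ℕ) (q q' : Bd) (h : q.vert = q'.vert) : dd (bp q' (k + 4)) q = (bdd k q q' : ℤ) - 1 := by
  induction k generalizing q q' with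
  | zero =>
    rw [dd_of_length (bp_length (by omega) q').le]
    rcases q with (_ | _) | (_ | _) | _ <;> rcases q' with (_ | _) | (_ | _) | _ <;>
      rfl
  | succ k ih =>
    have hn : 2 ≤ k + 4 := by omega
    have L : ∀ v, bp (.l v) (k + 1 + 4) = c v :: bp (.l two) (k + 4) := fun v => (cons_l hn v).symm
    have S1 : bp (.s one) (k + 1 + 4) = a one :: bp (.l one) (k + 4) := (cons_a_l hn).symm
    have S2 : bp (.s two) (k + 1 + 4) = b :: bp (.l two) (k + 4) := (cons_b_l hn).symm
    have M : bp .m (k + 1 + 4) = b :: bp (.s two) (k + 4) := (cons_b_s hn).symm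
    have hd : ∀ q q' e, dd (e :: bp q' (k + 4)) q = ddStep (dd (bp q' (k + 4))) k q e :=
      fun q q' e => dd_cons (bp_length hn q') e q
    rcases q with (_ | _) | (_ | _) | _ <;> rcases q' with (_ | _) | (_ | _) | _ <;>
      simp only [Bd.vert, reduceCtorEq] at h <;> simp only [L, S1, S2, M] <;>
      rw [hd] <;> simp only [ddStep] <;> simp (disch := decide) only [ih] <;>
      simp only [bdd, qA, qB, qC, qD] <;> push_cast <;> ring

/-- Within a copy `dd` is a value of the previous level plus a constant. Across a connection the
constants are such that the two sides differ by the one edge crossed. -/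
lemma dd_lipschitz {F : State} {x y : List Edg} (h : TE F x y) {v : Vert} (hx : pth v x) {q : Bd}
    (hq : q.vert = v) : |dd x q - dd y q| ≤ 1 := by
  subst hq
  induction x generalizing y q with
  | nil => exact absurd h TE.nil_left
  | cons e x ih =>
    obtain ⟨w, _, _, hl, _⟩ := h.pths
    rcases lt_or_ge x.length 4 with hx4 | hx4
    · rw [dd_of_length (by simp; omega), dd_of_length (by rw [← hl]; simp; omega)]
      simp
    · obtain ⟨k, hk⟩ := Nat.exists_eq_add_of_le' hx4
      have hn : 2 ≤ k + 4 := by omega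
      rw [pth_cons] at hx
      rcases TE_cons.1 h with ⟨g, h1, _⟩ | ⟨y', rfl, h, h1, h2⟩
      · have hg : g = .L := by
          by_contra hg
          exact cr_ne h1 (sta_ne_L (by omega) _ hg)
        subst hg
        have hcv2 : cv (bp (.s two) (k + 4)) = bp (.s one) (k + 4) := by
          simp [bp, lam, cv, List.replicate_succ]
        have hcv1 : cv (bp (.s one) (k + 4)) = bp (.s two) (k + 4) := by
          simp [bp, lam, cv, List.replicate_succ]
        have hs : ∀ q, sta .L x (psrc e) = some q → x = bp q (k + 4) := fun q h0 =>
          (sta_L_iff hn hk).1 h0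
        have hd : ∀ q q' e, dd (e :: bp q' (k + 4)) q = ddStep (dd (bp q' (k + 4))) k q e :=
          fun q q' e => dd_cons (bp_length hn q') e q
        have v1 := dd_bp k (.s one) (.s one) rfl
        have v2 := dd_bp k (.l one) (.s one) rfl
        have v3 := dd_bp k (.s two) (.s two) rfl
        have v4 := dd_bp k (.l two) (.s two) rfl
        have v5 := dd_bp k .m (.s two) rfl
        have v6 := dd_bp k .m .m rfl
        have v7 := dd_bp k (.l two) .m rfl
        have v8 := dd_bp k (.s two) .m rfl
        rcases cr_eq_some h1 with ⟨i, rfl, h2, rfl⟩ | ⟨i, rfl, h2, rfl⟩ | ⟨rfl, h2, rfl⟩ |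
          ⟨rfl, h2, rfl⟩ | ⟨rfl, h2, rfl⟩
        · obtain rfl := hs _ h2
          rw [hcv1]
          rcases q with (_ | _) | (_ | _) | _ <;> simp [Bd.vert, prng] at hx <;>
            simp only [hd, ddStep, v1, v2, v3, v4, v5, bdd] <;> rw [abs_le] <;>
            constructor <;> push_cast <;> linarith
        · obtain rfl := hs _ h2
          rw [hcv2]
          rcases q with (_ | _) | (_ | _) | _ <;> simp [Bd.vert, prng] at hx <;>
            simp only [hd, ddStep, v1, v2, v3, v4, v5, bdd] <;> rw [abs_le] <;>
            constructor <;> push_cast <;> linarith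
        · obtain rfl := hs _ h2
          rcases q with (_ | _) | (_ | _) | _ <;> simp [Bd.vert, prng] at hx <;>
            simp only [hd, ddStep, v6, v7, v8, bdd] <;> rw [abs_le] <;>
            constructor <;> push_cast <;> linarith
        · obtain rfl := hs _ h2
          rcases q with (_ | _) | (_ | _) | _ <;> simp [Bd.vert, prng] at hx <;>
            simp only [hd, ddStep, v6, v7, v8, bdd] <;> rw [abs_le] <;>
            constructor <;> push_cast <;> linarith
        · simp
      · have hl' : y'.length = x.length := by simpa using hl.symm
        have key : ∀ q : Bd, q.vert = psrc e → |dd x q - dd y' q| ≤ 1 := fun q hq => ih h (hq ▸ h1)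
        rw [dd_cons hk, dd_cons (hl'.trans hk)]
        rcases q with (_ | _) | (_ | _) | _ <;> rcases e with i | i | _ <;>
          simp only [ddStep, add_sub_add_right_eq_sub] <;>
          first
          | exact key _ rfl
          | simp [Bd.vert, prng] at hx

lemma Wk.dd_le {l : ℕ} {x y : List Edg} (h : Wk l x y) {q : Bd} (hx : pth q.vert x) :
    |dd x q - dd y q| ≤ l := by
  induction h with
  | refl k x => simp
  | @cons k F x y z h _ ih =>
    obtain ⟨v, h1, h2, h3, h4⟩ := h.pths
    obtain rfl := h1.unique h4 hx
    have h5 := dd_lipschitz h h1 rfl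
    have h6 := ih h2
    calc |dd x q - dd z q| ≤ |dd x q - dd y q| + |dd y q - dd z q| := abs_sub_le _ _ _
      _ ≤ 1 + k := add_le_add h5 h6
      _ = ((k + 1 : ℕ) : ℤ) := by push_cast; ring

/-- Distinct boundary points are far from each other. -/
lemma qD_le_of_wk {k l : ℕ} {q q' : Bd} (h : Wk l (bp q (k + 4)) (bp q' (k + 4)))
    (hv : q.vert = q'.vert) (hne : q ≠ q') : qD k ≤ l + 1 := by
  have hn : 2 ≤ k + 4 := by omega
  have h1 := h.dd_le (q := q) (mem_tl.1 (bp_mem hn q)).1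
  rw [dd_bp _ _ _ rfl, dd_bp _ _ _ hv] at h1
  have h2 : bdd k q q = 1 := by rcases q with (_ | _) | (_ | _) | _ <;> rfl
  have h3 : qD k ≤ bdd k q q' := by
    have := qs_bounds k
    rcases q with (_ | _) | (_ | _) | _ <;> rcases q' with (_ | _) | (_ | _) | _ <;>
      simp [Bd.vert] at hv <;> simp [bdd] at hne ⊢ <;> omega
  rw [h2, abs_le] at h1
  push_cast at h1
  omega

/-! ### Walks and the graphs of the tiles -/

lemma tileGraph_adj {v : Vert} {n : ℕ} {x y : penrose.Tile v n} :
    (penrose.tileGraph v n).Adj x y ↔ x ≠ y ∧ ∃ F, TE F x.1 y.1 := by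
  rw [Inflation.tileGraph, SimpleGraph.fromRel_adj]
  refine and_congr_right fun _ => ⟨?_, .inl⟩
  rintro (h | ⟨F, h⟩)
  · exact h
  · exact ⟨_, TileInfl.TE.symm h⟩

lemma graph_adj {η ζ : penrose.Omega} : penrose.graph.Adj η ζ ↔ η ≠ ζ ∧ ∃ F, penrose.Edge F η ζ := by
  rw [Inflation.graph, SimpleGraph.fromRel_adj]
  refine and_congr_right fun _ => ⟨?_, .inl⟩
  rintro (h | ⟨F, h⟩)
  · exact h
  · exact ⟨_, edge_symm h⟩

lemma mem_tl_of_tile {v : Vert} {n : ℕ} (hn : 1 ≤ n) (x : penrose.Tile v n) : x.1 ∈ tl v n :=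
  (tile_mem_iff hn).1 x.2

lemma exists_walk_of_wk {v : Vert} {n : ℕ} (hn : 1 ≤ n) {k : ℕ} {x y : penrose.Tile v n}
    (h : Wk k x.1 y.1) : ∃ p : (penrose.tileGraph v n).Walk x y, p.length ≤ k := by
  generalize hx : x.1 = x' at h
  generalize hy : y.1 = y' at h
  induction h generalizing x with
  | refl k x' =>
    obtain rfl : x = y := Subtype.ext (hx.trans hy.symm)
    exact ⟨.nil, by simp⟩
  | @cons k F x' z' y' h hw ih =>
    have hz : z' ∈ tl v n := (Wk.of_TE h).mem_tl (hx ▸ mem_tl_of_tile hn x)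
    obtain ⟨z, hz'⟩ : ∃ z : penrose.Tile v n, z.1 = z' := ⟨⟨z', (tile_mem_iff hn).2 hz⟩, rfl⟩
    obtain ⟨p, hp⟩ := ih (x := z) hz' hy
    by_cases hxz : x = z
    · exact ⟨p.copy hxz.symm rfl, by rw [SimpleGraph.Walk.length_copy]; omega⟩
    · exact ⟨.cons (tileGraph_adj.2 ⟨hxz, F, by rw [hx, hz']; exact h⟩) p, by
        rw [SimpleGraph.Walk.length_cons]; omega⟩

lemma wk_of_walk {v : Vert} {n : ℕ} {x y : penrose.Tile v n}
    (p : (penrose.tileGraph v n).Walk x y) : Wk p.length x.1 y.1 := by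
  induction p with
  | nil => exact .refl _ _
  | cons h _ ih =>
    obtain ⟨_, F, hF⟩ := tileGraph_adj.1 h
    exact .cons hF ih

lemma connected_tileGraph (v : Vert) {n : ℕ} (hn : 1 ≤ n) : (penrose.tileGraph v n).Connected := by
  have hne : (tl v n).Nonempty := by
    refine ⟨trunc (base v).1 n, mem_tl.2 ⟨?_, trunc_length _ _⟩⟩
    have := pth_trunc (base v) n
    rwa [psrc_base] at this
  obtain ⟨x, hx⟩ := hne
  have : Nonempty (penrose.Tile v n) := ⟨⟨x, (tile_mem_iff hn).2 hx⟩⟩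
  refine ⟨fun x y => ?_⟩
  obtain ⟨k, hk⟩ := exists_wk n (mem_tl_of_tile hn x) (mem_tl_of_tile hn y)
  obtain ⟨p, _⟩ := exists_walk_of_wk hn hk
  exact ⟨p⟩

lemma finite_tile {v : Vert} {n : ℕ} (hn : 1 ≤ n) : Finite (penrose.Tile v n) :=
  Finite.of_equiv _ (tileEquiv hn).symm

/-- Lower bounds for the diameters of the tiles. -/
lemma wk_diam {v : Vert} {n : ℕ} (hn : 1 ≤ n) {x y : List Edg} (hx : x ∈ tl v n) (hy : y ∈ tl v n) :
    Wk (penrose.tileGraph v n).diam x y := by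
  have := finite_tile (v := v) hn
  have hc := connected_tileGraph v hn
  have := hc.nonempty
  have h1 := SimpleGraph.connected_iff_ediam_ne_top.1 hc
  obtain ⟨p, hp⟩ := hc.exists_walk_length_eq_dist ⟨x, (tile_mem_iff hn).2 hx⟩ ⟨y, (tile_mem_iff hn).2 hy⟩
  have h2 := wk_of_walk p
  rw [hp] at h2
  exact h2.mono (SimpleGraph.dist_le_diam h1)

lemma one_le_diam (v : Vert) {n : ℕ} (hn : 1 ≤ n) : 1 ≤ (penrose.tileGraph v n).diam := by
  by_contra h0
  have h1 : (penrose.tileGraph v n).diam = 0 := by omega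
  obtain ⟨k, rfl⟩ := Nat.exists_eq_add_of_le' hn
  have key : ∀ w, ∃ x, x ∈ tl w k := fun w => ⟨trunc (base w).1 k, mem_tl.2 ⟨by
    have := pth_trunc (base w) k
    rwa [psrc_base] at this, trunc_length _ _⟩⟩
  obtain ⟨x, hx⟩ := key one
  obtain ⟨y, hy⟩ := key two
  have h2 := wk_diam hn (cons_mem_tl (e := a v) hx) (cons_mem_tl (e := c v) hy)
  have h3 : (penrose.tileGraph (prng (a v)) (k + 1)).diam = 0 := h1
  change Wk (penrose.tileGraph (prng (a v)) (k + 1)).diam _ _ at h2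
  rw [h3] at h2
  cases h2

lemma qD_le_diam (v : Vert) (k : ℕ) : qD k ≤ (penrose.tileGraph v (k + 4)).diam + 1 := by
  have hn : 2 ≤ k + 4 := by omega
  have h : Wk (penrose.tileGraph v (k + 4)).diam (bp (.l v) (k + 4)) (bp (.s v) (k + 4)) :=
    wk_diam (by omega) (bp_mem hn (.l v)) (bp_mem hn (.s v))
  exact qD_le_of_wk h rfl (by simp)

lemma edist_le_of_wk {n k : ℕ} {η ζ : penrose.Omega} (h : Wk k (trunc η.1 n) (trunc ζ.1 n))
    (ht : ∀ m, n ≤ m → η.1 m = ζ.1 m) : penrose.graph.edist η ζ ≤ k := by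
  generalize hx : trunc η.1 n = x at h
  generalize hy : trunc ζ.1 n = y at h
  induction h generalizing η with
  | refl k x =>
    rw [ext_of_trunc (hx.trans hy.symm) ht]
    simp
  | @cons k F x z y h hw ih =>
    rw [← hx] at h
    obtain ⟨hz, hl, h2⟩ := edge_of_TE h
    have h3 : trunc (glO z η hz).1 n = z := by
      have := trunc_gl z η.1
      rwa [hl] at this
    have h4 := ih (η := glO z η hz) (fun m hm => (gl_of_le (by omega) _).trans (ht m hm)) h3 hy
    have h5 : penrose.graph.edist η (glO z η hz) ≤ 1 := by
      rw [SimpleGraph.edist_le_one_iff_adj_or_eq, graph_adj]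
      by_cases h6 : η = glO z η hz
      · exact .inr h6
      · exact .inl ⟨h6, F, h2⟩
    refine SimpleGraph.edist_triangle.trans ((add_le_add h5 h4).trans (le_of_eq ?_))
    push_cast
    exact add_comm _ _

/-- Points with the same tail are close to each other. -/
lemma exists_edist_le : ∃ κ : ℕ, 1 ≤ κ ∧ ∀ k (η ζ : penrose.Omega),
    (∀ m, k + 4 ≤ m → η.1 m = ζ.1 m) → penrose.graph.edist η ζ ≤ (κ * qC k : ℕ) := by
  obtain ⟨κ, hκ, h⟩ := exists_wk_bound
  refine ⟨16 * κ, by omega, fun k η ζ ht => ?_⟩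
  have he := (h k).2
  have h1 : trunc η.1 (k + 4) ∈ tl (psrc (η.1 (k + 4))) (k + 4) :=
    mem_tl.2 ⟨pth_trunc _ _, trunc_length _ _⟩
  have h2 : trunc ζ.1 (k + 4) ∈ tl (psrc (η.1 (k + 4))) (k + 4) := by
    rw [ht _ le_rfl]
    exact mem_tl.2 ⟨pth_trunc _ _, trunc_length _ _⟩
  have h3 := (he _ _ h1 (.l _) (mem_bds.2 rfl)).trans (he _ _ h2 (.l _) (mem_bds.2 rfl)).symm
  exact edist_le_of_wk (h3.mono (by linarith)) ht

/-- A path that ends in `w` and begins with a given path. -/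
lemma exists_pad (w v : Vert) (l : ℕ) (hl : 2 ≤ l) : ∃ u : List Edg, u.length = l ∧
    ∀ x, pth v x → pth w (u ++ x) := by
  induction l, hl using Nat.le_induction generalizing w with
  | base =>
    cases v
    · exact ⟨[c w, a two], rfl, fun x hx => ⟨rfl, rfl, hx⟩⟩
    · exact ⟨[c w, c two], rfl, fun x hx => ⟨rfl, rfl, hx⟩⟩
  | succ l _ ih =>
    obtain ⟨u, h1, h2⟩ := ih two
    exact ⟨c w :: u, by simp [h1], fun x hx => ⟨rfl, h2 x hx⟩⟩

/-- Four edges lead from any vertex of the diagram to any other, so the tile of level n + 4 around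
`η` contains a copy of every 𝒯_{v,n}, and its diameter is a bounded multiple of that of 𝒯_{v,n}. -/
theorem tilesLinearlyRepetitive : penrose.TilesLinearlyRepetitive := by
  obtain ⟨κ, hκ, hd⟩ := exists_edist_le
  refine ⟨κ * (64 * qC 8), fun v n hn η => ?_⟩
  obtain ⟨u, hu, hpad⟩ := exists_pad (psrc (η.1 (n + 4))) v 4 (by omega)
  have hp : ∀ x : penrose.Tile v n, pth (psrc (η.1 (u ++ x.1).length)) (u ++ x.1) := fun x => by
    have h1 := mem_tl.1 (mem_tl_of_tile hn x)
    have h2 : (u ++ x.1).length = n + 4 := by rw [List.length_append, hu, h1.2]; omega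
    rw [h2]
    exact hpad _ h1.1
  have hlen : ∀ x : penrose.Tile v n, (u ++ x.1).length = n + 4 := fun x => by
    rw [List.length_append, hu, (mem_tl.1 (mem_tl_of_tile hn x)).2]; omega
  have htr : ∀ x : penrose.Tile v n, trunc (glO (u ++ x.1) η (hp x)).1 (n + 4) = u ++ x.1 := fun x => by
    have := trunc_gl (u ++ x.1) η.1
    rwa [hlen] at this
  refine ⟨fun x => glO (u ++ x.1) η (hp x), fun x y hxy => ?_, fun F x y h => ?_, ?_⟩
  · have h1 := htr x
    have h2 := htr y
    change glO (u ++ x.1) η (hp x) = glO (u ++ y.1) η (hp y) at hxy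
    rw [hxy, h2] at h1
    exact Subtype.ext (List.append_cancel_left h1.symm)
  · refine ⟨n + 4, ?_, fun k hk => ?_⟩
    · rw [htr, htr]
      exact TE.ext_append h (hp x) (by have := hp y; rwa [hlen, ← hlen x] at this)
    · exact (gl_of_le (by rw [hlen]; exact hk) _).trans (gl_of_le (by rw [hlen]; exact hk) _).symm
  · obtain ⟨x⟩ := (connected_tileGraph v hn).nonempty
    refine ⟨x, (hd n η _ fun m hm => (gl_of_le (by rw [hlen]; exact hm) _).symm).trans ?_⟩
    have h1 := one_le_diam v hn
    -- For n = k + 4 the chain is `qC (k + 4)` ≤ 16 `qC k` ≤ 32 `qD k` ≤ 32(diam + 1) ≤ 64 diam; the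
    -- factor `qC 8` takes care of the small levels.
    suffices h : qC n ≤ 64 * qC 8 * (penrose.tileGraph v n).diam by
      have := Nat.mul_le_mul_left κ h
      rw [← mul_assoc] at this
      exact_mod_cast this
    have hmono : Monotone qC := monotone_nat_of_le_succ fun k => by simp [qC]
    have h8 : 1 ≤ qC 8 := by have := qs_bounds 8; omega
    rcases le_or_gt n 8 with h | h
    · have h2 := hmono h
      calc qC n ≤ 64 * qC 8 * 1 := by omega
        _ ≤ _ := Nat.mul_le_mul_left _ h1
    · obtain ⟨k, rfl⟩ := Nat.exists_eq_add_of_le' (show 4 ≤ n by omega)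
      have h2 := qD_le_diam v k
      have h3 := qC_add_le k 4
      have h4 := qs_bounds k
      have h5 : qC (k + 4) ≤ 64 * (penrose.tileGraph v (k + 4)).diam := by omega
      calc qC (k + 4) ≤ 64 * 1 * (penrose.tileGraph v (k + 4)).diam := by omega
        _ ≤ _ := Nat.mul_le_mul_right _ (Nat.mul_le_mul_left _ h8)

theorem isBoundedType : penrose.IsBoundedType where
  isTileInflation := penrose_isTileInflation
  connected v _ hn := connected_tileGraph v hn
  bdry_bounded := penrose_bdry_bounded
  bdry_finite := penrose_bdry_finite
  repetitive := tilesLinearlyRepetitive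

/-! ### Isomorphisms of balls -/

/-- The points agree from the level `n` on. -/
def Cof (n : ℕ) (u w : penrose.Omega) : Prop := ∀ k, n ≤ k → u.1 k = w.1 k

lemma Cof.symm {n : ℕ} {u w : penrose.Omega} (h : Cof n u w) : Cof n w u := fun k hk => (h k hk).symm

lemma Cof.trans {n : ℕ} {u v w : penrose.Omega} (h : Cof n u v) (h' : Cof n v w) : Cof n u w :=
  fun k hk => (h k hk).trans (h' k hk)

lemma wk_bp_unique {k l : ℕ} {q q' : Bd} (h : Wk l (bp q (k + 4)) (bp q' (k + 4)))
    (hl : l + 2 ≤ qD k) : q = q' := by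
  by_contra hne
  have hn : 2 ≤ k + 4 := by omega
  have h1 := (mem_tl.1 (h.mem_tl (bp_mem hn q))).1
  have h2 := (mem_tl.1 (bp_mem hn q')).1
  have h3 : bp q' (k + 4) ≠ [] := fun h0 => by
    have := bp_length hn q'
    rw [h0] at this
    simp at this
  have := qD_le_of_wk h (h1.unique h3 h2) hne
  omega

/-- The data that determine an isomorphism of the balls of radius `r` around `ζ` and `η`: the
tiles of level `k + 4` that contain these balls, except for what lies behind the boundary points
`p` and `p'`, are matched, and so is what lies behind `p` and `p'`. -/
structure Matched (k r : ℕ) (q : Bd) (ζ p η p' : penrose.Omega) : Prop where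
  le : 2 * r + 2 ≤ qD k
  root : trunc ζ.1 (k + 4) = trunc η.1 (k + 4)
  left : trunc p.1 (k + 4) = bp q (k + 4)
  right : trunc p'.1 (k + 4) = bp q (k + 4)
  cof_left : Cof (k + 4) p ζ
  cof_right : Cof (k + 4) p' η
  far : ∀ q', Wk r (trunc ζ.1 (k + 4)) (bp q' (k + 4)) → q' = q
  trunc_act : trunc (act .L p).1 (k + 4) = trunc (act .L p').1 (k + 4)
  cof_act : Cof (k + 4) (act .L p) p ↔ Cof (k + 4) (act .L p') p'
  edge : ∀ F, relabel F = .L → (penrose.Edge F p (act .L p) ↔ penrose.Edge F p' (act .L p'))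

/-- The correspondence between the balls. -/
def Rel (n : ℕ) (ζ p η p' u u' : penrose.Omega) : Prop :=
  trunc u.1 n = trunc u'.1 n ∧
    (Cof n u ζ ∧ Cof n u' η ∨ Cof n u (act .L p) ∧ Cof n u' (act .L p'))

/-- The position of a point at distance at most `l` from `ζ`. -/
def Near (n : ℕ) (q : Bd) (ζ p : penrose.Omega) (l : ℕ) (u : penrose.Omega) : Prop :=
  Cof n u ζ ∧ Wk l (trunc ζ.1 n) (trunc u.1 n) ∨
  Cof n u (act .L p) ∧ ∃ l₁ l₂, l₁ + l₂ + 1 ≤ l ∧ Wk l₁ (trunc ζ.1 n) (bp q n) ∧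
    Wk l₂ (trunc (act .L p).1 n) (trunc u.1 n)

namespace Matched

variable {k r : ℕ} {q : Bd} {ζ p η p' : penrose.Omega}

lemma symm (h : Matched k r q ζ p η p') : Matched k r q η p' ζ p where
  le := h.le
  root := h.root.symm
  left := h.right
  right := h.left
  cof_left := h.cof_right
  cof_right := h.cof_left
  far := h.root ▸ h.far
  trunc_act := h.trunc_act.symm
  cof_act := h.cof_act.symm
  edge F hF := (h.edge F hF).symm

/-- The two alternatives in `Rel` can conflict only if the tile behind `p` is the tile of `ζ`
itself, and `cof_act` makes this happen on both sides or on neither. -/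
lemma unique (h : Matched k r q ζ p η p') {u u' u'' : penrose.Omega}
    (h1 : Rel (k + 4) ζ p η p' u u') (h2 : Rel (k + 4) ζ p η p' u u'') : u' = u'' := by
  have key : Cof (k + 4) u ζ → Cof (k + 4) u (act .L p) → Cof (k + 4) (act .L p') η := fun h3 h4 =>
    (h.cof_act.1 (h4.symm.trans (h3.trans h.cof_left.symm))).trans h.cof_right
  refine ext_of_trunc (h1.1.symm.trans h2.1) ?_
  rcases h1.2 with ⟨h3, h4⟩ | ⟨h3, h4⟩ <;> rcases h2.2 with ⟨h5, h6⟩ | ⟨h5, h6⟩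
  · exact h4.trans h6.symm
  · exact h4.trans ((key h3 h5).symm.trans h6.symm)
  · exact h4.trans ((key h5 h3).trans h6.symm)
  · exact h4.trans h6.symm

lemma rel_symm {n : ℕ} {u u' : penrose.Omega} (h : Rel n ζ p η p' u u') : Rel n η p' ζ p u' u :=
  ⟨h.1.symm, h.2.imp And.symm And.symm⟩

lemma rel_root (h : Matched k r q ζ p η p') : Rel (k + 4) ζ p η p' ζ η :=
  ⟨h.root, .inl ⟨fun _ _ => rfl, fun _ _ => rfl⟩⟩

/-- An edge inside a tile is copied. An edge leaving a tile starts at a boundary point: in the tile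
of `ζ` this must be `p` by `far`; in the tile behind `p` it must be `act .L p`, because other
boundary points are too far away by `le`. So the ball can only cross back and forth at this one
place. -/
lemma step (h : Matched k r q ζ p η p') {l : ℕ} (hl : l ≤ r) {F : State} {u w : penrose.Omega}
    (hu : Near (k + 4) q ζ p l u) (he : penrose.Edge F u w) : Near (k + 4) q ζ p (l + 1) w ∧
      ∀ u', Rel (k + 4) ζ p η p' u u' → ∃ w', Rel (k + 4) ζ p η p' w w' ∧ penrose.Edge F u' w' := by
  have hn : 2 ≤ k + 4 := by omega
  rcases edge_split he (k + 4) with ⟨h1, h2⟩ | ⟨⟨v, hv⟩, _⟩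
  · refine ⟨?_, fun u' hu' => ?_⟩
    · rcases hu with ⟨h3, h4⟩ | ⟨h3, l₁, l₂, h4, h5, h6⟩
      · exact .inl ⟨(Cof.symm h2).trans h3, h4.trans (.of_TE h1)⟩
      · exact .inr ⟨(Cof.symm h2).trans h3, l₁, l₂ + 1, by omega, h5, h6.trans (.of_TE h1)⟩
    · rw [hu'.1] at h1
      obtain ⟨hy, hl', h3⟩ := edge_of_TE h1
      have h4 : trunc (glO _ u' hy).1 (k + 4) = trunc w.1 (k + 4) := by
        have := trunc_gl (trunc w.1 (k + 4)) u'.1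
        rwa [hl'] at this
      have h5 : Cof (k + 4) (glO _ u' hy) u' := fun j hj => gl_of_le (by omega) _
      exact ⟨_, ⟨h4.symm, hu'.2.imp
        (fun h6 => ⟨(Cof.symm h2).trans h6.1, h5.trans h6.2⟩)
        fun h6 => ⟨(Cof.symm h2).trans h6.1, h5.trans h6.2⟩⟩, h3⟩
  · have hF : relabel F = .L := by
      by_contra hF
      exact hv (sta_ne_L (by rw [trunc_length]; omega) v hF)
    rw [hF] at hv
    obtain ⟨q₁, hq₁⟩ := Option.ne_none_iff_exists'.1 hv
    have hu1 := (sta_L_iff hn (trunc_length _ _)).1 hq₁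
    have hw := act_of_edge he
    rw [hF] at hw
    have hs : Rel (k + 4) ζ p η p' (act .L p) (act .L p') :=
      ⟨h.trunc_act, .inr ⟨fun _ _ => rfl, fun _ _ => rfl⟩⟩
    have hp : Rel (k + 4) ζ p η p' p p' := ⟨h.left.trans h.right.symm, .inl ⟨h.cof_left, h.cof_right⟩⟩
    rcases hu with ⟨h3, h4⟩ | ⟨h3, l₁, l₂, h4, h5, h6⟩
    · rw [hu1] at h4
      obtain rfl := h.far q₁ (h4.mono hl)
      obtain rfl : u = p := ext_of_trunc (hu1.trans h.left.symm) (h3.trans h.cof_left.symm)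
      subst hw
      refine ⟨.inr ⟨fun _ _ => rfl, l, 0, by omega, h4, .refl _ _⟩, fun u' hu' => ?_⟩
      obtain rfl := h.unique hp hu'
      exact ⟨_, hs, (h.edge F hF).1 he⟩
    · obtain ⟨q₂, hq₂⟩ := act_boundary hn h.left
      rw [hu1, hq₂] at h6
      obtain rfl := wk_bp_unique h6 (by have := h.le; omega)
      obtain rfl : u = act .L p := ext_of_trunc (hu1.trans hq₂.symm) h3
      rw [act_act] at hw
      subst hw
      refine ⟨.inl ⟨h.cof_left, ?_⟩, fun u' hu' => ?_⟩
      · rw [h.left]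
        exact h5.mono (by omega)
      · obtain rfl := h.unique hs hu'
        exact ⟨_, hp, edge_symm_iff.2 ((h.edge _ (by rw [relabel_stateInv, hF])).1 (edge_symm he))⟩

lemma near_of_walk (h : Matched k r q ζ p η p') {u w : penrose.Omega} (W : penrose.graph.Walk u w)
    {l : ℕ} (hl : l + W.length ≤ r) (hu : Near (k + 4) q ζ p l u) {u' : penrose.Omega}
    (hu' : Rel (k + 4) ζ p η p' u u') : Near (k + 4) q ζ p (l + W.length) w ∧
      ∃ w', Rel (k + 4) ζ p η p' w w' ∧ penrose.graph.edist u' w' ≤ W.length := by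
  induction W generalizing l u' with
  | nil => exact ⟨hu, u', hu', by simp⟩
  | cons hadj W ih =>
    rw [SimpleGraph.Walk.length_cons] at hl ⊢
    obtain ⟨_, F, hF⟩ := graph_adj.1 hadj
    obtain ⟨h1, h2⟩ := h.step (by omega) hu hF
    obtain ⟨v', h3, h4⟩ := h2 u' hu'
    obtain ⟨h5, w', h6, h7⟩ := ih (by omega) h1 h3
    refine ⟨by rwa [show l + (W.length + 1) = l + 1 + W.length by omega], w', h6, ?_⟩
    have h8 : penrose.graph.edist u' v' ≤ 1 := by
      rw [SimpleGraph.edist_le_one_iff_adj_or_eq, graph_adj]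
      by_cases h9 : u' = v'
      · exact .inr h9
      · exact .inl ⟨h9, F, h4⟩
    refine SimpleGraph.edist_triangle.trans ((add_le_add h8 h7).trans (le_of_eq ?_))
    push_cast
    exact add_comm _ _

lemma near_of_mem_ball (h : Matched k r q ζ p η p') (u : penrose.ball ζ r) :
    Near (k + 4) q ζ p r u.1 ∧ ∃ u' : penrose.ball η r, Rel (k + 4) ζ p η p' u.1 u'.1 := by
  have hu : penrose.graph.edist ζ u.1 ≤ r := u.2
  obtain ⟨W, hW⟩ := SimpleGraph.exists_walk_of_edist_ne_top
    (ne_top_of_le_ne_top (ENat.natCast_ne_top r) hu)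
  have hW' : W.length ≤ r := by
    rw [← hW] at hu
    exact_mod_cast hu
  obtain ⟨h1, u', h2, h3⟩ := h.near_of_walk W (l := 0) (by omega)
    (.inl ⟨fun _ _ => rfl, .refl _ _⟩) h.rel_root
  refine ⟨?_, ⟨u', h3.trans (by exact_mod_cast hW')⟩, h2⟩
  rcases h1 with ⟨h4, h5⟩ | ⟨h4, l₁, l₂, h5, h6⟩
  · exact .inl ⟨h4, h5.mono (by omega)⟩
  · exact .inr ⟨h4, l₁, l₂, by omega, h6⟩

theorem ballIso (h : Matched k r q ζ p η p') : penrose.BallIso ζ η r := by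
  choose f hf using fun u => (h.near_of_mem_ball u).2
  choose g hg using fun u => (h.symm.near_of_mem_ball u).2
  refine ⟨⟨f, g, fun u => ?_, fun u => ?_⟩, fun u hu => ?_, fun F u w => ⟨fun he => ?_, fun he => ?_⟩⟩
  · exact Subtype.ext (h.symm.unique (hg (f u)) (rel_symm (hf u)))
  · exact Subtype.ext (h.unique (hf (g u)) (rel_symm (hg u)))
  · have := hf u
    rw [hu] at this
    exact h.unique this h.rel_root
  · obtain ⟨w', h1, h2⟩ := (h.step le_rfl (h.near_of_mem_ball u).1 he).2 _ (hf u)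
    rw [h.unique h1 (hf w)] at h2
    exact h2
  · obtain ⟨w', h1, h2⟩ := (h.symm.step le_rfl (h.symm.near_of_mem_ball (f u)).1 he).2 _
      (rel_symm (hf u))
    rw [h.symm.unique h1 (rel_symm (hf w))] at h2
    exact h2

end Matched

/-! ### The connections behind the boundary points -/

lemma exists_cr_of_TE {F : State} {γ : ℕ → Edg} {n : ℕ} {y : List Edg} (h : TE F (trunc γ n) y) :
    ∃ j z, cr (γ j) (sta (relabel F) (trunc γ j) (psrc (γ j))) (trunc γ j) = some z ∧
      F = lab (relabel F) (γ j) (sta (relabel F) (trunc γ j) (psrc (γ j))) j := by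
  induction n generalizing y with
  | zero => exact absurd h TE.nil_left
  | succ n ih =>
    rcases TE_cons.1 h with ⟨g, h1, h2⟩ | ⟨y', _, h, _⟩
    · have hg : relabel F = g := by rw [h2, relabel_lab]
      rw [trunc_length] at h2
      subst hg
      exact ⟨n, y, h1, h2⟩
    · exact ih h

/-- The truncation by one level of the boundary points. -/
def down : Bd → Bd
  | .s one => .l one
  | .m => .s two
  | _ => .l two

lemma trunc_bp_succ {γ : ℕ → Edg} {n : ℕ} (hn : 2 ≤ n) {q : Bd} (h : trunc γ (n + 1) = bp q (n + 1)) :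
    trunc γ n = bp (down q) n := by
  rcases q with (_ | _) | (_ | _) | _
  · rw [← cons_l hn] at h; exact (List.cons.inj h).2
  · rw [← cons_l hn] at h; exact (List.cons.inj h).2
  · rw [← cons_a_l hn] at h; exact (List.cons.inj h).2
  · rw [← cons_b_l hn] at h; exact (List.cons.inj h).2
  · rw [← cons_b_s hn] at h; exact (List.cons.inj h).2

lemma trunc_bp_add {γ : ℕ → Edg} {n : ℕ} (hn : 2 ≤ n) {q : Bd} (d : ℕ)
    (h : trunc γ (n + d) = bp q (n + d)) : trunc γ n = bp (down^[d] q) n := by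
  induction d generalizing q with
  | zero => exact h
  | succ d ih =>
    rw [Function.iterate_succ_apply]
    exact ih (trunc_bp_succ (by omega) h)

lemma down_iterate (d : ℕ) (q : Bd) : down^[min d 2] q = down^[d] q := by
  have h2 : ∀ q, down^[2] q = .l two := by
    intro q
    rcases q with (_ | _) | (_ | _) | _ <;> rfl
  rcases le_total d 2 with h | h
  · rw [min_eq_left h]
  · obtain ⟨d, rfl⟩ := Nat.exists_eq_add_of_le' h
    rw [min_eq_right h, h2, Function.iterate_add_apply, h2]
    exact (Function.iterate_fixed rfl d).symm

/-- `e` followed by a boundary point of type `Q` is connected by `L` with `e'` followed by a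
boundary point of type `Q'`. -/
structure Cross (e : Edg) (Q : Bd) (e' : Edg) (Q' : Bd) : Prop where
  cr_bp : ∀ N, 2 ≤ N → cr e (some Q) (bp Q N) = some (e' :: bp Q' N)
  eq : e = e' → Q = Q'
  lab : ∀ N, 4 ≤ N → lab .L e (some Q) N = .Lc

lemma exists_cross {e : Edg} {Q : Bd} {x z : List Edg} (h : cr e (some Q) x = some z) :
    ∃ e' Q', Cross e Q e' Q' := by
  have lab4 : ∀ e Q N, 4 ≤ N → lab .L e (some Q) N = .Lc := by
    intro e Q N hN
    obtain ⟨N, rfl⟩ := Nat.exists_eq_add_of_le' hN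
    rcases e with (_ | _) | (_ | _) | _ <;> rcases Q with (_ | _) | (_ | _) | _ <;> rfl
  rcases cr_eq_some h with ⟨i, rfl, h2, rfl⟩ | ⟨i, rfl, h2, rfl⟩ | ⟨rfl, h2, rfl⟩ |
    ⟨rfl, h2, rfl⟩ | ⟨rfl, h2, rfl⟩ <;> obtain rfl := Option.some.inj h2
  · refine ⟨c i, .s two, fun N hN => ?_, by simp, lab4 _ _⟩
    obtain ⟨N, rfl⟩ := Nat.exists_eq_add_of_le' hN
    simp [cr, bp, lam, cv, List.replicate_succ]
  · refine ⟨a i, .s one, fun N hN => ?_, by simp, lab4 _ _⟩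
    obtain ⟨N, rfl⟩ := Nat.exists_eq_add_of_le' hN
    simp [cr, bp, lam, cv, List.replicate_succ]
  · exact ⟨c two, .m, fun N hN => rfl, by simp, lab4 _ _⟩
  · exact ⟨b, .m, fun N hN => rfl, by simp, lab4 _ _⟩
  · exact ⟨a two, .l one, fun N hN => rfl, by simp, lab4 _ _⟩

/-- Behind a boundary point there is no edge labeled `L`, or it is a connection of a higher level. -/
lemma exists_cross_of_edge {γ ζ : penrose.Omega} {n : ℕ} (hn : 4 ≤ n) {q : Bd}
    (h : trunc γ.1 n = bp q n) {F : State} (hF : relabel F = .L) (he : penrose.Edge F γ ζ) :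
    ∃ d e Q e' Q', Cross e Q e' Q' ∧ trunc γ.1 (n + d + 1) = e :: bp Q (n + d) := by
  obtain ⟨m, h1, -⟩ := he
  obtain ⟨j, z, h2, h3⟩ := exists_cr_of_TE h1
  rw [hF] at h2 h3
  have hj : n ≤ j := by
    by_contra hj
    obtain ⟨u, -, h4⟩ := trunc_append γ.1 (show j + 1 ≤ n by omega)
    have h5 : sta .L (u ++ trunc γ.1 (j + 1)) one ≠ none := by
      rw [← h4, h, sta_bp (by omega)]
      simp
    obtain ⟨w, h6⟩ := sta_suffix h5
    rw [cr_none_of_stp h6] at h2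
    simp at h2
  obtain ⟨d, rfl⟩ := Nat.exists_eq_add_of_le hj
  obtain ⟨Q, hQ⟩ := Option.ne_none_iff_exists'.1 (cr_ne h2)
  rw [hQ] at h2
  obtain ⟨e', Q', hc⟩ := exists_cross h2
  refine ⟨d, _, Q, e', Q', hc, ?_⟩
  rw [trunc, (sta_L_iff (by omega) (trunc_length _ _)).1 hQ]

/-- The action of `L` at a connection. -/
lemma Cross.act {e e' : Edg} {Q Q' : Bd} (hc : Cross e Q e' Q') {γ : penrose.Omega} {N : ℕ}
    (hN : 4 ≤ N) (h : trunc γ.1 (N + 1) = e :: bp Q N) : penrose.Edge .Lc γ (act .L γ) ∧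
      trunc (act .L γ).1 (N + 1) = e' :: bp Q' N ∧ Cof (N + 1) (act .L γ) γ := by
  have h1 : TE .Lc (trunc γ.1 (N + 1)) (e' :: bp Q' N) := by
    rw [h]
    refine TE_cons.2 (.inl ⟨.L, ?_, ?_⟩)
    · rw [sta_bp (by omega), hc.cr_bp N (by omega)]
    · rw [sta_bp (by omega), bp_length (by omega), hc.lab N hN]
  obtain ⟨hy, hl, h2⟩ := edge_of_TE h1
  have h3 : TileInfl.act .L γ = _ := act_of_edge h2
  rw [h3]
  refine ⟨h2, ?_, fun j hj => gl_of_le (by omega) _⟩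
  have := trunc_gl (e' :: bp Q' N) γ.1
  rwa [hl] at this

/-- What `Matched` requires about the points `p` and `p'`. -/
def Alike (n : ℕ) (p p' : penrose.Omega) : Prop :=
  trunc (act .L p).1 n = trunc (act .L p').1 n ∧
  (Cof n (act .L p) p ↔ Cof n (act .L p') p') ∧
  ∀ F, relabel F = .L → (penrose.Edge F p (act .L p) ↔ penrose.Edge F p' (act .L p'))

/-- From level 4 on every connection carries the label `Lc` and has the same shape on all levels. So
the height of the connection enters only through the type to which its ends are truncated. -/
lemma Cross.alike {e e' : Edg} {Q Q' : Bd} (hc : Cross e Q e' Q') {p p' : penrose.Omega} {n d d' : ℕ}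
    (hn : 4 ≤ n) (hd : ∀ q, down^[d] q = down^[d'] q) (h : trunc p.1 (n + d + 1) = e :: bp Q (n + d))
    (h' : trunc p'.1 (n + d' + 1) = e :: bp Q (n + d')) : Alike n p p' := by
  obtain ⟨h1, h2, h3⟩ := hc.act (by omega) h
  obtain ⟨h1', h2', h3'⟩ := hc.act (by omega) h'
  have key : ∀ {p : penrose.Omega} {d : ℕ}, trunc p.1 (n + d + 1) = e :: bp Q (n + d) →
      trunc (TileInfl.act .L p).1 (n + d + 1) = e' :: bp Q' (n + d) →
      Cof (n + d + 1) (TileInfl.act .L p) p → (Cof n (TileInfl.act .L p) p ↔ e = e') := by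
    intro p d h h2 h3
    constructor
    · intro h4
      rw [← (List.cons.inj h).1, ← (List.cons.inj h2).1]
      exact (h4 (n + d) (by omega)).symm
    · intro h4
      rw [ext_of_trunc (h2.trans (by rw [h, h4, hc.eq h4])) h3]
      exact fun _ _ => rfl
  refine ⟨?_, ?_, fun F hF => ⟨fun h4 => ?_, fun h4 => ?_⟩⟩
  · rw [trunc_bp_add (by omega) d (List.cons.inj h2).2,
      trunc_bp_add (by omega) d' (List.cons.inj h2').2, hd]
  · rw [key h h2 h3, key h' h2' h3']
  · obtain rfl := (edge_unique h4 h1 hF).1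
    exact h1'
  · obtain rfl := (edge_unique h4 h1' hF).1
    exact h1

lemma alike_of_not_edge {p p' : penrose.Omega} {n : ℕ} (h : trunc p.1 n = trunc p'.1 n)
    (h1 : ∀ F ζ, relabel F = .L → ¬ penrose.Edge F p ζ)
    (h2 : ∀ F ζ, relabel F = .L → ¬ penrose.Edge F p' ζ) : Alike n p p' := by
  have h3 := act_of_not_edge h1
  have h4 := act_of_not_edge h2
  refine ⟨by rw [h3, h4, h], ?_, fun F hF => iff_of_false (h1 F _ hF) (h2 F _ hF)⟩
  rw [h3, h4]
  exact iff_of_true (fun _ _ => rfl) fun _ _ => rfl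

/-- The path c₁μ₂ is neither a connecting point nor a boundary point for L. It serves as the model
of a boundary point with nothing behind it. -/
lemma not_edge_of_trunc {γ : penrose.Omega} {N : ℕ} (hN : 4 ≤ N)
    (h : trunc γ.1 (N + 1) = c one :: bp .m N) (F : State) (ζ : penrose.Omega) (hF : relabel F = .L) :
    ¬ penrose.Edge F γ ζ := by
  intro he
  obtain ⟨d, e, Q, e', Q', hc, h1⟩ := exists_cross_of_edge hN (List.cons.inj h).2 hF he
  rcases d with _ | d
  · obtain ⟨rfl, h2⟩ := List.cons.inj (h1.symm.trans h)
    have h3 := hc.cr_bp N (by omega)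
    have h4 := sta_bp (n := N) (by omega) Q one
    rw [show bp Q N = bp .m N from h2, sta_bp (by omega)] at h4
    obtain rfl := Option.some.inj h4
    simp [cr] at h3
  · have h2 : trunc γ.1 (N + 1 + d) = bp Q (N + 1 + d) := by
      have := (List.cons.inj h1).2
      rwa [show N + (d + 1) = N + 1 + d by omega] at this
    have h3 := trunc_bp_add (by omega) d h2
    have h4 := sta_bp (n := N + 1) (by omega) (down^[d] Q) one
    rw [← h3, h, sta_cons, sta_bp (by omega)] at h4
    simp [stp] at h4

/-- Behind the boundary points of the first tile there is always an edge labeled `L`. -/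
lemma exists_edge_of_vert {γ : penrose.Omega} {n : ℕ} (hn : 4 ≤ n) {q : Bd} (hq : q.vert = one)
    (h : trunc γ.1 n = bp q n) : ∃ F ζ, relabel F = .L ∧ penrose.Edge F γ ζ := by
  have hv : ∃ i, γ.1 n = a i := by
    have h1 := pth_trunc γ n
    rw [h] at h1
    have h2 := (mem_tl.1 (bp_mem (by omega : 2 ≤ n) q)).1
    have h3 : bp q n ≠ [] := fun h0 => by
      have := bp_length (by omega : 2 ≤ n) q
      rw [h0] at this
      simp at this
      omega
    have h4 := h1.unique h3 h2
    rw [hq] at h4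
    generalize γ.1 n = e at h4
    rcases e with i | i | _
    · exact ⟨i, rfl⟩
    · simp [psrc] at h4
    · simp [psrc] at h4
  have key : ∀ {N e Q z}, 4 ≤ N → trunc γ.1 (N + 1) = e :: bp Q N →
      cr e (some Q) (bp Q N) = some z → ∃ F ζ, relabel F = .L ∧ penrose.Edge F γ ζ := by
    intro N e Q z hN h1 h2
    obtain ⟨e', Q', hc⟩ := exists_cross h2
    exact ⟨.Lc, _, rfl, (hc.act hN h1).1⟩
  obtain ⟨i, hi⟩ := hv
  have h1 : trunc γ.1 (n + 1) = a i :: bp q n := by rw [trunc, hi, h]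
  -- After λ₁ the edge a₂ gives the loop, while a₁ leads to σ₁ of the next level; after σ₁ either
  -- edge a_j is a connection.
  rcases q with (_ | _) | (_ | _) | _ <;> simp [Bd.vert] at hq
  · cases i
    · rw [cons_a_l (by omega)] at h1
      have h2 : psrc (γ.1 (n + 1)) = one := by
        have := γ.2 n
        rw [hi] at this
        exact this.symm
      obtain ⟨j, hj⟩ : ∃ j, γ.1 (n + 1) = a j := by
        generalize γ.1 (n + 1) = e at h2
        rcases e with i | i | _
        · exact ⟨i, rfl⟩
        · simp [psrc] at h2
        · simp [psrc] at h2
      exact key (N := n + 1) (by omega) (by rw [trunc, hj, h1]) (by rw [cr])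
    · exact key hn h1 (by rw [cr])
  · exact key hn h1 (by rw [cr])

/-- Every boundary point occurs, with everything behind it, near every point. -/
lemma exists_alike {n : ℕ} (hn : 4 ≤ n) {q : Bd} {p : penrose.Omega} (h : trunc p.1 n = bp q n)
    (η : penrose.Omega) : ∃ p', trunc p'.1 n = bp q n ∧ Cof (n + 5) p' η ∧ Alike n p p' := by
  have key : ∀ (e : Edg) (Q : Bd) (d : ℕ), d ≤ 2 → psrc e = Q.vert → ∃ p' : penrose.Omega,
      trunc p'.1 (n + d + 1) = e :: bp Q (n + d) ∧ Cof (n + 5) p' η := by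
    intro e Q d hd he
    obtain ⟨u, hu, h1⟩ := exists_pad (psrc (η.1 (n + 5))) (prng e) (4 - d) (by omega)
    have h2 : pth (prng e) (e :: bp Q (n + d)) :=
      ⟨rfl, he ▸ (mem_tl.1 (bp_mem (by omega : 2 ≤ n + d) Q)).1⟩
    have hlen : (e :: bp Q (n + d)).length = n + d + 1 := by
      rw [List.length_cons, bp_length (by omega)]
    have hl : (u ++ e :: bp Q (n + d)).length = n + 5 := by
      rw [List.length_append, hlen]; omega
    have h3 : pth (psrc (η.1 (u ++ e :: bp Q (n + d)).length)) (u ++ e :: bp Q (n + d)) := by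
      rw [hl]
      exact h1 _ h2
    refine ⟨glO _ η h3, ?_, fun j hj => gl_of_le (by omega) _⟩
    have h4 : trunc (glO _ η h3).1 (n + 5) = u ++ e :: bp Q (n + d) := by
      have := trunc_gl (u ++ e :: bp Q (n + d)) η.1
      rwa [hl] at this
    have h5 := trunc_drop (glO _ η h3).1 (n + d + 1) (4 - d)
    rw [show n + d + 1 + (4 - d) = n + 5 by omega, h4, ← hu, List.drop_left] at h5
    exact h5.symm
  have inj : ∀ {Q : Bd}, bp Q n = bp q n → Q = q := fun {Q} h0 => by
    have h4 := sta_bp (by omega : 2 ≤ n) Q one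
    rw [h0, sta_bp (by omega)] at h4
    exact (Option.some.inj h4).symm
  by_cases he : ∃ F ζ, relabel F = .L ∧ penrose.Edge F p ζ
  · obtain ⟨F, ζ, hF, he⟩ := he
    obtain ⟨d, e, Q, e', Q', hc, h1⟩ := exists_cross_of_edge hn h hF he
    have hv : psrc e = Q.vert := by
      have h2 := pth_trunc p (n + d + 1)
      rw [h1] at h2
      have h3 := (mem_tl.1 (bp_mem (by omega : 2 ≤ n + d) Q)).1
      refine h2.2.unique (fun h0 => ?_) h3
      have := bp_length (by omega : 2 ≤ n + d) Q
      rw [h0] at this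
      simp at this
      omega
    -- Two truncations bring every type to λ₂, where it stays. So a connection at height `d` can be
    -- replaced by the same one at height at most 2, which fits into five levels.
    obtain ⟨p', h2, h3⟩ := key e Q (min d 2) (min_le_right _ _) hv
    refine ⟨p', ?_, h3, hc.alike hn (fun q => (down_iterate d q).symm) h1 h2⟩
    rw [trunc_bp_add (by omega) _ (List.cons.inj h2).2, down_iterate,
      ← trunc_bp_add (by omega) d (List.cons.inj h1).2, h]
  -- With nothing behind it the boundary point lies in the second tile, and each type there is a
  -- truncation of μ₂; it is then placed below c₁μ₂.
  · have hq : ∃ d ≤ 2, down^[d] .m = q := by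
      have h0 : q.vert ≠ one := fun h0 => he (exists_edge_of_vert hn h0 h)
      rcases q with (_ | _) | (_ | _) | _ <;> simp [Bd.vert] at h0
      · exact ⟨2, le_rfl, rfl⟩
      · exact ⟨1, by omega, rfl⟩
      · exact ⟨0, by omega, rfl⟩
    obtain ⟨d, hd, rfl⟩ := hq
    obtain ⟨p', h2, h3⟩ := key (c one) .m d hd rfl
    have h4 := trunc_bp_add (by omega) _ (List.cons.inj h2).2
    refine ⟨p', h4, h3, alike_of_not_edge (h.trans h4.symm) (fun F ζ h5 h6 => he ⟨F, ζ, h5, h6⟩) ?_⟩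
    exact not_edge_of_trunc (by omega) h2

lemma exists_ballIso {k r : ℕ} (hr : 2 * r + 2 ≤ qD k) (ζ η : penrose.Omega) :
    ∃ η', Cof (k + 5 + 4) η η' ∧ penrose.BallIso ζ η' r := by
  have hn : 2 ≤ k + 4 := by omega
  have hζ : trunc ζ.1 (k + 4) ∈ tl (psrc (ζ.1 (k + 4))) (k + 4) :=
    mem_tl.2 ⟨pth_trunc _ _, trunc_length _ _⟩
  obtain ⟨q, hq, hfar⟩ : ∃ q : Bd, q.vert = psrc (ζ.1 (k + 4)) ∧
      ∀ q', Wk r (trunc ζ.1 (k + 4)) (bp q' (k + 4)) → q' = q := by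
    by_cases h : ∃ q, Wk r (trunc ζ.1 (k + 4)) (bp q (k + 4))
    · obtain ⟨q, h⟩ := h
      refine ⟨q, ?_, fun q' h' => wk_bp_unique (h'.symm.trans h) (by omega)⟩
      have h1 := (mem_tl.1 (h.mem_tl hζ)).1
      have h2 := (mem_tl.1 (bp_mem hn q)).1
      refine h2.unique (fun h0 => ?_) h1
      have := bp_length hn q
      rw [h0] at this
      simp at this
    -- No boundary point is within reach, so any one of the tile will do.
    · exact ⟨.l _, rfl, fun q' h' => absurd ⟨q', h'⟩ h⟩
  have glue : ∀ (x : List Edg) (v : Vert) (γ : penrose.Omega), x ∈ tl v (k + 4) →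
      v = psrc (γ.1 (k + 4)) → ∃ δ : penrose.Omega, trunc δ.1 (k + 4) = x ∧ Cof (k + 4) δ γ := by
    rintro x v γ hx rfl
    obtain ⟨h1, h2⟩ := mem_tl.1 hx
    refine ⟨glO x γ (by rwa [h2]), ?_, fun j hj => gl_of_le (by omega) _⟩
    have := trunc_gl x γ.1
    rwa [h2] at this
  obtain ⟨p, hp, hpc⟩ := glue _ _ ζ (bp_mem hn q) hq
  obtain ⟨p', hp', hpc', h1, h2, h3⟩ := exists_alike (by omega) hp η
  have hv : psrc (ζ.1 (k + 4)) = psrc (p'.1 (k + 4)) := by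
    have h4 := pth_trunc p' (k + 4)
    rw [hp'] at h4
    rw [← hq]
    refine ((mem_tl.1 (bp_mem hn q)).1).unique (fun h0 => ?_) h4
    have := bp_length hn q
    rw [h0] at this
    simp at this
  obtain ⟨η', h4, h5⟩ := glue _ _ p' hζ hv
  refine ⟨η', fun j hj => ((h5 j (by omega)).trans (hpc' j (by omega))).symm,
    Matched.ballIso (k := k) (q := q) (p := p) (p' := p')
      ⟨hr, h4.symm, hp, hp', hpc, h5.symm, hfar, h1, h2, h3⟩⟩

theorem linearlyRepetitive : penrose.LinearlyRepetitive := by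
  obtain ⟨κ, hκ, hd⟩ := exists_edist_le
  refine ⟨κ * 384 + 1, by norm_cast; omega, fun r => κ * 384 * r, fun r hr => ?_, fun r hr ζ _ η => ?_⟩
  · have : (1 : ℝ) ≤ r := by exact_mod_cast hr
    push_cast
    linarith
  · have hex : ∃ k, 2 * r + 2 ≤ qD k := ⟨2 * (2 * r + 2), by have := lt_qD (2 * (2 * r + 2)); omega⟩
    classical
    have h1 := Nat.find_spec hex
    obtain ⟨k, hk⟩ : ∃ k, Nat.find hex = k + 1 := by
      refine Nat.exists_eq_succ_of_ne_zero fun h0 => ?_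
      rw [h0] at h1
      simp [qD] at h1
    have h2 := Nat.find_min hex (show k < Nat.find hex by omega)
    rw [hk] at h1
    obtain ⟨η', h3, h4⟩ := exists_ballIso h1 ζ η
    refine ⟨η', (hd (k + 1 + 5) η η' h3).trans ?_, h4⟩
    have h5 := qC_add_le k 6
    have h6 := qs_bounds k
    -- By minimality `qD k` ≤ 2r + 1 ≤ 3r, hence `qC (k + 6)` ≤ 64 `qC k` ≤ 128 `qD k` ≤ 384r.
    have h7 : qC (k + 1 + 5) ≤ 384 * r := by
      rw [show k + 1 + 5 = k + 6 by omega]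
      omega
    have := Nat.mul_le_mul_left κ h7
    rw [← mul_assoc] at this
    exact_mod_cast this

end TileInfl

theorem mainTheorem6 :
    TileInfl.penrose.LinearlyRepetitive ∧ TileInfl.penrose.IsBoundedType ∧
    ∃ X : TileInfl.Gen → (TileInfl.penrose.Omega ≃ₜ TileInfl.penrose.Omega),
      TileInfl.IsRelabeling X ∧
      (∃ P, TileInfl.IsPartition (X .L) P) ∧
      ∃ β η : ℝ, β = (3 + Real.sqrt 5) / 2 ∧
        Filter.Tendsto
          (fun n : ℕ => (Nat.card (TileInfl.penrose.Tile .two n) : ℝ) ^ ((1 : ℝ) / (n : ℝ)))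
          Filter.atTop (nhds β) ∧
        0 < η ∧ η ^ 5 + η ^ 4 + η ^ 3 - 2 = 0 ∧
        (∀ x : ℝ, 0 < x → x ^ 5 + x ^ 4 + x ^ 3 - 2 = 0 → x = η) ∧
        |η - 0.9028| < 0.00005 ∧
        |Real.log β / (Real.log β - Real.log η) - 0.9040| < 0.00005 ∧
        ∀ P, TileInfl.IsPartition (X .L) P →
          ∃ N : Fin 3 → (TileInfl.penrose.Omega ≃ₜ TileInfl.penrose.Omega),
            TileInfl.IsFragmentation (X .L) P N ∧
            ∀ α : ℝ, Real.log β / (Real.log β - Real.log η) < α →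
              ∃ C : ℝ, 1 ≤ C ∧ ∀ R : ℕ, 1 ≤ R →
                (TileInfl.growth {N 0, N 1, N 2, X .M, X .S} R : ℝ) ≤
                  Real.exp ((C * (R : ℝ)) ^ α) := by
  obtain ⟨η, h1, h2, h3⟩ := TileInfl.exists_root
  refine ⟨TileInfl.linearlyRepetitive, TileInfl.isBoundedType, TileInfl.genHomeo,
    TileInfl.isRelabeling_genHomeo, ⟨_, TileInfl.isPartition_stdPiece⟩, (3 + Real.sqrt 5) / 2, η, rfl,
    TileInfl.tendsto_card_tile, by linarith, h3, fun x hx h => ?_, ?_,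
    TileInfl.abs_exponent_sub h1 h2, fun P hP => ⟨_, TileInfl.isFragmentation_hom hP, fun α hα => ?_⟩⟩
  · rcases lt_trichotomy x η with h4 | h4 | h4
    · have := TileInfl.quintic_strictMono hx.le h4
      linarith
    · exact h4
    · have := TileInfl.quintic_strictMono (by linarith) h4
      linarith
  · rw [abs_lt]
    constructor <;> linarith
  -- At η itself the constant in the weights vanishes, so a rate slightly above η is used; the
  -- strict inequality for α leaves room for it.
  · obtain ⟨h, H, h4⟩ := TileInfl.exists_rate (by linarith) (by linarith) h3 TileInfl.log_golden_pos hα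
    exact TileInfl.exists_growth_le_rpow hP H h4
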